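/- **Theorem.** Fix $p \in \{1, 2, 3, \dots\} \cup \{\infty\}$. The following decision problem is solvable in polynomial time: given a finite simple graph $G = (V, E)$ and an edge-linear function $f : G \to [0, \infty)$, decide whether $\mathbf{ucat}_s^p(f) \le 2$. Here $G$ also denotes the geometric realization of the graph as a one-dimensional simplicial complex, and $f$ is edge linear if $f(c v_0 + (1 - c) v_1) = c f(v_0) + (1 - c) f(v_1)$ for every edge $(v_0, v_1)$ and all $c \in [0, 1]$. The input consists of the graph, given by its adjacency matrix, and the values of $f$ at the vertices, which are nonnegative rational numbers given by numerator and denominator in binary. Polynomial time means time bounded by a polynomial in the bit length of the input, on a random access machine with logarithmic cost (equivalently, on a Turing machine). A continuous function $g : X \to [0, \infty)$ on a topological space $X$ is unimodal if $\{g \ge c\}$ is contractible or empty for every $c > 0$. The strong unimodal category $\mathbf{ucat}_s^p(f)$ is the smallest $k \ge 0$ (or $\infty$, if there is none) for which there exist unimodal functions $f_1, \dots, f_k : X \to [0, \infty)$ such that $\sum_{i=1}^k f_i(x)^p = f(x)^p$ for all $x \in X$ (for $p = \infty$: $\max_{1 \le i \le k} f_i(x) = f(x)$ for all $x \in X$,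 where the maximum of no functions is $0$), and such that the intersection of any nonempty finite collection of superlevel sets $\{f_{i_l} > c_l\}$, $c_l \ge 0$, is contractible or empty. -/

import Mathlib

open scoped NNReal

/-! ## Geometric realization of a graph and edge-linear functions -/

/-- The point of `V → ℝ` that represents the vertex `v` in barycentric coordinates. -/
noncomputable def vertexPoint {V : Type} [DecidableEq V] (v : V) : V → ℝ :=
  Pi.single v 1

/-- The geometric realization of a finite simple graph as a one-dimensional geometric simplicial
complex in `V → ℝ`: its points are the vertices and the points `c • u + (1 - c) • v` of the edges
`{u, v}`, in barycentric coordinates. It carries the subspace topology. -/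
def realization {V : Type} [Fintype V] [DecidableEq V] (G : SimpleGraph V) : Set (V → ℝ) :=
  {x | ∃ v : V, x = vertexPoint v} ∪
    {x | ∃ u v : V, G.Adj u v ∧ x ∈ segment ℝ (vertexPoint u) (vertexPoint v)}

/-- The edge-linear function on the realization of `G` with prescribed values at the vertices.
The barycentric coordinates `x v` are nonnegative and sum to one, and at most two of them, those
at the ends of an edge, do not vanish. -/
noncomputable def edgeLinear {V : Type} [Fintype V] [DecidableEq V] (G : SimpleGraph V)
    (f : V → ℝ≥0) (x : realization G) : ℝ≥0 :=
  ∑ v : V, Real.toNNReal (x.1 v) * f v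

/-! ## The strong unimodal category -/

/-- A subset of a topological space that is contractible or empty. -/
def ContractibleOrEmpty {X : Type} [TopologicalSpace X] (S : Set X) : Prop :=
  S = ∅ ∨ ContractibleSpace S

/-- A continuous function `X → [0, ∞)` is unimodal if each superlevel set `{f ≥ c}` with `c > 0`
is contractible or empty. -/
def IsUnimodal {X : Type} [TopologicalSpace X] (f : X → ℝ≥0) : Prop :=
  Continuous f ∧ ∀ c : ℝ≥0, 0 < c → ContractibleOrEmpty {x | c ≤ f x}

/-- The functions `F i` decompose `f` with exponent `p`: the sum of the `p`-th powers is `f ^ p`,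
and for `p = ∞` the maximum is `f`. (The maximum of no functions `X → [0, ∞)` is `0`.) -/
def DecomposesTo {X : Type} (p : ℕ∞) {k : ℕ} (F : Fin k → X → ℝ≥0) (f : X → ℝ≥0) : Prop :=
  match p with
  | ⊤ => ∀ x, (Finset.univ.sup fun i => F i x) = f x
  | (q : ℕ) => ∀ x, ∑ i, F i x ^ q = f x ^ q

/-- `F` is a strong unimodal decomposition of `f`: the `F i` are unimodal, they decompose `f`, and
every intersection of a nonempty collection of superlevel sets `{F i > c i}`, `c i ≥ 0`, is
contractible or empty. (Several superlevel sets of one `F i` intersect in the one with the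
largest threshold, so one threshold for each index is enough.) -/
def IsStrongDecomposition {X : Type} [TopologicalSpace X] (p : ℕ∞) {k : ℕ}
    (F : Fin k → X → ℝ≥0) (f : X → ℝ≥0) : Prop :=
  (∀ i, IsUnimodal (F i)) ∧ DecomposesTo p F f ∧
    ∀ J : Finset (Fin k), J.Nonempty → ∀ c : Fin k → ℝ≥0,
      ContractibleOrEmpty {x | ∀ i ∈ J, c i < F i x}

/-- The strong unimodal category: the smallest number of functions in a strong unimodal
decomposition of `f` (`⊤` if there is none). -/
noncomputable def strongUcat {X : Type} [TopologicalSpace X] (p : ℕ∞) (f : X → ℝ≥0) : ℕ∞ :=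
  sInf {m : ℕ∞ | ∃ k : ℕ, m = k ∧ ∃ F : Fin k → X → ℝ≥0, IsStrongDecomposition p F f}

/-! ## Random access machines with logarithmic cost

Structured programs for a random access machine with registers `reg 0, reg 1, …` and memory cells
`mem 0, mem 1, …`, all holding natural numbers. Every operation is charged the bit lengths of the
numbers and addresses that it handles, plus one; with this cost measure, polynomial time is the
same as polynomial time on Turing machines. -/

namespace RAM

/-- The contents of the registers and of the memory. -/
structure State where
  reg : ℕ → ℕ
  mem : ℕ → ℕ

/-- Arithmetic expressions; `cell e` reads the memory cell whose address is the value of `e`. -/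
inductive Expr where
  | const (a : ℕ)
  | reg (r : ℕ)
  | cell (e : Expr)
  | add (e₁ e₂ : Expr)
  | sub (e₁ e₂ : Expr)
  | mul (e₁ e₂ : Expr)

/-- The value of an expression; subtraction is truncated at `0`. -/
def Expr.eval (s : State) : Expr → ℕ
  | const a => a
  | reg r => s.reg r
  | cell e => s.mem (e.eval s)
  | add e₁ e₂ => e₁.eval s + e₂.eval s
  | sub e₁ e₂ => e₁.eval s - e₂.eval s
  | mul e₁ e₂ => e₁.eval s * e₂.eval s

/-- The logarithmic cost of evaluating an expression (`Nat.size` is the bit length). -/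
def Expr.cost (s : State) : Expr → ℕ
  | const a => a.size + 1
  | reg r => (s.reg r).size + 1
  | cell e => e.cost s + (e.eval s).size + (s.mem (e.eval s)).size + 1
  | add e₁ e₂ => e₁.cost s + e₂.cost s + (e₁.eval s).size + (e₂.eval s).size + 1
  | sub e₁ e₂ => e₁.cost s + e₂.cost s + (e₁.eval s).size + (e₂.eval s).size + 1
  | mul e₁ e₂ => e₁.cost s + e₂.cost s + (e₁.eval s).size + (e₂.eval s).size + 1

/-- Programs: `set r e` writes the value of `e` to register `r`, and `store a e` writes it to the
memory cell whose address is the value of `a`. Conditions hold when their value is not `0`. -/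
inductive Program where
  | skip
  | set (r : ℕ) (e : Expr)
  | store (a e : Expr)
  | seq (P Q : Program)
  | ite (e : Expr) (P Q : Program)
  | loop (e : Expr) (P : Program)

/-- `Run P s t s'`: the program `P`, started in state `s`, halts in state `s'` after time `t`. -/
inductive Run : Program → State → ℕ → State → Prop
  | skip (s : State) : Run .skip s 1 s
  | set (r : ℕ) (e : Expr) (s : State) :
      Run (.set r e) s (e.cost s + (e.eval s).size + 1)
        { s with reg := Function.update s.reg r (e.eval s) }
  | store (a e : Expr) (s : State) :
      Run (.store a e) s (a.cost s + e.cost s + (a.eval s).size + (e.eval s).size + 1)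
        { s with mem := Function.update s.mem (a.eval s) (e.eval s) }
  | seq {P Q : Program} {s s₁ s₂ : State} {t₁ t₂ : ℕ} :
      Run P s t₁ s₁ → Run Q s₁ t₂ s₂ → Run (.seq P Q) s (t₁ + t₂ + 1) s₂
  | ite_true {e : Expr} {P Q : Program} {s s₁ : State} {t : ℕ} :
      e.eval s ≠ 0 → Run P s t s₁ →
        Run (.ite e P Q) s (e.cost s + (e.eval s).size + t + 1) s₁
  | ite_false {e : Expr} {P Q : Program} {s s₁ : State} {t : ℕ} :
      e.eval s = 0 → Run Q s t s₁ →
        Run (.ite e P Q) s (e.cost s + (e.eval s).size + t + 1) s₁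
  | loop_true {e : Expr} {P : Program} {s s₁ s₂ : State} {t₁ t₂ : ℕ} :
      e.eval s ≠ 0 → Run P s t₁ s₁ → Run (.loop e P) s₁ t₂ s₂ →
        Run (.loop e P) s (e.cost s + (e.eval s).size + t₁ + t₂ + 1) s₂
  | loop_false {e : Expr} {P : Program} {s : State} :
      e.eval s = 0 → Run (.loop e P) s (e.cost s + (e.eval s).size + 1) s

/-- The start state: the input is in the memory cells `0, …, l.length - 1`, its length is in
register `0`, and all else is `0`. -/
def start (l : List ℕ) : State where
  reg r := if r = 0 then l.length else 0
  mem a := l.getD a 0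

/-- The size of an input: the number of bits needed to write it down, with separators. -/
def inputSize (l : List ℕ) : ℕ :=
  (l.map fun a => a.size + 1).sum

/-- A decision problem `A` on instances of type `α`, encoded by `enc`, is decidable in polynomial
time: one program halts on all encoded instances in time bounded by a polynomial in the input size,
and leaves `1` in register `0` if the answer is yes, and `0` if it is no. -/
def PolyTimeDecidable {α : Type} (enc : α → List ℕ) (A : α → Prop) : Prop :=
  ∃ (P : Program) (q : Polynomial ℕ), ∀ x : α, ∃ (t : ℕ) (s : State),
    Run P (start (enc x)) t s ∧ t ≤ q.eval (inputSize (enc x)) ∧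
      (A x → s.reg 0 = 1) ∧ (¬ A x → s.reg 0 = 0)

end RAM

/-! ## Instances of the decision problem -/

/-- A finite simple graph with vertices `0, …, n - 1`, and the nonnegative rational values of an
edge-linear function at the vertices. -/
structure GraphFunction where
  n : ℕ
  graph : SimpleGraph (Fin n)
  val : Fin n → ℚ≥0

/-- The edge-linear function on the realization of the graph that the instance describes. -/
noncomputable def GraphFunction.toFun (I : GraphFunction) : realization I.graph → ℝ≥0 :=
  edgeLinear I.graph fun v => (I.val v : ℝ≥0)

open Classical in
/-- An instance is encoded by the number of vertices, the adjacency matrix row by row, the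
numerators of the values, and their denominators. -/
noncomputable def GraphFunction.encode (I : GraphFunction) : List ℕ :=
  I.n :: ((List.finRange I.n).flatMap fun u =>
      (List.finRange I.n).map fun v => if I.graph.Adj u v then 1 else 0) ++
    ((List.finRange I.n).map fun v => (I.val v).num) ++
    ((List.finRange I.n).map fun v => (I.val v).den)

/-!
Replace `f` by the natural numbers `g v = D * f v ^ q`, where `D` clears the denominators and `q = p`
(`q = 1` for `p = ∞`); each of them has polynomially many bits. The problem then concerns the
subgraph where `g` is positive, and the answer is yes if and only if a certain search in this
subgraph succeeds for some choice of two vertices `ρ` and `m`, the places of the maxima of the two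
summands. The search builds a spanning tree from `ρ`, and a second one from `m` if `m` has not been
found. It keeps track of the amount `rise v` by which `g` increases along the path from the root to
`v` (steps down are not counted; a second root starts with `rise m = g m`), of the minimum `low v`
of `g` on this path (replaced by `0` for `p < ∞`), and of the sum `total` of all increases in the
forest. It succeeds (`IsAccepting`) if the forest contains all vertices and edges of the subgraph,
all increases occur on the path to `m`, and `rise m + low m ≤ g m`.

*Necessity* (`exists_isAccepting`). Let `F₁`, `F₂` be a strong unimodal decomposition with maxima
over the vertices at `ρ` and `m`. The set where `f` is positive is the union of the open contractible
sets `{F₁ > 0}` and `{F₂ > 0}` with connected intersection, so that a map to `ℂ \ {0}` has a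
logarithm on it (`exists_log_on_union`). For an edge that is not in the forest, a map which winds
around the origin once along this edge and avoids it elsewhere gives a contradiction; hence the
subgraph is the forest. As superlevel sets are connected, `F₁` decreases away from `ρ` and `F₂`
decreases away from `m` (`le_par_of_level`, `par_le_of_level`). So `f` can increase away from `ρ`
only on the path to `m`, and there `F₂` has to account for the increases.

*Sufficiency* (`IsSearchForest.strongUcat_le_two`, `IsSearchForest.strongUcat_top_le_two`). For an
accepting forest put `h₂ v = min (g v) (rise v + low m)`, and `h₁ v = g v - rise v`, or
`h₁ v = min (low v) (g v)` for `p = ∞`. These functions decrease away from `m` and from `ρ`, and along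
an edge they increase where `g` does. They are extended to the edges as affine functions of `f ^ q`
(`interpolate`), and the `q`-th roots of the extensions are the wanted decomposition: their
superlevel sets and the intersections of these are closed under moving along an edge towards the
larger value of `f`, and their vertices span subtrees, hence they are contractible
(`contractibleOrEmpty_of_upward`).

*Running time.* The search needs `n` rounds in each of which all pairs of vertices are tried, and it
is carried out for all pairs `ρ`, `m`. The program `RAM.mainProgram` consists of nested loops over
the vertices, and all numbers in it have at most `(q + 1) * K` bits, where `K` is the size of the
input. This bounds the running time by a polynomial in `K` (`RAM.Program.timeBound`). Correctness
is proved in a calculus of postconditions (`RAM.Ensures`) that has this bound built in.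
-/

set_option linter.unusedSectionVars false

/-! ### Logarithms on contractible sets -/

theorem exists_log_of_contractible {A : Type*} [TopologicalSpace A] [ContractibleSpace A]
    (Z : A → ℂ) (hZ : Continuous Z) (h0 : ∀ a, Z a ≠ 0) :
    ∃ L : A → ℂ, Continuous L ∧ ∀ a, Complex.exp (L a) = Z a := by
  obtain ⟨y, ⟨H⟩⟩ := id_nullhomotopic A
  let H' : C(unitInterval × A, {z : ℂ // z ≠ 0}) :=
    ⟨fun q => ⟨Z (H.symm q), h0 _⟩,
      Continuous.subtype_mk (hZ.comp H.symm.continuous) _⟩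
  have hy : ∀ a, H' (0, a) = (⟨_, Complex.exp_ne_zero (Complex.log (Z y))⟩ : {z : ℂ // z ≠ 0}) := by
    intro a
    apply Subtype.ext
    simp [H', Complex.exp_log (h0 y)]
  let K := Complex.isCoveringMap_exp.liftHomotopy H' (ContinuousMap.const A (Complex.log (Z y))) hy
  refine ⟨fun a => K (1, a), K.continuous.comp (by fun_prop), fun a => ?_⟩
  have := congrFun (Complex.isCoveringMap_exp.liftHomotopy_lifts H'
    (ContinuousMap.const A (Complex.log (Z y))) hy) (1, a)
  have := congrArg Subtype.val this
  simpa [H', K] using this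

theorem eq_of_exp_eq_on_preconnected {X : Type*} [TopologicalSpace X] {K : Set X}
    (hK : IsPreconnected K) {L L' : X → ℂ} (hL : ContinuousOn L K) (hL' : ContinuousOn L' K)
    (h : ∀ x ∈ K, Complex.exp (L x) = Complex.exp (L' x)) {x y : X} (hx : x ∈ K) (hy : y ∈ K) :
    L x - L' x = L y - L' y := by
  refine Complex.isCoveringMap_exp.constOn_of_comp hK (hL.sub hL') ?_ hx hy
  intro a ha b hb
  apply Subtype.ext
  simp [Complex.exp_sub, h a ha, h b hb]

theorem exists_log_of_contractibleOrEmpty {X : Type} [TopologicalSpace X] {A : Set X}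
    (hA : ContractibleOrEmpty A) (Z : X → ℂ) (hZ : Continuous Z) (h0 : ∀ x, Z x ≠ 0) :
    ∃ L : X → ℂ, ContinuousOn L A ∧ ∀ x ∈ A, Complex.exp (L x) = Z x := by
  classical
  rcases hA with rfl | hA
  · exact ⟨fun _ => 0, by simp, by simp⟩
  · obtain ⟨L, hL, hL'⟩ := exists_log_of_contractible (fun a : A => Z a)
      (hZ.comp continuous_subtype_val) (fun a => h0 a)
    refine ⟨fun x => if h : x ∈ A then L ⟨x, h⟩ else 0, ?_, fun x hx => ?_⟩
    · rw [continuousOn_iff_continuous_domRestrict]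
      convert hL using 1
      ext ⟨x, hx⟩
      simp [hx]
    · simp [hx, hL']

theorem ContractibleOrEmpty.isPreconnected {X : Type} [TopologicalSpace X] {A : Set X}
    (hA : ContractibleOrEmpty A) : IsPreconnected A := by
  rcases hA with rfl | hA
  · exact isPreconnected_empty
  · exact isPreconnected_iff_preconnectedSpace.2 inferInstance

/-- A function without zeros has a logarithm on the union of two open contractible sets with
connected intersection: two logarithms differ by a constant on the intersection. -/
theorem exists_log_on_union {X : Type} [TopologicalSpace X] {A B : Set X}
    (hAo : IsOpen A) (hBo : IsOpen B) (hA : ContractibleOrEmpty A) (hB : ContractibleOrEmpty B)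
    (hAB : IsPreconnected (A ∩ B)) (Z : X → ℂ) (hZ : Continuous Z) (h0 : ∀ x, Z x ≠ 0) :
    ∃ L : X → ℂ, ContinuousOn L (A ∪ B) ∧ ∀ x ∈ A ∪ B, Complex.exp (L x) = Z x := by
  classical
  obtain ⟨L₁, c₁, e₁⟩ := exists_log_of_contractibleOrEmpty hA Z hZ h0
  obtain ⟨L₂, c₂, e₂⟩ := exists_log_of_contractibleOrEmpty hB Z hZ h0
  obtain ⟨c, hc, hc1⟩ : ∃ c : ℂ, (∀ x ∈ A ∩ B, L₁ x = L₂ x + c) ∧ Complex.exp c = 1 := by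
    by_cases hne : (A ∩ B).Nonempty
    · obtain ⟨y, hy⟩ := hne
      refine ⟨L₁ y - L₂ y, fun x hx => ?_, ?_⟩
      · rw [← eq_of_exp_eq_on_preconnected hAB (c₁.mono Set.inter_subset_left)
          (c₂.mono Set.inter_subset_right)
          (fun x hx => (e₁ x hx.1).trans (e₂ x hx.2).symm) hx hy]
        ring
      · rw [Complex.exp_sub, e₁ y hy.1, e₂ y hy.2, div_self (h0 y)]
    · exact ⟨0, fun x hx => (hne ⟨x, hx⟩).elim, Complex.exp_zero⟩
  have hLA : ∀ x ∈ A, (if x ∈ A then L₁ x else L₂ x + c) = L₁ x := fun x hx => if_pos hx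
  have hLB : ∀ x ∈ B, (if x ∈ A then L₁ x else L₂ x + c) = L₂ x + c := by
    intro x hx
    by_cases hxA : x ∈ A
    · rw [if_pos hxA, hc x ⟨hxA, hx⟩]
    · rw [if_neg hxA]
  refine ⟨fun x => if x ∈ A then L₁ x else L₂ x + c, ?_, ?_⟩
  · exact ContinuousOn.union_of_isOpen (c₁.congr hLA) ((c₂.add continuousOn_const).congr hLB)
      hAo hBo
  · rintro x (hx | hx)
    · simp only [hLA x hx, e₁ x hx]
    · simp only [hLB x hx, Complex.exp_add, e₂ x hx, hc1, mul_one]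

/-! ### Straight-line retractions -/

/-- A set is contractible if it retracts to a contractible subset in such a way that the segments
from its points to their images lie in the set. -/
theorem contractibleSpace_of_segment_retraction {E : Type*} [TopologicalSpace E] [AddCommGroup E]
    [Module ℝ E] [ContinuousAdd E] [ContinuousSMul ℝ E] {S T : Set E} (hTS : T ⊆ S) (r : E → E)
    (hr : ContinuousOn r S) (hrT : Set.MapsTo r S T) (hid : ∀ x ∈ T, r x = x)
    (hseg : ∀ x ∈ S, segment ℝ x (r x) ⊆ S) (hT : ContractibleSpace T) :
    ContractibleSpace S := by
  let f : C(S, T) := ⟨hrT.restrict, hr.mapsToRestrict hrT⟩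
  let i : C(T, S) := ⟨Set.inclusion hTS, continuous_inclusion hTS⟩
  have hval : Continuous fun q : unitInterval × S => r (q.2 : E) :=
    (continuousOn_iff_continuous_domRestrict.1 hr).comp continuous_snd
  have hmem : ∀ q : unitInterval × S,
      (q.1 : ℝ) • (q.2 : E) + (1 - (q.1 : ℝ)) • r (q.2 : E) ∈ S := fun q =>
    hseg _ q.2.2 ⟨q.1, 1 - q.1, q.1.2.1, sub_nonneg.2 q.1.2.2, by ring, rfl⟩
  have H : (i.comp f).Homotopic (ContinuousMap.id S) :=
    ⟨{ toFun := fun q => ⟨_, hmem q⟩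
       continuous_toFun := by
        refine Continuous.subtype_mk ?_ _
        exact ((continuous_subtype_val.comp continuous_fst).smul
          (continuous_subtype_val.comp continuous_snd)).add
          ((continuous_const.sub (continuous_subtype_val.comp continuous_fst)).smul hval)
       map_zero_left := fun x => Subtype.ext (by simp [i, f])
       map_one_left := fun x => Subtype.ext (by simp) }⟩
  have H' : f.comp i = ContinuousMap.id T := by
    ext x
    simp [f, i, hid x x.2]
  exact ContinuousMap.HomotopyEquiv.contractibleSpace
    { toFun := f, invFun := i, left_inv := H, right_inv := by rw [H'] }

/-! ### Points of the realization -/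

section Realization

variable {V : Type} [DecidableEq V]

/-- The point at parameter `t` on the segment from the vertex `a` to the vertex `b`. -/
noncomputable def edgePoint (a b : V) (t : ℝ) : V → ℝ :=
  (1 - t) • vertexPoint a + t • vertexPoint b

theorem edgePoint_apply (a b : V) (t : ℝ) (v : V) :
    edgePoint a b t v = (if v = a then 1 - t else 0) + (if v = b then t else 0) := by
  simp [edgePoint, vertexPoint, Pi.single_apply]

theorem edgePoint_zero (a b : V) : edgePoint a b 0 = vertexPoint a := by simp [edgePoint]

theorem edgePoint_one (a b : V) : edgePoint a b 1 = vertexPoint b := by simp [edgePoint]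

theorem edgePoint_symm (a b : V) (t : ℝ) : edgePoint b a (1 - t) = edgePoint a b t := by
  simp [edgePoint, add_comm]

variable [Fintype V] {G : SimpleGraph V}

theorem vertexPoint_mem (v : V) : vertexPoint v ∈ realization G := Or.inl ⟨v, rfl⟩

theorem edgePoint_mem {a b : V} (h : G.Adj a b) {t : ℝ} (h0 : 0 ≤ t) (h1 : t ≤ 1) :
    edgePoint a b t ∈ realization G :=
  Or.inr ⟨a, b, h, 1 - t, t, sub_nonneg.2 h1, h0, by ring, rfl⟩

/-- A point of the realization is a vertex or lies on an edge. -/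
theorem realization_cases {x : V → ℝ} (hx : x ∈ realization G) :
    (∃ v, x = vertexPoint v) ∨
      ∃ a b t, G.Adj a b ∧ 0 ≤ t ∧ t ≤ 1 ∧ x = edgePoint a b t := by
  rcases hx with hx | ⟨a, b, hab, s, t, hs, ht, hst, rfl⟩
  · exact Or.inl hx
  · refine Or.inr ⟨a, b, t, hab, ht, by linarith, ?_⟩
    rw [edgePoint, ← hst]; simp

theorem realization_nonneg {x : V → ℝ} (hx : x ∈ realization G) (v : V) : 0 ≤ x v := by
  rcases realization_cases hx with ⟨w, rfl⟩ | ⟨a, b, t, -, h0, h1, rfl⟩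
  · rw [← edgePoint_zero w w, edgePoint_apply]; split_ifs <;> simp
  · rw [edgePoint_apply]; split_ifs <;> linarith

theorem realization_sum {x : V → ℝ} (hx : x ∈ realization G) : ∑ v, x v = 1 := by
  rcases realization_cases hx with ⟨w, rfl⟩ | ⟨a, b, t, -, h0, h1, rfl⟩
  · simp [vertexPoint]
  · simp [edgePoint_apply, Finset.sum_add_distrib]

theorem realization_adj {x : V → ℝ} (hx : x ∈ realization G) {u v : V} (hu : 0 < x u)
    (hv : 0 < x v) (huv : u ≠ v) : G.Adj u v := by
  rcases realization_cases hx with ⟨w, rfl⟩ | ⟨a, b, t, hab, h0, h1, rfl⟩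
  · rw [← edgePoint_zero w w, edgePoint_apply] at hu hv
    split_ifs at hu hv <;> simp_all
  · rw [edgePoint_apply] at hu hv
    split_ifs at hu hv <;> simp_all
    exact hab.symm

/-- A point with at most one nonzero barycentric coordinate is a vertex. -/
theorem realization_eq_vertexPoint {x : V → ℝ} (hx : x ∈ realization G) {b : V}
    (h : ∀ v, 0 < x v → v = b) : x = vertexPoint b := by
  have h0 : ∀ v, v ≠ b → x v = 0 := fun v hv =>
    le_antisymm (not_lt.1 fun h' => hv (h v h')) (realization_nonneg hx v)
  have hs := realization_sum hx
  rw [Finset.sum_eq_single b (fun v _ hv => h0 v hv) (by simp)] at hs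
  ext v
  by_cases hv : v = b
  · simp [hv, hs, vertexPoint]
  · simp [h0 v hv, vertexPoint, hv]

theorem realization_exists_pos {x : V → ℝ} (hx : x ∈ realization G) : ∃ v, 0 < x v := by
  by_contra! h
  have := Finset.sum_nonpos fun v (_ : v ∈ Finset.univ) => h v
  linarith [realization_sum hx]

/-- A vertex, as a point of the realization. -/
noncomputable def vtx (G : SimpleGraph V) (v : V) : realization G := ⟨vertexPoint v, vertexPoint_mem v⟩

theorem vtx_apply (v w : V) : (vtx G v).1 w = if w = v then 1 else 0 := by
  simp [vtx, vertexPoint, Pi.single_apply]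

theorem edgeLinear_eq_sum (f : V → ℝ≥0) (x : realization G) :
    (edgeLinear G f x : ℝ) = ∑ v, x.1 v * f v := by
  simp only [edgeLinear, NNReal.coe_sum, NNReal.coe_mul]
  exact Finset.sum_congr rfl fun v _ => by rw [Real.coe_toNNReal _ (realization_nonneg x.2 v)]

theorem edgeLinear_vtx (f : V → ℝ≥0) (v : V) : edgeLinear G f (vtx G v) = f v := by
  apply NNReal.coe_injective
  simp [edgeLinear_eq_sum, vtx_apply]

theorem edgeLinear_edgePoint (f : V → ℝ≥0) {a b : V} {t : ℝ} (h : edgePoint a b t ∈ realization G) :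
    (edgeLinear G f ⟨edgePoint a b t, h⟩ : ℝ) = (1 - t) * f a + t * f b := by
  simp [edgeLinear_eq_sum, edgePoint_apply, add_mul, Finset.sum_add_distrib]

/-- The vertices of a connected subset of the realization are connected through edges with both
ends in the subset, whether or not those edges lie in it: a set `D` of vertices that no such edge
leaves contains all vertices of the subset as soon as it contains one. -/
theorem mem_of_isPreconnected {S : Set (realization G)} (hS : IsPreconnected S) (D : Set V)
    (hD : ∀ a ∈ D, ∀ b, b ∉ D → G.Adj a b → vtx G a ∈ S → vtx G b ∈ S → False) {u v : V}
    (hu : u ∈ D) (huS : vtx G u ∈ S) (hvS : vtx G v ∈ S) : v ∈ D := by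
  by_contra hv
  let U : Set (realization G) := {x | ∃ a, (a ∈ D ∧ vtx G a ∈ S) ∧ 0 < x.1 a}
  let W : Set (realization G) :=
    {y | ∃ x, (x ∈ S ∧ ∀ a ∈ D, vtx G a ∈ S → x.1 a ≤ 0) ∧ ∀ b, 0 < x.1 b → 0 < y.1 b}
  have cont : ∀ a, Continuous fun x : realization G => x.1 a := fun a =>
    (continuous_apply a).comp continuous_subtype_val
  have hU : IsOpen U := by
    have : U = ⋃ a, ⋃ _ : a ∈ D ∧ vtx G a ∈ S, {x : realization G | 0 < x.1 a} := by
      ext; simp [U]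
    rw [this]
    exact isOpen_iUnion fun a => isOpen_iUnion fun _ => isOpen_lt continuous_const (cont a)
  have hW : IsOpen W := by
    have : W = ⋃ x : realization G, ⋃ _ : x ∈ S ∧ ∀ a ∈ D, vtx G a ∈ S → x.1 a ≤ 0,
        ⋂ b, ⋂ _ : 0 < x.1 b, {y : realization G | 0 < y.1 b} := by
      ext; simp [W]
    rw [this]
    exact isOpen_iUnion fun x => isOpen_iUnion fun _ => isOpen_iInter_of_finite fun b =>
      isOpen_iInter_of_finite fun _ => isOpen_lt continuous_const (cont b)
  have hcov : S ⊆ U ∪ W := by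
    intro x hx
    by_cases h : x ∈ U
    · exact Or.inl h
    · exact Or.inr ⟨x, ⟨hx, fun a ha haS => not_lt.1 fun h' => h ⟨a, ⟨ha, haS⟩, h'⟩⟩, fun _ h => h⟩
  have hSU : (S ∩ U).Nonempty := ⟨_, huS, u, ⟨hu, huS⟩, by simp [vtx_apply]⟩
  have hSW : (S ∩ W).Nonempty := by
    refine ⟨_, hvS, vtx G v, ⟨hvS, fun a ha _ => ?_⟩, fun _ h => h⟩
    rw [vtx_apply, if_neg (by rintro rfl; exact hv ha)]
  obtain ⟨y, -, ⟨a, ⟨haD, haS⟩, hya⟩, x, ⟨hxS, hx⟩, hxy⟩ := hS U W hU hW hcov hSU hSW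
  obtain ⟨b, hb⟩ := realization_exists_pos x.2
  have hne : ∀ c, 0 < x.1 c → a ≠ c := by
    rintro c hc rfl
    exact absurd (hx a haD haS) (not_le.2 hc)
  have hxb : x.1 = vertexPoint b := by
    refine realization_eq_vertexPoint x.2 fun c hc => ?_
    by_contra hcb
    have h := y.2
    rcases realization_cases h with ⟨w, hw⟩ | ⟨p, q, t, -, -, -, hw⟩
    · have h1 := hya
      have h2 := hxy b hb
      rw [hw, ← edgePoint_zero w w, edgePoint_apply] at h1 h2
      have := hne b hb
      split_ifs at h1 h2 <;> simp_all
    · have h1 := hya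
      have h2 := hxy b hb
      have h3 := hxy c hc
      have h4 := hne b hb
      have h5 := hne c hc
      rw [hw, edgePoint_apply] at h1 h2 h3
      clear hw hx hxS hcov hSU hSW hW hU hS hD
      have e1 : a = p ∨ a = q := by by_contra! h; simp [h.1, h.2] at h1
      have e2 : b = p ∨ b = q := by by_contra! h; simp [h.1, h.2] at h2
      have e3 : c = p ∨ c = q := by by_contra! h; simp [h.1, h.2] at h3
      grind
  have hxb' : x = vtx G b := Subtype.ext hxb
  refine hD a haD b (fun hbD => ?_) (realization_adj y.2 hya (hxy b hb) (hne b hb)) haS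
    (hxb' ▸ hxS)
  exact absurd (hx b hbD (hxb' ▸ hxS)) (not_le.2 hb)

end Realization

/-! ### Contractible subsets of trees -/

section Contractible

variable {V : Type} [Fintype V] [DecidableEq V] {G : SimpleGraph V}

theorem eq_edgePoint {x : V → ℝ} (hx : x ∈ realization G) {a b : V} (hab : a ≠ b)
    (h : ∀ v, 0 < x v → v = a ∨ v = b) : x = edgePoint a b (x b) := by
  have h0 : ∀ v, v ≠ a → v ≠ b → x v = 0 := fun v ha hb =>
    le_antisymm (not_lt.1 fun h' => (h v h').elim ha hb) (realization_nonneg hx v)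
  have hs := realization_sum hx
  rw [Finset.sum_eq_add a b hab (fun v _ hv => h0 v hv.1 hv.2) (by simp) (by simp)] at hs
  ext v
  rw [edgePoint_apply]
  by_cases hva : v = a
  · subst hva; simp [hab]; linarith
  · by_cases hvb : v = b
    · subst hvb; simp [hva]
    · simp [hva, hvb, h0 v hva hvb]

theorem segment_edgePoint_subset {a b : V} {t : ℝ} (ht : 0 ≤ t) :
    segment ℝ (edgePoint a b t) (vertexPoint a) ⊆
      {y | ∃ t', 0 ≤ t' ∧ t' ≤ t ∧ y = edgePoint a b t'} := by
  rintro _ ⟨r, s, hr, hs, hrs, rfl⟩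
  refine ⟨r * t, by positivity, by nlinarith, ?_⟩
  obtain rfl : s = 1 - r := by linarith
  ext v
  simp only [edgePoint, Pi.add_apply, Pi.smul_apply, smul_eq_mul]
  ring

/-- Points on an edge, with the ends of the edge ordered by the value of `f`. -/
theorem realization_cases_le (f : V → ℝ≥0) {x : V → ℝ} (hx : x ∈ realization G) :
    (∃ v, x = vertexPoint v) ∨
      ∃ a b t, G.Adj a b ∧ f a ≤ f b ∧ 0 ≤ t ∧ t ≤ 1 ∧ x = edgePoint a b t := by
  rcases realization_cases hx with h | ⟨a, b, t, hab, h0, h1, rfl⟩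
  · exact Or.inl h
  · rcases le_total (f a) (f b) with h | h
    · exact Or.inr ⟨a, b, t, hab, h, h0, h1, rfl⟩
    · exact Or.inr ⟨b, a, 1 - t, hab.symm, h, by linarith, by linarith, (edgePoint_symm a b t).symm⟩

/-- The subcomplex of the realization that is spanned by a set of vertices. -/
def spannedSubcomplex (G : SimpleGraph V) (A : Finset V) : Set (V → ℝ) :=
  {x | x ∈ realization G ∧ ∀ v, 0 < x v → v ∈ A}

/-- A set of vertices that spans a subtree with root `t`: parents of its other elements lie in the
set and are their neighbors, a rank decreases from child to parent, and there are no edges but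
those from child to parent. -/
structure IsRootedSubtree (G : SimpleGraph V) (par : V → V) (rank : V → ℕ) (t : V)
    (A : Finset V) : Prop where
  root_mem : t ∈ A
  par_mem : ∀ v ∈ A, v ≠ t → par v ∈ A
  par_adj : ∀ v ∈ A, v ≠ t → G.Adj v (par v)
  rank_lt : ∀ v ∈ A, v ≠ t → rank (par v) < rank v
  rank_le : rank (par t) ≤ rank t
  edge : ∀ u ∈ A, ∀ v ∈ A, G.Adj u v → par u = v ∨ par v = u

namespace IsRootedSubtree

variable {par : V → V} {rank : V → ℕ} {t : V} {A : Finset V}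

theorem rank_root_le (h : IsRootedSubtree G par rank t A) :
    ∀ v ∈ A, rank t ≤ rank v := by
  have : ∀ n, ∀ v ∈ A, rank v = n → rank t ≤ n := by
    intro n
    induction n using Nat.strong_induction_on with
    | _ n ih =>
      intro v hv hn
      by_cases hvt : v = t
      · rw [← hn, hvt]
      · have := h.rank_lt v hv hvt
        have := ih _ (hn ▸ this) _ (h.par_mem v hv hvt) rfl
        omega
  exact fun v hv => this _ v hv rfl

/-- The root is the parent of no vertex twice over: only children point upwards. -/
theorem edge' (h : IsRootedSubtree G par rank t A) {u v : V} (hu : u ∈ A) (hv : v ∈ A)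
    (huv : G.Adj u v) : (u ≠ t ∧ par u = v) ∨ (v ≠ t ∧ par v = u) := by
  have key : ∀ w ∈ A, G.Adj t w → par t = w → False := by
    rintro w hw hadj rfl
    have h1 := h.rank_root_le _ (h.par_mem _ hw hadj.ne')
    have h2 := h.rank_lt _ hw hadj.ne'
    have h3 := h.rank_le
    omega
  rcases h.edge u hu v hv huv with h' | h'
  · refine Or.inl ⟨?_, h'⟩
    rintro rfl
    exact key v hv huv h'
  · refine Or.inr ⟨?_, h'⟩
    rintro rfl
    exact key u hu huv.symm h'

theorem erase (h : IsRootedSubtree G par rank t A) {l : V} (hlt : l ≠ t)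
    (hmax : ∀ v ∈ A, v ≠ t → rank v ≤ rank l) : IsRootedSubtree G par rank t (A.erase l) where
  root_mem := Finset.mem_erase.2 ⟨hlt.symm, h.root_mem⟩
  par_mem v hv hvt := by
    have hv := Finset.mem_of_mem_erase hv
    refine Finset.mem_erase.2 ⟨?_, h.par_mem v hv hvt⟩
    intro e
    have := h.rank_lt v hv hvt
    have := hmax v hv hvt
    rw [e] at *
    omega
  par_adj v hv := h.par_adj v (Finset.mem_of_mem_erase hv)
  rank_lt v hv := h.rank_lt v (Finset.mem_of_mem_erase hv)
  rank_le := h.rank_le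
  edge u hu v hv := h.edge u (Finset.mem_of_mem_erase hu) v (Finset.mem_of_mem_erase hv)

/-- A subtree is contractible: the edge from a vertex of the largest rank, a leaf, to its parent
can be collapsed. -/
theorem contractibleSpace (h : IsRootedSubtree G par rank t A) :
    ContractibleSpace (spannedSubcomplex G A) := by
  induction hn : A.card using Nat.strong_induction_on generalizing A with
  | _ n ih =>
  by_cases hA : ∃ l ∈ A, l ≠ t
  · obtain ⟨l, hl, hmax⟩ := Finset.exists_max_image (A.erase t) rank
      (by obtain ⟨l, hl, hlt⟩ := hA; exact ⟨l, Finset.mem_erase.2 ⟨hlt, hl⟩⟩)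
    obtain ⟨hlt, hlA⟩ := Finset.mem_erase.1 hl
    have hmax : ∀ v ∈ A, v ≠ t → rank v ≤ rank l := fun v hv hvt =>
      hmax v (Finset.mem_erase.2 ⟨hvt, hv⟩)
    have hB := h.erase hlt hmax
    have hadj := h.par_adj l hlA hlt
    have hpA := h.par_mem l hlA hlt
    have hcB := ih _ (hn ▸ Finset.card_erase_lt_of_mem hlA) hB rfl
    -- The support of a point near the leaf consists of the leaf and its parent.
    have key : ∀ x ∈ spannedSubcomplex G A, 0 < x l → x = edgePoint (par l) l (x l) := by
      intro x hx hxl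
      refine eq_edgePoint hx.1 hadj.ne' fun v hv => ?_
      by_cases hvl : v = l
      · exact Or.inr hvl
      · left
        rcases h.edge' (hx.2 v hv) hlA (realization_adj hx.1 hv hxl hvl) with ⟨h1, h2⟩ | ⟨h1, h2⟩
        · have := h.rank_lt v (hx.2 v hv) h1
          have := hmax v (hx.2 v hv) h1
          rw [h2] at *
          omega
        · exact h2.symm
    have hr0 : ∀ x : V → ℝ, x l = 0 →
        x + x l • (vertexPoint (par l) - vertexPoint l : V → ℝ) = x := by
      intro x hx
      rw [hx]; simp
    have hr1 : ∀ x ∈ spannedSubcomplex G A, 0 < x l →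
        x + x l • (vertexPoint (par l) - vertexPoint l : V → ℝ) = vertexPoint (par l) := by
      intro x hx hxl
      conv_lhs => rw [show x + x l • (vertexPoint (par l) - vertexPoint l : V → ℝ) =
        edgePoint (par l) l (x l) + x l • (vertexPoint (par l) - vertexPoint l : V → ℝ) by
          rw [← key x hx hxl]]
      ext v
      simp only [edgePoint, Pi.add_apply, Pi.smul_apply, Pi.sub_apply, smul_eq_mul]
      ring
    have hpos : ∀ x ∈ spannedSubcomplex G A, ¬ 0 < x l → x l = 0 := fun x hx h' =>
      le_antisymm (not_lt.1 h') (realization_nonneg hx.1 l)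
    refine contractibleSpace_of_segment_retraction (T := spannedSubcomplex G (A.erase l))
      (fun x hx => ⟨hx.1, fun v hv => Finset.mem_of_mem_erase (hx.2 v hv)⟩)
      (fun x => x + x l • (vertexPoint (par l) - vertexPoint l : V → ℝ))
      (by fun_prop) ?_ ?_ ?_ hcB
    · intro x hx
      by_cases hxl : 0 < x l
      · simp only [hr1 x hx hxl]
        refine ⟨vertexPoint_mem _, fun v hv => ?_⟩
        have : v = par l := by
          by_contra h'
          simp [vertexPoint, h'] at hv
        exact this ▸ Finset.mem_erase.2 ⟨hadj.ne', hpA⟩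
      · simp only [hr0 x (hpos x hx hxl)]
        refine ⟨hx.1, fun v hv => Finset.mem_erase.2 ⟨?_, hx.2 v hv⟩⟩
        rintro rfl
        exact hxl hv
    · intro x hx
      refine hr0 x (hpos x ⟨hx.1, fun v hv => Finset.mem_of_mem_erase (hx.2 v hv)⟩ fun h' => ?_)
      exact (Finset.mem_erase.1 (hx.2 l h')).1 rfl
    · intro x hx
      by_cases hxl : 0 < x l
      · simp only [hr1 x hx hxl]
        rw [key x hx hxl]
        have hx1 : x l ≤ 1 := by
          rw [← realization_sum hx.1]
          exact Finset.single_le_sum (fun v _ => realization_nonneg hx.1 v) (Finset.mem_univ l)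
        refine (segment_edgePoint_subset hxl.le).trans ?_
        rintro _ ⟨s, hs0, hs1, rfl⟩
        refine ⟨edgePoint_mem hadj.symm hs0 (hs1.trans hx1), fun v hv => ?_⟩
        rw [edgePoint_apply] at hv
        by_cases h1 : v = par l
        · exact h1 ▸ hpA
        · by_cases h2 : v = l
          · exact h2 ▸ hlA
          · simp [h1, h2] at hv
      · simp only [hr0 x (hpos x hx hxl), segment_same]
        exact Set.singleton_subset_iff.2 hx
  · push Not at hA
    have : spannedSubcomplex G A = {vertexPoint t} := by
      ext x
      simp only [Set.mem_singleton_iff]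
      constructor
      · intro hx
        exact realization_eq_vertexPoint hx.1 fun v hv => hA v (hx.2 v hv)
      · rintro rfl
        refine ⟨vertexPoint_mem t, fun v hv => ?_⟩
        have : v = t := by
          by_contra h'
          simp [vertexPoint, h'] at hv
        exact this ▸ h.root_mem
    rw [this]
    infer_instance

end IsRootedSubtree

/-- A subset of the realization that is closed under moving along an edge towards the end with the
larger value of `f` is contractible if its vertices span a subtree. -/
theorem contractibleOrEmpty_of_upward (f : V → ℝ≥0) (S : Set (realization G))
    (hS : ∀ a b (hab : G.Adj a b), f a ≤ f b → ∀ t t' (h0 : 0 ≤ t) (htt' : t ≤ t') (h1 : t' ≤ 1),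
      ⟨edgePoint a b t, edgePoint_mem hab h0 (htt'.trans h1)⟩ ∈ S →
      ⟨edgePoint a b t', edgePoint_mem hab (h0.trans htt') h1⟩ ∈ S)
    (hA : ∀ A : Finset V, A.Nonempty → (∀ v, v ∈ A ↔ vtx G v ∈ S) →
      ∃ par rank t, IsRootedSubtree G par rank t A) :
    ContractibleOrEmpty S := by
  classical
  rcases S.eq_empty_or_nonempty with rfl | ⟨x₀, hx₀⟩
  · exact Or.inl rfl
  right
  let A : Finset V := Finset.univ.filter fun v => vtx G v ∈ S
  have memA : ∀ v, v ∈ A ↔ vtx G v ∈ S := by simp [A]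
  let S' : Set (V → ℝ) := Subtype.val '' S
  have hSS' : ∀ {x : V → ℝ} (h : x ∈ realization G), x ∈ S' ↔ ⟨x, h⟩ ∈ S := by
    intro x h
    constructor
    · rintro ⟨y, hy, rfl⟩; exact hy
    · intro h'; exact ⟨_, h', rfl⟩
  have hvS' : ∀ v, vertexPoint v ∈ S' ↔ v ∈ A := fun v => by
    rw [memA, hSS' (vertexPoint_mem v)]; rfl
  have hSr : S' ⊆ realization G := by rintro _ ⟨y, -, rfl⟩; exact y.2
  have up : ∀ a b, G.Adj a b → f a ≤ f b → ∀ t t', 0 ≤ t → t ≤ t' → t' ≤ 1 →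
      edgePoint a b t ∈ S' → edgePoint a b t' ∈ S' := by
    intro a b hab hf t t' h0 h h1 ht
    rw [hSS' (edgePoint_mem hab (h0.trans h) h1)]
    exact hS a b hab hf t t' h0 h h1 ((hSS' _).1 ht)
  -- The normal form of points of the set: a vertex, or a point of an edge whose upper end lies in
  -- the set.
  have cases : ∀ x ∈ S', (∃ v ∈ A, x = vertexPoint v) ∨
      ∃ a b t, G.Adj a b ∧ f a ≤ f b ∧ 0 ≤ t ∧ t ≤ 1 ∧ x = edgePoint a b t ∧ b ∈ A := by
    intro x hx
    rcases realization_cases_le f (hSr hx) with ⟨v, rfl⟩ | ⟨a, b, t, hab, hf, h0, h1, rfl⟩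
    · exact Or.inl ⟨v, (hvS' v).1 hx, rfl⟩
    · refine Or.inr ⟨a, b, t, hab, hf, h0, h1, rfl, ?_⟩
      rw [← hvS', ← edgePoint_one a b]
      exact up a b hab hf t 1 h0 h1 le_rfl hx
  let m : (V → ℝ) → ℝ := fun x => ∑ a ∈ A, x a
  let r : (V → ℝ) → V → ℝ := fun x => (m x)⁻¹ • fun v => if v ∈ A then x v else 0
  have hid : ∀ x ∈ spannedSubcomplex G A, r x = x := by
    intro x hx
    have h0 : ∀ v, v ∉ A → x v = 0 := fun v hv =>
      le_antisymm (not_lt.1 fun h' => hv (hx.2 v h')) (realization_nonneg hx.1 v)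
    have hm : m x = 1 := by
      rw [← realization_sum hx.1]
      exact Finset.sum_subset (Finset.subset_univ _) fun v _ hv => h0 v hv
    ext v
    by_cases hv : v ∈ A
    · simp [r, hm, hv]
    · simp [r, hm, hv, h0 v hv]
  have hvert : ∀ v ∈ A, vertexPoint v ∈ spannedSubcomplex G A := by
    intro v hv
    refine ⟨vertexPoint_mem v, fun w hw => ?_⟩
    have : w = v := by
      by_contra h'
      simp [vertexPoint, h'] at hw
    exact this ▸ hv
  have hTS : spannedSubcomplex G A ⊆ S' := by
    intro x hx
    rcases realization_cases_le f hx.1 with ⟨v, rfl⟩ | ⟨a, b, t, hab, hf, h0, h1, rfl⟩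
    · rw [hvS']
      exact hx.2 v (by simp [vertexPoint])
    · rcases h1.eq_or_lt with rfl | h1
      · rw [edgePoint_one, hvS']
        exact hx.2 b (by rw [edgePoint_one]; simp [vertexPoint])
      · refine up a b hab hf 0 t le_rfl h0 h1.le ?_
        rw [edgePoint_zero, hvS']
        refine hx.2 a ?_
        rw [edgePoint_apply, if_pos rfl, if_neg hab.ne]
        linarith
  have hcase : ∀ x ∈ S', x ∈ spannedSubcomplex G A ∨ ∃ a b t, G.Adj a b ∧ f a ≤ f b ∧ 0 ≤ t ∧
      t ≤ 1 ∧ x = edgePoint a b t ∧ b ∈ A ∧ r x = vertexPoint b ∧ 0 < t ∧ 0 < m x := by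
    intro x hx
    rcases cases x hx with ⟨v, hv, rfl⟩ | ⟨a, b, t, hab, hf, h0, h1, rfl, hb⟩
    · exact Or.inl (hvert v hv)
    · by_cases ha : a ∈ A
      · left
        refine ⟨hSr hx, fun v hv => ?_⟩
        rw [edgePoint_apply] at hv
        by_cases e1 : v = a
        · exact e1 ▸ ha
        · by_cases e2 : v = b
          · exact e2 ▸ hb
          · simp [e1, e2] at hv
      · have ht : 0 < t := by
          refine h0.lt_of_ne ?_
          rintro rfl
          rw [edgePoint_zero, hvS'] at hx
          exact ha hx
        have hz : ∀ v ∈ A, v ≠ b → edgePoint a b t v = 0 := by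
          intro v hv hvb
          rw [edgePoint_apply, if_neg (by rintro rfl; exact ha hv), if_neg hvb, add_zero]
        have hb' : edgePoint a b t b = t := by
          rw [edgePoint_apply, if_neg hab.ne', if_pos rfl, zero_add]
        have hm : m (edgePoint a b t) = t := by
          simp only [m]
          rw [Finset.sum_eq_single_of_mem b hb hz, hb']
        refine Or.inr ⟨a, b, t, hab, hf, h0, h1, rfl, hb, ?_, ht, by rw [hm]; exact ht⟩
        ext v
        by_cases hvb : v = b
        · subst hvb
          simp [r, hm, hb, hb', vertexPoint, ht.ne']
        · by_cases hv : v ∈ A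
          · simp [r, hv, hz v hv hvb, vertexPoint, hvb]
          · simp [r, hv, vertexPoint, hvb]
  have hne : A.Nonempty := by
    rcases cases x₀.1 ⟨x₀, hx₀, rfl⟩ with ⟨v, hv, -⟩ | ⟨a, b, t, -, -, -, -, -, hb⟩
    exacts [⟨v, hv⟩, ⟨b, hb⟩]
  obtain ⟨par, rank, t, ht⟩ := hA A hne memA
  have hS'c : ContractibleSpace S' := by
    refine contractibleSpace_of_segment_retraction hTS r ?_ ?_ hid ?_ ht.contractibleSpace
    · have hm : Continuous m := by fun_prop
      have hi : Continuous fun x : V → ℝ => fun v => if v ∈ A then x v else 0 := by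
        refine continuous_pi fun v => ?_
        by_cases hv : v ∈ A <;> simp [hv] <;> fun_prop
      refine (hm.continuousOn.inv₀ fun x hx => ?_).smul hi.continuousOn
      rcases hcase x hx with h | ⟨a, b, t, -, -, -, -, -, -, -, -, h⟩
      · intro h0
        have := hid x h
        obtain ⟨v, hv⟩ := realization_exists_pos h.1
        rw [← this] at hv
        simp [r, h0] at hv
      · exact h.ne'
    · intro x hx
      rcases hcase x hx with h | ⟨a, b, t, -, -, -, -, -, hb, hr, -⟩
      · rw [hid x h]; exact h
      · rw [hr]; exact hvert b hb
    · intro x hx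
      rcases hcase x hx with h | ⟨a, b, t, hab, hf, h0, h1, rfl, hb, hr, -⟩
      · rw [hid x h, segment_same]
        exact Set.singleton_subset_iff.2 hx
      · rw [hr, ← edgePoint_symm]
        refine (segment_edgePoint_subset (by linarith)).trans ?_
        rintro _ ⟨s, hs0, hs1, rfl⟩
        rw [← edgePoint_symm]
        exact up a b hab hf t (1 - s) h0 (by linarith) (by linarith) hx
  exact (Topology.IsEmbedding.subtypeVal.homeomorphImage S).contractibleSpace

end Contractible

/-! ### Interpolation along the powers of an edge-linear function -/

section Interpolation

variable {V : Type} [Fintype V] [DecidableEq V] {G : SimpleGraph V}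

/-- For `s + t = 1` this is the difference between the `q`-th power of an affine function with end
values `α` and `β` and the affine function with end values `α ^ q` and `β ^ q`. It is written as a
homogeneous polynomial that vanishes for `s = 0` and for `t = 0`. -/
def powerDefect (q : ℕ) (α β s t : ℝ) : ℝ :=
  (s * α + t * β) ^ q - (s * α ^ q + t * β ^ q) * (s + t) ^ (q - 1)

theorem powerDefect_zero_left {q : ℕ} (hq : q ≠ 0) (α β t : ℝ) : powerDefect q α β 0 t = 0 := by
  obtain ⟨k, rfl⟩ := Nat.exists_eq_succ_of_ne_zero hq
  simp [powerDefect, pow_succ]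
  ring

theorem powerDefect_symm (q : ℕ) (α β s t : ℝ) : powerDefect q α β s t = powerDefect q β α t s := by
  simp [powerDefect, add_comm]

theorem powerDefect_zero_right {q : ℕ} (hq : q ≠ 0) (α β s : ℝ) : powerDefect q α β s 0 = 0 := by
  rw [powerDefect_symm, powerDefect_zero_left hq]

/-- The quotient of the increments of `h` and of `f ^ q`; it is `0` if `f a = f b`. -/
noncomputable def powerSlope (q : ℕ) (f : V → ℝ≥0) (h : V → ℝ) (a b : V) : ℝ :=
  (h b - h a) / ((f b : ℝ) ^ q - (f a : ℝ) ^ q)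

theorem powerSlope_symm (q : ℕ) (f : V → ℝ≥0) (h : V → ℝ) (a b : V) :
    powerSlope q f h a b = powerSlope q f h b a := by
  rw [powerSlope, powerSlope, ← neg_sub (h a), ← neg_sub ((f a : ℝ) ^ q), neg_div_neg_eq]

/-- The function on the realization that is an affine function of the `q`-th power of the
edge-linear function `f` on every edge, and takes the values `h` at the vertices. -/
noncomputable def interpolate (q : ℕ) (f : V → ℝ≥0) (h : V → ℝ) (x : V → ℝ) : ℝ :=
  ∑ v, h v * x v +
    (1 / 2) * ∑ a, ∑ b, powerSlope q f h a b * powerDefect q (f a) (f b) (x a) (x b)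

theorem continuous_interpolate (q : ℕ) (f : V → ℝ≥0) (h : V → ℝ) :
    Continuous (interpolate q f h) := by
  unfold interpolate powerDefect
  fun_prop

theorem interpolate_vertexPoint {q : ℕ} (hq : q ≠ 0) (f : V → ℝ≥0) (h : V → ℝ) (v : V) :
    interpolate q f h (vertexPoint v) = h v := by
  have h1 : ∑ a, ∑ b, powerSlope q f h a b *
      powerDefect q (f a) (f b) (vertexPoint v a) (vertexPoint v b) = 0 := by
    refine Finset.sum_eq_zero fun a _ => Finset.sum_eq_zero fun b _ => ?_
    by_cases hab : a = b
    · simp [hab, powerSlope]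
    · by_cases hav : a = v
      · have : b ≠ v := fun e => hab (hav.trans e.symm)
        simp [vertexPoint, this, powerDefect_zero_right hq]
      · simp [vertexPoint, hav, powerDefect_zero_left hq]
  rw [interpolate, h1]
  simp [vertexPoint, Pi.single_apply]

theorem interpolate_edgePoint {q : ℕ} (hq : q ≠ 0) (f : V → ℝ≥0) (h : V → ℝ) {a b : V}
    (hab : a ≠ b) (hfh : f a = f b → h a = h b) (t : ℝ) :
    interpolate q f h (edgePoint a b t) =
      h a + powerSlope q f h a b * (((1 - t) * f a + t * f b) ^ q - (f a : ℝ) ^ q) := by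
  have ha : edgePoint a b t a = 1 - t := by simp [edgePoint_apply, hab]
  have hb : edgePoint a b t b = t := by simp [edgePoint_apply, hab.symm]
  have h0 : ∀ v, v ≠ a → v ≠ b → edgePoint a b t v = 0 := fun v h1 h2 => by
    simp [edgePoint_apply, h1, h2]
  have h1 : ∑ v, h v * edgePoint a b t v = (1 - t) * h a + t * h b := by
    rw [Finset.sum_eq_add a b hab (fun v _ hv => by rw [h0 v hv.1 hv.2, mul_zero]) (by simp)
      (by simp), ha, hb]
    ring
  have h2 : ∑ u, ∑ v, powerSlope q f h u v *
      powerDefect q (f u) (f v) (edgePoint a b t u) (edgePoint a b t v) =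
      2 * (powerSlope q f h a b * powerDefect q (f a) (f b) (1 - t) t) := by
    rw [Finset.sum_eq_add a b hab _ (by simp) (by simp),
      Finset.sum_eq_single b, Finset.sum_eq_single a, ha, hb, powerSlope_symm q f h b a,
      powerDefect_symm q (f b)]
    · ring
    · intro v _ hv
      by_cases hvb : v = b
      · simp [hvb, powerSlope]
      · rw [h0 v hv hvb, powerDefect_zero_right hq, mul_zero]
    · simp
    · intro v _ hv
      by_cases hva : v = a
      · simp [hva, powerSlope]
      · rw [h0 v hva hv, powerDefect_zero_right hq, mul_zero]
    · simp
    · intro v _ hv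
      refine Finset.sum_eq_zero fun w _ => ?_
      rw [h0 v hv.1 hv.2, powerDefect_zero_left hq, mul_zero]
  have h3 : powerSlope q f h a b * ((f b : ℝ) ^ q - (f a : ℝ) ^ q) = h b - h a := by
    by_cases hg : (f b : ℝ) ^ q - (f a : ℝ) ^ q = 0
    · have : f a = f b := by
        apply NNReal.coe_injective
        exact (pow_left_inj₀ (f a).2 (f b).2 hq).1 (sub_eq_zero.1 hg).symm
      rw [hg, hfh this]; simp
    · rw [powerSlope, div_mul_cancel₀ _ hg]
  rw [interpolate, h1, h2, powerDefect, show 1 - t + t = 1 by ring, one_pow]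
  linear_combination (-t) * h3

/-- The values at the ends of an edge are ordered by `h` as they are by `f`. -/
def Comonotone (G : SimpleGraph V) (f : V → ℝ≥0) (h : V → ℝ) : Prop :=
  ∀ a b, G.Adj a b → f a ≤ f b → h a ≤ h b

variable {q : ℕ} {f : V → ℝ≥0} {h : V → ℝ}

theorem Comonotone.eq (hh : Comonotone G f h) {a b : V} (hab : G.Adj a b) (hf : f a = f b) :
    h a = h b :=
  le_antisymm (hh a b hab hf.le) (hh b a hab.symm hf.ge)

theorem Comonotone.interpolate_mono (hq : q ≠ 0) (hh : Comonotone G f h) {a b : V}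
    (hab : G.Adj a b) (hf : f a ≤ f b) {t t' : ℝ} (h0 : 0 ≤ t) (htt' : t ≤ t') :
    interpolate q f h (edgePoint a b t) ≤ interpolate q f h (edgePoint a b t') := by
  have hf' : (f a : ℝ) ≤ f b := hf
  have ha : (0 : ℝ) ≤ f a := (f a).2
  rw [interpolate_edgePoint hq f h hab.ne (hh.eq hab), interpolate_edgePoint hq f h hab.ne (hh.eq hab)]
  have hs : 0 ≤ powerSlope q f h a b :=
    div_nonneg (sub_nonneg.2 (hh a b hab hf)) (sub_nonneg.2 (pow_le_pow_left₀ ha hf' q))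
  have : ((1 - t) * f a + t * f b : ℝ) ^ q ≤ ((1 - t') * f a + t' * f b) ^ q := by
    apply pow_le_pow_left₀ <;> nlinarith
  nlinarith

theorem Comonotone.interpolate_nonneg (hq : q ≠ 0) (hh : Comonotone G f h) (hpos : ∀ v, 0 ≤ h v)
    {x : V → ℝ} (hx : x ∈ realization G) : 0 ≤ interpolate q f h x := by
  rcases realization_cases_le f hx with ⟨v, rfl⟩ | ⟨a, b, t, hab, hf, h0, h1, rfl⟩
  · rw [interpolate_vertexPoint hq]; exact hpos v
  · refine le_trans ?_ (hh.interpolate_mono hq hab hf le_rfl h0)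
    rw [edgePoint_zero, interpolate_vertexPoint hq]; exact hpos a

/-- The `q`-th root of the interpolation. -/
noncomputable def interpolateRoot (G : SimpleGraph V) (q : ℕ) (f : V → ℝ≥0) (h : V → ℝ)
    (x : realization G) : ℝ≥0 :=
  Real.toNNReal (interpolate q f h x.1) ^ ((q : ℝ)⁻¹)

theorem continuous_interpolateRoot : Continuous (interpolateRoot G q f h) := by
  unfold interpolateRoot
  exact (NNReal.continuous_rpow_const (by positivity)).comp
    (continuous_real_toNNReal.comp ((continuous_interpolate q f h).comp continuous_subtype_val))

theorem interpolateRoot_pow (hq : q ≠ 0) (hh : Comonotone G f h) (hpos : ∀ v, 0 ≤ h v)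
    (x : realization G) : ((interpolateRoot G q f h x : ℝ)) ^ q = interpolate q f h x.1 := by
  rw [← NNReal.coe_pow, interpolateRoot, NNReal.rpow_inv_natCast_pow _ hq,
    Real.coe_toNNReal _ (hh.interpolate_nonneg hq hpos x.2)]

theorem lt_interpolateRoot (hq : q ≠ 0) (hh : Comonotone G f h) (hpos : ∀ v, 0 ≤ h v) (c : ℝ≥0)
    (x : realization G) : c < interpolateRoot G q f h x ↔ (c : ℝ) ^ q < interpolate q f h x.1 := by
  rw [← interpolateRoot_pow hq hh hpos, ← NNReal.coe_lt_coe,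
    pow_lt_pow_iff_left₀ c.coe_nonneg (interpolateRoot G q f h x).coe_nonneg hq]

theorem le_interpolateRoot (hq : q ≠ 0) (hh : Comonotone G f h) (hpos : ∀ v, 0 ≤ h v) (c : ℝ≥0)
    (x : realization G) : c ≤ interpolateRoot G q f h x ↔ (c : ℝ) ^ q ≤ interpolate q f h x.1 := by
  rw [← interpolateRoot_pow hq hh hpos, ← NNReal.coe_le_coe,
    pow_le_pow_iff_left₀ c.coe_nonneg (interpolateRoot G q f h x).coe_nonneg hq]

end Interpolation

/-! ### Decompositions that are read off from a rooted forest -/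

section Forest

variable {V : Type} [Fintype V] [DecidableEq V] {G : SimpleGraph V}

/-- The edges between the vertices where `f` is positive are those that join a vertex to its
parent; roots are their own parents. -/
structure IsRootedForest (G : SimpleGraph V) (f : V → ℝ≥0) (par : V → V) (rank : V → ℕ) : Prop where
  rank_le : ∀ v, rank (par v) ≤ rank v
  adj : ∀ v, 0 < f v → par v ≠ v → G.Adj v (par v)
  rank_lt : ∀ v, 0 < f v → par v ≠ v → rank (par v) < rank v
  edge : ∀ u v, 0 < f u → 0 < f v → G.Adj u v → par u = v ∨ par v = u

/-- A function decreases away from the vertex `m` in a rooted forest: it increases from child to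
parent off the chain of ancestors of `m`, and from parent to child on that chain. -/
structure DecreasesFrom (par : V → V) (m : V) (h : V → ℝ) : Prop where
  off : ∀ v, 0 < h v → (∀ k, par^[k] m ≠ v) → par v ≠ v ∧ h v ≤ h (par v)
  on : ∀ k, h (par^[k + 1] m) ≤ h (par^[k] m)

/-- A threshold for positive numbers. -/
structure IsThreshold (θ : ℝ → Prop) : Prop where
  pos : ∀ x, θ x → 0 < x
  mono : ∀ x y, x ≤ y → θ x → θ y

theorem isThreshold_lt {c : ℝ} (hc : 0 ≤ c) : IsThreshold fun x => c < x :=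
  ⟨fun _ h => hc.trans_lt h, fun _ _ h h' => h'.trans_le h⟩

theorem isThreshold_le {c : ℝ} (hc : 0 < c) : IsThreshold fun x => c ≤ x :=
  ⟨fun _ h => hc.trans_le h, fun _ _ h h' => h'.trans h⟩

variable {f : V → ℝ≥0} {par : V → V} {rank : V → ℕ} {m : V} {h : V → ℝ}

theorem DecreasesFrom.iterate_le (hm : DecreasesFrom par m h) (k i : ℕ) :
    h (par^[k + i] m) ≤ h (par^[k] m) := by
  induction i with
  | zero => exact le_rfl
  | succ i ih => exact (hm.on (k + i)).trans ih

/-- The superlevel sets of a function that decreases from a vertex have a top vertex. -/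
theorem DecreasesFrom.exists_top (hF : IsRootedForest G f par rank) (hm : DecreasesFrom par m h)
    (hpos : ∀ v, 0 < h v → 0 < f v) {θ : ℝ → Prop} (hθ : IsThreshold θ) {v₀ : V} (hv₀ : θ (h v₀)) :
    ∃ t, θ (h t) ∧ ∀ v, θ (h v) → v ≠ t → par v ≠ v ∧ θ (h (par v)) := by
  classical
  have hex : ∃ k, θ (h (par^[k] m)) := by
    have : ∀ n v, rank v = n → θ (h v) → ∃ k, θ (h (par^[k] m)) := by
      intro n
      induction n using Nat.strong_induction_on with
      | _ n ih =>
        intro v hn hv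
        by_cases hP : ∃ k, par^[k] m = v
        · obtain ⟨k, rfl⟩ := hP
          exact ⟨k, hv⟩
        · push Not at hP
          obtain ⟨h1, h2⟩ := hm.off v (hθ.pos _ hv) hP
          exact ih _ (hn ▸ hF.rank_lt v (hpos v (hθ.pos _ hv)) h1) _ rfl (hθ.mono _ _ h2 hv)
    exact this _ v₀ rfl hv₀
  obtain ⟨t, ht, hmin⟩ := Finset.exists_min_image
    (Finset.univ.filter fun v => θ (h v) ∧ ∃ k, par^[k] m = v) rank
    (by obtain ⟨k, hk⟩ := hex; exact ⟨par^[k] m, by simp [hk]⟩)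
  simp only [Finset.mem_filter, Finset.mem_univ, true_and] at ht hmin
  obtain ⟨htθ, k, rfl⟩ := ht
  refine ⟨_, htθ, fun v hv hvt => ?_⟩
  by_cases hP : ∃ j, par^[j] m = v
  swap
  · push Not at hP
    obtain ⟨h1, h2⟩ := hm.off v (hθ.pos _ hv) hP
    exact ⟨h1, hθ.mono _ _ h2 hv⟩
  obtain ⟨j, rfl⟩ := hP
  have fix : ∀ i w, par w = w → par^[i] w = w := fun i w hw => Function.iterate_fixed hw i
  rcases lt_or_ge j k with hjk | hjk
  · obtain ⟨i, rfl⟩ : ∃ i, k = j + 1 + i := ⟨k - (j + 1), by omega⟩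
    refine ⟨fun hr => hvt ?_, ?_⟩
    · rw [show j + 1 + i = (1 + i) + j by ring, Function.iterate_add_apply, fix _ _ hr]
    · rw [← Function.iterate_succ_apply' par j m]
      exact hθ.mono _ _ (hm.iterate_le (j + 1) i) htθ
  · exfalso
    obtain ⟨i, rfl⟩ : ∃ i, j = i + k := ⟨j - k, by omega⟩
    rw [Function.iterate_add_apply] at hv hvt
    set t := par^[k] m
    have hle : ∀ i w, rank (par^[i] w) ≤ rank w := by
      intro i
      induction i with
      | zero => exact fun w => le_rfl
      | succ i ih => exact fun w => (ih (par w)).trans (hF.rank_le w)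
    by_cases hr : par t = t
    · exact hvt (fix _ _ hr)
    · have h1 := hF.rank_lt t (hpos t (hθ.pos _ htθ)) hr
      obtain ⟨i', rfl⟩ : ∃ i', i = i' + 1 := by
        refine ⟨i - 1, ?_⟩
        have : i ≠ 0 := by rintro rfl; exact hvt rfl
        omega
      have h2 := hmin _ ⟨hv, i' + 1 + k, Function.iterate_add_apply par _ k m⟩
      have h3 : rank (par^[i' + 1] t) ≤ rank (par t) := hle i' (par t)
      omega

theorem IsRootedForest.isRootedSubtree (hF : IsRootedForest G f par rank) {A : Finset V} {t : V}
    (ht : t ∈ A) (hA : ∀ v ∈ A, 0 < f v) (hpar : ∀ v ∈ A, v ≠ t → par v ≠ v ∧ par v ∈ A) :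
    IsRootedSubtree G par rank t A where
  root_mem := ht
  par_mem v hv hvt := (hpar v hv hvt).2
  par_adj v hv hvt := hF.adj v (hA v hv) (hpar v hv hvt).1
  rank_lt v hv hvt := hF.rank_lt v (hA v hv) (hpar v hv hvt).1
  rank_le := hF.rank_le t
  edge u hu v hv := hF.edge u v (hA u hu) (hA v hv)

/-- Two functions on the vertices that extend to a strong unimodal decomposition: both are
comonotone with `f`, the first one decreases away from the root `ρ`, the second one from the
vertex `m`. -/
structure IsForestPair (G : SimpleGraph V) (f : V → ℝ≥0) (par : V → V) (rank : V → ℕ) (ρ m : V)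
    (h₁ h₂ : V → ℝ) : Prop where
  forest : IsRootedForest G f par rank
  root : par ρ = ρ
  nonneg₁ : ∀ v, 0 ≤ h₁ v
  nonneg₂ : ∀ v, 0 ≤ h₂ v
  pos₁ : ∀ v, 0 < h₁ v → 0 < f v
  pos₂ : ∀ v, 0 < h₂ v → 0 < f v
  comonotone₁ : Comonotone G f h₁
  comonotone₂ : Comonotone G f h₂
  decreases₁ : ∀ v, 0 < h₁ v → v ≠ ρ → par v ≠ v ∧ h₁ v ≤ h₁ (par v)
  decreases₂ : DecreasesFrom par m h₂

namespace IsForestPair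

variable {ρ : V} {h₁ h₂ : V → ℝ}

theorem root_mem (H : IsForestPair G f par rank ρ m h₁ h₂) {θ : ℝ → Prop} (hθ : IsThreshold θ)
    {v : V} (hv : θ (h₁ v)) : θ (h₁ ρ) := by
  have : ∀ n v, rank v = n → θ (h₁ v) → θ (h₁ ρ) := by
    intro n
    induction n using Nat.strong_induction_on with
    | _ n ih =>
      intro v hn hv
      by_cases hvρ : v = ρ
      · exact hvρ ▸ hv
      · obtain ⟨h1, h2⟩ := H.decreases₁ v (hθ.pos _ hv) hvρ
        exact ih _ (hn ▸ H.forest.rank_lt v (H.pos₁ v (hθ.pos _ hv)) h1) _ rfl (hθ.mono _ _ h2 hv)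
  exact this _ v rfl hv

theorem subtree₁ (H : IsForestPair G f par rank ρ m h₁ h₂) {θ : ℝ → Prop} (hθ : IsThreshold θ)
    {A : Finset V} (hne : A.Nonempty) (hA : ∀ v, v ∈ A ↔ θ (h₁ v)) :
    IsRootedSubtree G par rank ρ A := by
  obtain ⟨v₀, hv₀⟩ := hne
  refine H.forest.isRootedSubtree ((hA ρ).2 (H.root_mem hθ ((hA v₀).1 hv₀)))
    (fun v hv => H.pos₁ v (hθ.pos _ ((hA v).1 hv))) fun v hv hvρ => ?_
  obtain ⟨h1, h2⟩ := H.decreases₁ v (hθ.pos _ ((hA v).1 hv)) hvρ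
  exact ⟨h1, (hA _).2 (hθ.mono _ _ h2 ((hA v).1 hv))⟩

theorem subtree₂ (H : IsForestPair G f par rank ρ m h₁ h₂) {θ : ℝ → Prop} (hθ : IsThreshold θ)
    {A : Finset V} (hne : A.Nonempty) (hA : ∀ v, v ∈ A ↔ θ (h₂ v)) :
    ∃ t, IsRootedSubtree G par rank t A := by
  obtain ⟨v₀, hv₀⟩ := hne
  obtain ⟨t, ht, htop⟩ := H.decreases₂.exists_top H.forest H.pos₂ hθ ((hA v₀).1 hv₀)
  refine ⟨t, H.forest.isRootedSubtree ((hA t).2 ht)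
    (fun v hv => H.pos₂ v (hθ.pos _ ((hA v).1 hv))) fun v hv hvt => ?_⟩
  obtain ⟨h1, h2⟩ := htop v ((hA v).1 hv) hvt
  exact ⟨h1, (hA _).2 h2⟩

theorem subtree₁₂ (H : IsForestPair G f par rank ρ m h₁ h₂) {θ₁ θ₂ : ℝ → Prop}
    (hθ₁ : IsThreshold θ₁) (hθ₂ : IsThreshold θ₂)
    {A : Finset V} (hne : A.Nonempty) (hA : ∀ v, v ∈ A ↔ θ₁ (h₁ v) ∧ θ₂ (h₂ v)) :
    ∃ t, IsRootedSubtree G par rank t A := by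
  obtain ⟨v₀, hv₀⟩ := hne
  have hv₀ := (hA v₀).1 hv₀
  obtain ⟨t, ht, htop⟩ := H.decreases₂.exists_top H.forest H.pos₂ hθ₂ hv₀.2
  have step : ∀ v, θ₁ (h₁ v) ∧ θ₂ (h₂ v) → v ≠ t →
      par v ≠ v ∧ θ₁ (h₁ (par v)) ∧ θ₂ (h₂ (par v)) := by
    intro v hv hvt
    obtain ⟨h1, h2⟩ := htop v hv.2 hvt
    have hvρ : v ≠ ρ := by rintro rfl; exact h1 H.root
    exact ⟨h1, hθ₁.mono _ _ (H.decreases₁ v (hθ₁.pos _ hv.1) hvρ).2 hv.1, h2⟩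
  have htA : θ₁ (h₁ t) := by
    have : ∀ n v, rank v = n → θ₁ (h₁ v) ∧ θ₂ (h₂ v) → θ₁ (h₁ t) := by
      intro n
      induction n using Nat.strong_induction_on with
      | _ n ih =>
        intro v hn hv
        by_cases hvt : v = t
        · exact hvt ▸ hv.1
        · obtain ⟨h1, h2⟩ := step v hv hvt
          exact ih _ (hn ▸ H.forest.rank_lt v (H.pos₁ v (hθ₁.pos _ hv.1)) h1) _ rfl h2
    exact this _ v₀ rfl hv₀
  refine ⟨t, H.forest.isRootedSubtree ((hA t).2 ⟨htA, ht⟩)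
    (fun v hv => H.pos₁ v (hθ₁.pos _ ((hA v).1 hv).1)) fun v hv hvt => ?_⟩
  obtain ⟨h1, h2⟩ := step v ((hA v).1 hv) hvt
  exact ⟨h1, (hA _).2 h2⟩

/-- The superlevel sets of the interpolations are contractible because their vertices span
subtrees. -/
theorem isStrongDecomposition (H : IsForestPair G f par rank ρ m h₁ h₂) {q : ℕ} (hq : q ≠ 0)
    {p : ℕ∞} (hdec : DecomposesTo p ![interpolateRoot G q f h₁, interpolateRoot G q f h₂]
      (edgeLinear G f)) :
    IsStrongDecomposition p ![interpolateRoot G q f h₁, interpolateRoot G q f h₂]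
      (edgeLinear G f) := by
  -- Superlevel sets of the interpolations, and their intersections, are closed under moving along
  -- an edge towards the larger value of `f`.
  have up : ∀ (h : V → ℝ) (θ : ℝ → Prop), Comonotone G f h → IsThreshold θ → ∀ a b, G.Adj a b →
      f a ≤ f b → ∀ t t', 0 ≤ t → t ≤ t' → θ (interpolate q f h (edgePoint a b t)) →
      θ (interpolate q f h (edgePoint a b t')) :=
    fun h θ hh hθ a b hab hf t t' h0 htt' ht =>
      hθ.mono _ _ (hh.interpolate_mono hq hab hf h0 htt') ht
  have vert : ∀ (h : V → ℝ) (v : V), interpolate q f h (vtx G v).1 = h v := fun h v =>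
    interpolate_vertexPoint hq f h v
  have s₁ : ∀ θ, IsThreshold θ →
      ContractibleOrEmpty {x : realization G | θ (interpolate q f h₁ x.1)} := fun θ hθ =>
    contractibleOrEmpty_of_upward f _
      (fun a b hab hf t t' h0 htt' _ => up h₁ θ H.comonotone₁ hθ a b hab hf t t' h0 htt')
      fun A hne hA => ⟨par, rank, ρ, H.subtree₁ hθ hne (by simpa [vert] using hA)⟩
  have s₂ : ∀ θ, IsThreshold θ →
      ContractibleOrEmpty {x : realization G | θ (interpolate q f h₂ x.1)} := fun θ hθ =>
    contractibleOrEmpty_of_upward f _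
      (fun a b hab hf t t' h0 htt' _ => up h₂ θ H.comonotone₂ hθ a b hab hf t t' h0 htt')
      fun A hne hA => ⟨par, rank, H.subtree₂ hθ hne (by simpa [vert] using hA)⟩
  have s₁₂ : ∀ θ₁ θ₂, IsThreshold θ₁ → IsThreshold θ₂ → ContractibleOrEmpty
      {x : realization G | θ₁ (interpolate q f h₁ x.1) ∧ θ₂ (interpolate q f h₂ x.1)} :=
    fun θ₁ θ₂ hθ₁ hθ₂ => contractibleOrEmpty_of_upward f _
      (fun a b hab hf t t' h0 htt' _ hx =>
        ⟨up h₁ θ₁ H.comonotone₁ hθ₁ a b hab hf t t' h0 htt' hx.1,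
          up h₂ θ₂ H.comonotone₂ hθ₂ a b hab hf t t' h0 htt' hx.2⟩)
      fun A hne hA => ⟨par, rank, H.subtree₁₂ hθ₁ hθ₂ hne (by simpa [vert] using hA)⟩
  have lt₁ := lt_interpolateRoot hq H.comonotone₁ H.nonneg₁
  have lt₂ := lt_interpolateRoot hq H.comonotone₂ H.nonneg₂
  have le₁ := le_interpolateRoot hq H.comonotone₁ H.nonneg₁
  have le₂ := le_interpolateRoot hq H.comonotone₂ H.nonneg₂
  refine ⟨fun i => ?_, hdec, fun J hJ c => ?_⟩
  · fin_cases i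
    · refine ⟨continuous_interpolateRoot, fun c hc => ?_⟩
      simpa only [Fin.zero_eta, Matrix.cons_val_zero, le₁] using
        s₁ _ (isThreshold_le (pow_pos (NNReal.coe_pos.2 hc) q))
    · refine ⟨continuous_interpolateRoot, fun c hc => ?_⟩
      simpa only [Fin.mk_one, Matrix.cons_val_one, Matrix.cons_val_zero, le₂] using
        s₂ _ (isThreshold_le (pow_pos (NNReal.coe_pos.2 hc) q))
  · have hc : ∀ i, (0 : ℝ) ≤ (c i : ℝ) ^ q := fun i => pow_nonneg (c i).2 q
    by_cases h0 : (0 : Fin 2) ∈ J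
    · by_cases h1 : (1 : Fin 2) ∈ J
      · convert s₁₂ _ _ (isThreshold_lt (hc 0)) (isThreshold_lt (hc 1)) using 1
        ext x
        simp [Fin.forall_fin_two, h0, h1, lt₁, lt₂]
      · convert s₁ _ (isThreshold_lt (hc 0)) using 1
        ext x
        simp [Fin.forall_fin_two, h0, h1, lt₁]
    · by_cases h1 : (1 : Fin 2) ∈ J
      · convert s₂ _ (isThreshold_lt (hc 1)) using 1
        ext x
        simp [Fin.forall_fin_two, h0, h1, lt₂]
      · obtain ⟨j, hj⟩ := hJ
        fin_cases j
        exacts [(h0 hj).elim, (h1 hj).elim]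

theorem strongUcat_le_two_of_decomposesTo (H : IsForestPair G f par rank ρ m h₁ h₂) {q : ℕ}
    (hq : q ≠ 0) {p : ℕ∞} (hdec : DecomposesTo p
      ![interpolateRoot G q f h₁, interpolateRoot G q f h₂] (edgeLinear G f)) :
    strongUcat p (edgeLinear G f) ≤ 2 :=
  sInf_le ⟨2, rfl, _, H.isStrongDecomposition hq hdec⟩

/-- Values on an edge are affine functions of the `q`-th power of `f` with values `h` at the ends. -/
theorem _root_.exists_interpolate_eq {q : ℕ} (hq : q ≠ 0) {x : V → ℝ} (hx : x ∈ realization G) :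
    (∃ v, ((∑ w, x w * f w : ℝ) = f v) ∧ ∀ h, interpolate q f h x = h v) ∨
    ∃ a b τ, G.Adj a b ∧ 0 ≤ τ ∧ τ ≤ 1 ∧
      (∑ w, x w * f w : ℝ) ^ q = (1 - τ) * (f a : ℝ) ^ q + τ * (f b : ℝ) ^ q ∧
      ∀ h, Comonotone G f h → interpolate q f h x = (1 - τ) * h a + τ * h b := by
  rcases realization_cases_le f hx with ⟨v, rfl⟩ | ⟨a, b, t, hab, hf, h0, h1, rfl⟩
  · refine Or.inl ⟨v, ?_, fun h => interpolate_vertexPoint hq f h v⟩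
    simp [vertexPoint, Pi.single_apply]
  · right
    have hs : (∑ w, edgePoint a b t w * f w : ℝ) = (1 - t) * f a + t * f b := by
      simp [edgePoint_apply, add_mul, Finset.sum_add_distrib]
    have hfa : (0 : ℝ) ≤ f a := (f a).2
    have hf' : (f a : ℝ) ≤ f b := hf
    have l1 : (f a : ℝ) ^ q ≤ ((1 - t) * f a + t * f b) ^ q := by
      apply pow_le_pow_left₀ hfa; nlinarith
    have l2 : ((1 - t) * f a + t * f b : ℝ) ^ q ≤ (f b : ℝ) ^ q := by
      apply pow_le_pow_left₀ <;> nlinarith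
    rcases hf.eq_or_lt with hfe | hlt
    · refine ⟨a, b, 0, hab, le_rfl, zero_le_one, ?_, fun h hh => ?_⟩
      · rw [hs, ← hfe]; ring
      · rw [interpolate_edgePoint hq f h hab.ne (hh.eq hab), ← hfe]; ring
    · have hd : 0 < (f b : ℝ) ^ q - (f a : ℝ) ^ q :=
        sub_pos.2 (pow_lt_pow_left₀ hlt hfa hq)
      refine ⟨a, b, (((1 - t) * f a + t * f b) ^ q - (f a : ℝ) ^ q) /
        ((f b : ℝ) ^ q - (f a : ℝ) ^ q), hab, div_nonneg (by linarith) hd.le,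
        (div_le_one hd).2 (by linarith), ?_, fun h hh => ?_⟩
      · rw [hs]; field_simp; ring
      · rw [interpolate_edgePoint hq f h hab.ne (hh.eq hab), powerSlope]; field_simp; ring

theorem strongUcat_le_two (H : IsForestPair G f par rank ρ m h₁ h₂) {q : ℕ}
    (hq : q ≠ 0) (hsum : ∀ v, h₁ v + h₂ v = (f v : ℝ) ^ q) :
    strongUcat q (edgeLinear G f) ≤ 2 := by
  refine H.strongUcat_le_two_of_decomposesTo hq fun x => ?_
  apply NNReal.coe_injective
  simp only [Fin.sum_univ_two, Matrix.cons_val_zero, Matrix.cons_val_one, NNReal.coe_add,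
    NNReal.coe_pow, interpolateRoot_pow hq H.comonotone₁ H.nonneg₁,
    interpolateRoot_pow hq H.comonotone₂ H.nonneg₂, edgeLinear_eq_sum]
  rcases exists_interpolate_eq (f := f) hq x.2 with ⟨v, h1, h2⟩ | ⟨a, b, τ, -, -, -, h1, h2⟩
  · rw [h2, h2, h1, hsum]
  · rw [h2 _ H.comonotone₁, h2 _ H.comonotone₂, h1, ← hsum, ← hsum]; ring

/-- For `p = ∞`, the maximum of the interpolations is `f` on an edge if one of the two functions
agrees with `f` at both of its ends. -/
theorem strongUcat_top_le_two (H : IsForestPair G f par rank ρ m h₁ h₂)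
    (hle₁ : ∀ v, h₁ v ≤ f v) (hle₂ : ∀ v, h₂ v ≤ f v) (hv : ∀ v, h₁ v = f v ∨ h₂ v = f v)
    (he : ∀ a b, G.Adj a b → (h₁ a = f a ∧ h₁ b = f b) ∨ (h₂ a = f a ∧ h₂ b = f b)) :
    strongUcat ⊤ (edgeLinear G f) ≤ 2 := by
  refine H.strongUcat_le_two_of_decomposesTo one_ne_zero fun x => ?_
  apply NNReal.coe_injective
  have e₁ := interpolateRoot_pow one_ne_zero H.comonotone₁ H.nonneg₁ x
  have e₂ := interpolateRoot_pow one_ne_zero H.comonotone₂ H.nonneg₂ x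
  rw [pow_one] at e₁ e₂
  have hu : (Finset.univ : Finset (Fin 2)) = {0, 1} := rfl
  simp only [hu, Finset.sup_insert, Finset.sup_singleton, Matrix.cons_val_zero,
    Matrix.cons_val_one, NNReal.coe_max, e₁, e₂, edgeLinear_eq_sum]
  rcases exists_interpolate_eq (f := f) one_ne_zero x.2 with
    ⟨v, h1, h2⟩ | ⟨a, b, τ, hab, h0, hτ, h1, h2⟩
  · rw [h2, h2, h1]
    rcases hv v with h | h
    · rw [h]; exact max_eq_left (hle₂ v)
    · rw [h]; exact max_eq_right (hle₁ v)
  · rw [h2 _ H.comonotone₁, h2 _ H.comonotone₂]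
    rw [pow_one, pow_one, pow_one] at h1
    rw [h1]
    have h1τ : 0 ≤ 1 - τ := sub_nonneg.2 hτ
    rcases he a b hab with ⟨h3, h4⟩ | ⟨h3, h4⟩
    · rw [h3, h4]
      exact max_eq_left (add_le_add (mul_le_mul_of_nonneg_left (hle₂ a) h1τ)
        (mul_le_mul_of_nonneg_left (hle₂ b) h0))
    · rw [h3, h4]
      exact max_eq_right (add_le_add (mul_le_mul_of_nonneg_left (hle₁ a) h1τ)
        (mul_le_mul_of_nonneg_left (hle₁ b) h0))

end IsForestPair

end Forest

/-! ### Search forests -/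

section SearchForest

variable {V : Type} [Fintype V] [DecidableEq V]

/-- The contribution of a vertex to the rises along the paths of a search forest: the amount by
which it exceeds its parent. The value of a root other than `ρ` counts in full. -/
def increment (g : V → ℕ) (ρ : V) (par : V → V) (v : V) : ℕ :=
  if par v = v then (if v = ρ then 0 else g v) else g v - g (par v)

/-- A forest that a search finds among the vertices where `g` is positive. It starts at the root
`ρ`; a second root `m` is possible in another component. `M` is the set of the vertices found so
far, `rise v` adds up the increments from the root to `v`, `low v` is the minimum of `g` from the
root to `v` if `ε = 1` and `0` if `ε = 0`, and `total` adds up all increments. For the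
second root, `rise` and `low` are chosen in such a way that it needs no separate treatment; the set
`C` in the field `second` shows that it lies in another component than `ρ`. -/
structure IsSearchForest (G : SimpleGraph V) (g : V → ℕ) (ε : ℕ) (ρ m : V) (M : Finset V)
    (par : V → V) (rank rise low : V → ℕ) (total : ℕ) : Prop where
  pos : ∀ v ∈ M, 0 < g v
  root_mem : ρ ∈ M
  par_root : par ρ = ρ
  rise_root : rise ρ = 0
  low_root : low ρ = ε * g ρ
  par_of_notMem : ∀ v, v ∉ M → par v = v
  second : ∀ v ∈ M, par v = v → v ≠ ρ → v = m ∧ rise v = g v ∧ low v = 0 ∧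
    ∃ C : Set V, ρ ∈ C ∧ m ∉ C ∧ ∀ u ∈ C, ∀ w, G.Adj u w → 0 < g u → 0 < g w → w ∈ C
  par_mem : ∀ v ∈ M, par v ∈ M
  adj : ∀ v ∈ M, par v ≠ v → G.Adj v (par v)
  rank_lt : ∀ v ∈ M, par v ≠ v → rank (par v) < rank v
  rise_eq : ∀ v ∈ M, par v ≠ v → rise v = rise (par v) + (g v - g (par v))
  low_eq : ∀ v ∈ M, par v ≠ v → low v = min (low (par v)) (g v)
  total_eq : total = ∑ v ∈ M, increment g ρ par v

/-- The criterion for the search forest from `ρ` and `m`: it consists of all vertices and edges of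
the subgraph where `g` is positive, all increments occur on the path to `m`, and the values on this
path leave room for them. -/
structure IsAccepting (G : SimpleGraph V) (g : V → ℕ) (m : V) (M : Finset V)
    (par : V → V) (rise low : V → ℕ) (total : ℕ) : Prop where
  mem : ∀ v, 0 < g v → v ∈ M
  edge : ∀ u v, 0 < g u → 0 < g v → G.Adj u v → par u = v ∨ par v = u
  rise_eq_total : rise m = total
  rise_add_low_le : rise m + low m ≤ g m

namespace IsSearchForest

variable {G : SimpleGraph V} {g : V → ℕ} {ε : ℕ} {ρ m : V} {M : Finset V} {par : V → V}
  {rank rise low : V → ℕ} {total : ℕ}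

theorem iterate_mem (S : IsSearchForest G g ε ρ m M par rank rise low total) (k : ℕ) :
    ∀ v ∈ M, par^[k] v ∈ M := by
  induction k with
  | zero => exact fun v hv => hv
  | succ k ih => exact fun v hv => ih _ (S.par_mem v hv)

theorem rank_par_le (S : IsSearchForest G g ε ρ m M par rank rise low total) (v : V) :
    rank (par v) ≤ rank v := by
  by_cases h : par v = v
  · rw [h]
  · by_cases hv : v ∈ M
    · exact (S.rank_lt v hv h).le
    · exact absurd (S.par_of_notMem v hv) h

theorem rank_iterate_le (S : IsSearchForest G g ε ρ m M par rank rise low total) (k : ℕ) :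
    ∀ v, rank (par^[k] v) ≤ rank v := by
  induction k with
  | zero => exact fun v => le_rfl
  | succ k ih => exact fun v => (ih (par v)).trans (S.rank_par_le v)

/-- Induction from the roots to the leaves. -/
theorem induction (S : IsSearchForest G g ε ρ m M par rank rise low total) {P : V → Prop}
    (hroot : ∀ v ∈ M, par v = v → P v) (hchild : ∀ v ∈ M, par v ≠ v → P (par v) → P v) :
    ∀ v ∈ M, P v := by
  have : ∀ n, ∀ v ∈ M, rank v = n → P v := by
    intro n
    induction n using Nat.strong_induction_on with
    | _ n ih =>
      intro v hv hn
      by_cases h : par v = v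
      · exact hroot v hv h
      · exact hchild v hv h (ih _ (hn ▸ S.rank_lt v hv h) _ (S.par_mem v hv) rfl)
  exact fun v hv => this _ v hv rfl

/-- The first root lies on the path of a vertex, or the path ends in the second root. -/
theorem exists_root (S : IsSearchForest G g ε ρ m M par rank rise low total) :
    ∀ v ∈ M, ∃ k, par^[k] v = ρ ∨ (par^[k] v = m ∧ par m = m ∧ m ≠ ρ ∧ m ∈ M) := by
  refine S.induction (fun v hv h => ⟨0, ?_⟩) fun v hv h ⟨k, hk⟩ => ⟨k + 1, hk⟩
  by_cases hρ : v = ρ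
  · exact Or.inl hρ
  · have := (S.second v hv h hρ).1
    exact Or.inr ⟨this, this ▸ h, this ▸ hρ, this ▸ hv⟩

/-- The vertices on the path from `v` to its root. -/
def _root_.ancestors (par : V → V) (v : V) : Set V := {w | ∃ k, par^[k] v = w}

theorem _root_.mem_ancestors {par : V → V} {v w : V} :
    w ∈ ancestors par v ↔ ∃ k, par^[k] v = w := Iff.rfl

theorem rise_eq_sum (S : IsSearchForest G g ε ρ m M par rank rise low total)
    [DecidableRel fun v w => w ∈ ancestors par v] :
    ∀ v ∈ M, rise v = ∑ w ∈ M with w ∈ ancestors par v, increment g ρ par w := by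
  refine S.induction (fun v hv h => ?_) fun v hv h ih => ?_
  · have : (M.filter fun w => w ∈ ancestors par v) = {v} := by
      ext w
      simp only [Finset.mem_filter, Finset.mem_singleton, mem_ancestors,
        Function.iterate_fixed h]
      exact ⟨fun h' => h'.2.choose_spec.symm, fun h' => ⟨h' ▸ hv, 0, h'.symm⟩⟩
    rw [this, Finset.sum_singleton, increment, if_pos h]
    split_ifs with hρ
    · rw [hρ, S.rise_root]
    · exact (S.second v hv h hρ).2.1
  · have : (M.filter fun w => w ∈ ancestors par v) =
        insert v (M.filter fun w => w ∈ ancestors par (par v)) := by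
      ext w
      simp only [Finset.mem_filter, Finset.mem_insert, mem_ancestors]
      constructor
      · rintro ⟨hw, k, hk⟩
        cases k with
        | zero => exact Or.inl hk.symm
        | succ k => exact Or.inr ⟨hw, k, hk⟩
      · rintro (rfl | ⟨hw, k, hk⟩)
        · exact ⟨hv, 0, rfl⟩
        · exact ⟨hw, k + 1, hk⟩
    rw [this, Finset.sum_insert, ← ih, S.rise_eq v hv h, increment, if_neg h, add_comm]
    simp only [Finset.mem_filter, mem_ancestors, not_and, not_exists]
    intro _ k hk
    have h1 := S.rank_iterate_le k (par v)
    have h2 := S.rank_lt v hv h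
    rw [hk] at h1
    omega

/-- All increments occur on the path of `m` if and only if its rise is the total. -/
theorem rise_eq_total_iff (S : IsSearchForest G g ε ρ m M par rank rise low total) (hm : m ∈ M) :
    rise m = total ↔ ∀ v ∈ M, v ∉ ancestors par m → increment g ρ par v = 0 := by
  classical
  rw [S.rise_eq_sum m hm, S.total_eq, ← Finset.sum_filter_add_sum_filter_not M
    (fun w => w ∈ ancestors par m), left_eq_add, Finset.sum_eq_zero_iff]
  simp

section Accepting

variable (S : IsSearchForest G g ε ρ m M par rank rise low total) (hm : m ∈ M)
  (A : IsAccepting G g m M par rise low total)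

include S hm A

/-- Off the path to `m`, the values do not increase from parent to child. -/
theorem le_of_off {v : V} (hv : v ∈ M) (hoff : ∀ k, par^[k] m ≠ v) :
    v = ρ ∨ (par v ≠ v ∧ g v ≤ g (par v)) := by
  by_cases hρ : v = ρ
  · exact Or.inl hρ
  · right
    have h := (S.rise_eq_total_iff hm).1 A.rise_eq_total v hv (by simpa [mem_ancestors] using hoff)
    by_cases hr : par v = v
    · exact absurd (S.second v hv hr hρ).1.symm (hoff 0)
    · rw [increment, if_neg hr] at h
      exact ⟨hr, by omega⟩

/-- The last condition of `IsAccepting` propagates from `m` to its ancestors. -/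
theorem low_add_rise_le (k : ℕ) : low m + rise (par^[k] m) ≤ g (par^[k] m) := by
  induction k with
  | zero => have := A.rise_add_low_le; simp; omega
  | succ k ih =>
    rw [Function.iterate_succ_apply']
    have hu := S.iterate_mem k m hm
    set u := par^[k] m
    by_cases hr : par u = u
    · rwa [hr]
    · have := S.rise_eq u hu hr
      omega

omit hm A in
theorem low_le : ∀ v ∈ M, ε ≤ 1 → low v ≤ g v := by
  refine S.induction (fun v hv h hε => ?_) fun v hv h _ hε => ?_
  · by_cases hρ : v = ρ
    · rw [hρ, S.low_root]; nlinarith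
    · have := (S.second v hv h hρ).2.2.1
      omega
  · rw [S.low_eq v hv h]; exact min_le_right _ _

/-- The second summand of the decomposition that belongs to an accepting search forest. -/
def _root_.laterPart (g rise low : V → ℕ) (m : V) (v : V) : ℕ := min (g v) (rise v + low m)

theorem laterPart_comonotone {a b : V} (hab : G.Adj a b) (h : g a ≤ g b) :
    laterPart g rise low m a ≤ laterPart g rise low m b := by
  unfold laterPart
  rcases Nat.eq_zero_or_pos (g a) with h0 | h0
  · simp [h0]
  · have ha := A.mem a h0
    have hb := A.mem b (h0.trans_le h)
    rcases A.edge a b h0 (h0.trans_le h) hab with h' | h'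
    · have := S.rise_eq a ha (h' ▸ hab.ne')
      rw [h'] at this
      omega
    · have := S.rise_eq b hb (h' ▸ hab.ne)
      rw [h'] at this
      omega

theorem laterPart_off {v : V} (hpos : 0 < laterPart g rise low m v)
    (hoff : ∀ k, par^[k] m ≠ v) :
    par v ≠ v ∧ laterPart g rise low m v ≤ laterPart g rise low m (par v) := by
  have hv := A.mem v (lt_of_lt_of_le hpos (min_le_left _ _))
  rcases S.le_of_off hm A hv hoff with rfl | ⟨h1, h2⟩
  · obtain ⟨k, hk | ⟨hk, h3, h4, h5⟩⟩ := S.exists_root m hm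
    · exact absurd hk (hoff k)
    · have := (S.second m h5 h3 h4).2.2.1
      simp [laterPart, S.rise_root, this] at hpos
  · exact ⟨h1, S.laterPart_comonotone hm A (S.adj v hv h1) h2⟩

theorem laterPart_on (k : ℕ) :
    laterPart g rise low m (par^[k + 1] m) ≤ laterPart g rise low m (par^[k] m) := by
  rw [Function.iterate_succ_apply']
  have h1 := S.low_add_rise_le hm A k
  have hu := S.iterate_mem k m hm
  set u := par^[k] m
  by_cases hr : par u = u
  · rw [hr]
  · have := S.rise_eq u hu hr
    unfold laterPart
    omega

/-- In an accepting search forest, a second function on the vertices that decreases from the root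
`ρ` makes up, together with `laterPart`, a pair of functions that extends to the realization. The
numbers `g v` are multiples of the powers of the values of the edge-linear function. -/
theorem isForestPair {f : V → ℝ≥0} {q : ℕ} (hq : q ≠ 0) {D : ℝ} (hD : 0 < D)
    (hg : ∀ v, (g v : ℝ) = D * (f v : ℝ) ^ q) (h₁ : V → ℕ) (hle : ∀ v, h₁ v ≤ g v)
    (hco : ∀ a b, G.Adj a b → g a ≤ g b → h₁ a ≤ h₁ b)
    (hdec : ∀ v, 0 < h₁ v → v ≠ ρ → par v ≠ v ∧ h₁ v ≤ h₁ (par v)) :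
    IsForestPair G f par rank ρ m (fun v => (h₁ v : ℝ) / D)
      (fun v => (laterPart g rise low m v : ℝ) / D) := by
  have hpos : ∀ v, 0 < f v ↔ 0 < g v := by
    intro v
    rw [← Nat.cast_pos (α := ℝ), hg, mul_pos_iff_of_pos_left hD]
    refine ⟨fun h => pow_pos (NNReal.coe_pos.2 h) q, fun h => pos_of_ne_zero ?_⟩
    intro h0
    simp [h0, hq] at h
  have hmono : ∀ a b, f a ≤ f b → g a ≤ g b := by
    intro a b hab
    rw [← Nat.cast_le (α := ℝ), hg, hg]
    exact mul_le_mul_of_nonneg_left (pow_le_pow_left₀ (f a).2 hab q) hD.le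
  have hdiv : ∀ a b : ℕ, (a : ℝ) / D ≤ (b : ℝ) / D ↔ a ≤ b := fun a b => by
    rw [div_le_div_iff_of_pos_right hD, Nat.cast_le]
  have hdiv0 : ∀ a : ℕ, 0 < (a : ℝ) / D ↔ 0 < a := fun a => by
    rw [div_pos_iff_of_pos_right hD, Nat.cast_pos]
  have hmem : ∀ v, 0 < f v → v ∈ M := fun v hv => A.mem v ((hpos v).1 hv)
  exact
    { forest :=
        { rank_le := S.rank_par_le
          adj := fun v hv => S.adj v (hmem v hv)
          rank_lt := fun v hv => S.rank_lt v (hmem v hv)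
          edge := fun u v hu hv => A.edge u v ((hpos u).1 hu) ((hpos v).1 hv) }
      root := S.par_root
      nonneg₁ := fun v => div_nonneg (Nat.cast_nonneg _) hD.le
      nonneg₂ := fun v => div_nonneg (Nat.cast_nonneg _) hD.le
      pos₁ := fun v hv => (hpos v).2 (((hdiv0 _).1 hv).trans_le (hle v))
      pos₂ := fun v hv => (hpos v).2 (((hdiv0 _).1 hv).trans_le (min_le_left _ _))
      comonotone₁ := fun a b hab h => (hdiv _ _).2 (hco a b hab (hmono a b h))
      comonotone₂ := fun a b hab h =>
        (hdiv _ _).2 (S.laterPart_comonotone hm A hab (hmono a b h))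
      decreases₁ := fun v hv hρ =>
        ⟨(hdec v ((hdiv0 _).1 hv) hρ).1, (hdiv _ _).2 (hdec v ((hdiv0 _).1 hv) hρ).2⟩
      decreases₂ :=
        { off := fun v hv hoff =>
            ⟨(S.laterPart_off hm A ((hdiv0 _).1 hv) hoff).1,
              (hdiv _ _).2 (S.laterPart_off hm A ((hdiv0 _).1 hv) hoff).2⟩
          on := fun k => (hdiv _ _).2 (S.laterPart_on hm A k) } }

end Accepting

theorem low_eq_zero (S : IsSearchForest G g 0 ρ m M par rank rise low total) :
    ∀ v ∈ M, low v = 0 := by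
  refine S.induction (fun v hv h => ?_) fun v hv h ih => ?_
  · by_cases hρ : v = ρ
    · rw [hρ, S.low_root, zero_mul]
    · exact (S.second v hv h hρ).2.2.1
  · rw [S.low_eq v hv h, ih, Nat.zero_min]

/-- An accepting search forest gives a decomposition for `p = q`; the first summand comes from
`g v - rise v`. -/
theorem strongUcat_le_two (S : IsSearchForest G g 0 ρ m M par rank rise low total) (hm : m ∈ M)
    (A : IsAccepting G g m M par rise low total) {f : V → ℝ≥0} {q : ℕ} (hq : q ≠ 0) {D : ℝ}
    (hD : 0 < D) (hg : ∀ v, (g v : ℝ) = D * (f v : ℝ) ^ q) :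
    strongUcat q (edgeLinear G f) ≤ 2 := by
  have hpair := S.isForestPair hm A hq hD hg (fun v => g v - rise v) (fun v => Nat.sub_le _ _)
    (fun a b hab h => by
      rcases Nat.eq_zero_or_pos (g a) with h0 | h0
      · simp [h0]
      · rcases A.edge a b h0 (h0.trans_le h) hab with h' | h'
        · have := S.rise_eq a (A.mem a h0) (h' ▸ hab.ne')
          rw [h'] at this
          omega
        · have := S.rise_eq b (A.mem b (h0.trans_le h)) (h' ▸ hab.ne)
          rw [h'] at this
          omega)
    (fun v hv hρ => by
      have hvM := A.mem v (by omega)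
      by_cases h : par v = v
      · have := (S.second v hvM h hρ).2.1
        omega
      · have := S.rise_eq v hvM h
        exact ⟨h, by omega⟩)
  refine hpair.strongUcat_le_two hq fun v => ?_
  rw [← add_div, ← Nat.cast_add, div_eq_iff hD.ne', mul_comm, ← hg, laterPart, S.low_eq_zero m hm]
  congr 1
  omega

/-- An accepting search forest gives a decomposition for `p = ∞`; the first summand comes from the
minimum of `g` on the path from the root. -/
theorem strongUcat_top_le_two (S : IsSearchForest G g 1 ρ m M par rank rise low total)
    (hm : m ∈ M) (A : IsAccepting G g m M par rise low total) {f : V → ℝ≥0} {D : ℝ}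
    (hD : 0 < D) (hg : ∀ v, (g v : ℝ) = D * f v) :
    strongUcat ⊤ (edgeLinear G f) ≤ 2 := by
  have hlow : ∀ v ∈ M, low v ≤ g v := fun v hv => S.low_le v hv le_rfl
  have hadd : ∀ v ∈ M, g v ≤ low v + rise v := by
    refine S.induction (fun v hv h => ?_) fun v hv h ih => ?_
    · by_cases hρ : v = ρ
      · rw [hρ, S.low_root, one_mul]; omega
      · have := (S.second v hv h hρ).2.1
        omega
    · have := S.rise_eq v hv h
      have := S.low_eq v hv h
      omega
  have hzero : ∀ v ∈ M, rise v = 0 → low v = g v := by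
    refine S.induction (fun v hv h h0 => ?_) fun v hv h ih h0 => ?_
    · by_cases hρ : v = ρ
      · rw [hρ, S.low_root, one_mul]
      · have := (S.second v hv h hρ).2.1
        have := S.pos v hv
        omega
    · have := S.rise_eq v hv h
      have := S.low_eq v hv h
      have := ih (by omega)
      omega
  -- Once the path has risen, it has seen its minimum.
  have hpath : ∀ k, 0 < rise (par^[k] m) → low (par^[k] m) ≤ low m := by
    intro k
    induction k with
    | zero => exact fun _ => le_rfl
    | succ k ih =>
      have h1 := S.low_add_rise_le hm A k
      have hu := S.iterate_mem k m hm
      rw [Function.iterate_succ_apply']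
      set u := par^[k] m
      by_cases hr : par u = u
      · rwa [hr]
      · have := S.rise_eq u hu hr
        have := S.low_eq u hu hr
        omega
  have hrise : ∀ v ∈ M, 0 < rise v → low v ≤ low m := by
    refine S.induction (fun v hv h h0 => ?_) fun v hv h ih h0 => ?_
    · by_cases hρ : v = ρ
      · rw [hρ, S.rise_root] at h0
        omega
      · have := (S.second v hv h hρ).2.2.1
        omega
    · by_cases hP : ∃ k, par^[k] m = v
      · obtain ⟨k, rfl⟩ := hP
        exact hpath k h0
      · push Not at hP
        rcases S.le_of_off hm A hv hP with rfl | ⟨-, h2⟩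
        · exact absurd S.par_root h
        · have := S.rise_eq v hv h
          have := S.low_eq v hv h
          have := ih (by omega)
          omega
  have hpair := S.isForestPair (q := 1) hm A one_ne_zero hD (by simpa using hg)
    (fun v => min (low v) (g v)) (fun v => min_le_right _ _)
    (fun a b hab h => by
      rcases Nat.eq_zero_or_pos (g a) with h0 | h0
      · simp [h0]
      · have := hlow a (A.mem a h0)
        rcases A.edge a b h0 (h0.trans_le h) hab with h' | h'
        · have := S.low_eq a (A.mem a h0) (h' ▸ hab.ne')
          rw [h'] at this
          omega
        · have := S.low_eq b (A.mem b (h0.trans_le h)) (h' ▸ hab.ne)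
          rw [h'] at this
          omega)
    (fun v hv hρ => by
      have hvM := A.mem v (by omega)
      by_cases h : par v = v
      · have := (S.second v hvM h hρ).2.2.1
        omega
      · have := S.low_eq v hvM h
        have := hlow _ (S.par_mem v hvM)
        exact ⟨h, by omega⟩)
  have hfD : ∀ v, (f v : ℝ) = (g v : ℝ) / D := fun v => by
    rw [hg, mul_div_cancel_left₀ _ hD.ne']
  have e₁ : ∀ v, g v ≤ low v → ((min (low v) (g v) : ℕ) : ℝ) / D = f v := fun v h => by
    rw [hfD, min_eq_right h]
  have e₂ : ∀ v, g v ≤ rise v + low m → (laterPart g rise low m v : ℝ) / D = f v := fun v h => by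
    rw [hfD, laterPart, min_eq_left h]
  have hvert : ∀ v, g v ≤ low v ∨ g v ≤ rise v + low m := by
    intro v
    rcases Nat.eq_zero_or_pos (g v) with h0 | h0
    · left; omega
    · have hv := A.mem v h0
      have := hadd v hv
      have := hzero v hv
      have := hrise v hv
      omega
  have hedge : ∀ v ∈ M, par v ≠ v → (g v ≤ low v ∧ g (par v) ≤ low (par v)) ∨
      (g v ≤ rise v + low m ∧ g (par v) ≤ rise (par v) + low m) := by
    intro v hv h
    have hp := S.par_mem v hv
    have := hadd v hv
    have := hzero v hv
    have := hrise v hv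
    have := hadd _ hp
    have := hzero _ hp
    have := hrise _ hp
    have := S.rise_eq v hv h
    have := S.low_eq v hv h
    omega
  refine hpair.strongUcat_top_le_two (fun v => ?_) (fun v => ?_) (fun v => ?_) fun a b hab => ?_
  · rw [hfD, div_le_div_iff_of_pos_right hD, Nat.cast_le]; exact min_le_right _ _
  · rw [hfD, div_le_div_iff_of_pos_right hD, Nat.cast_le]; exact min_le_left _ _
  · exact (hvert v).imp (e₁ v) (e₂ v)
  · have : (g a ≤ low a ∧ g b ≤ low b) ∨ (g a ≤ rise a + low m ∧ g b ≤ rise b + low m) := by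
      rcases Nat.eq_zero_or_pos (g a) with ha | ha
      · have := hvert b
        omega
      rcases Nat.eq_zero_or_pos (g b) with hb | hb
      · have := hvert a
        omega
      rcases A.edge a b ha hb hab with h' | h'
      · have := hedge a (A.mem a ha) (h' ▸ hab.ne')
        rwa [h'] at this
      · have := hedge b (A.mem b hb) (h' ▸ hab.ne)
        rw [h'] at this
        exact this.imp And.symm And.symm
    exact this.imp (fun h => ⟨e₁ a h.1, e₁ b h.2⟩) (fun h => ⟨e₂ a h.1, e₂ b h.2⟩)

end IsSearchForest

end SearchForest

/-! ### From decompositions to search forests -/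

/-- The properties of the two functions of a strong unimodal decomposition of `f` that matter on
the realization of a graph. -/
structure IsStrongPair {X : Type} [TopologicalSpace X] (F₁ F₂ f : X → ℝ≥0) : Prop where
  cont₁ : Continuous F₁
  cont₂ : Continuous F₂
  level₁ : ∀ c, 0 < c → IsPreconnected {x | c ≤ F₁ x}
  level₂ : ∀ c, 0 < c → IsPreconnected {x | c ≤ F₂ x}
  supp₁ : ContractibleOrEmpty {x | 0 < F₁ x}
  supp₂ : ContractibleOrEmpty {x | 0 < F₂ x}
  supp_inter : IsPreconnected ({x | 0 < F₁ x} ∩ {x | 0 < F₂ x})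
  le₁ : ∀ x, F₁ x ≤ f x
  le₂ : ∀ x, F₂ x ≤ f x
  pos : ∀ x, 0 < f x → 0 < F₁ x ∨ 0 < F₂ x

/-- Fewer than two functions can be complemented by zero functions. -/
theorem exists_pair_of_strongUcat_le_two {X : Type} [TopologicalSpace X] {p : ℕ∞} (hp : 1 ≤ p)
    {f : X → ℝ≥0} (h : strongUcat p f ≤ 2) :
    ∃ F₁ F₂ : X → ℝ≥0, IsStrongPair F₁ F₂ f ∧ DecomposesTo p ![F₁, F₂] f := by
  obtain ⟨F, hF⟩ : ∃ F : Fin 2 → X → ℝ≥0, IsStrongDecomposition p F f := by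
    have h3 : strongUcat p f < 3 := lt_of_le_of_lt h (by norm_num)
    obtain ⟨_, ⟨k, rfl, F, hu, hd, hs⟩, hk⟩ := sInf_lt_iff.1 h3
    have hk : k < 3 := by exact_mod_cast hk
    have hk2 : k ≤ 2 := by omega
    have hzero : IsUnimodal fun _ : X => (0 : ℝ≥0) := by
      refine ⟨continuous_const, fun c hc => Or.inl ?_⟩
      ext x
      simp [hc.ne']
    let F' : Fin 2 → X → ℝ≥0 := fun i => if h : i.1 < k then F ⟨i.1, h⟩ else fun _ => 0
    have hF' : ∀ i : Fin k, F' (Fin.castLE hk2 i) = F i := fun i => by simp [F']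
    have hF0 : ∀ i : Fin 2, ¬ i.1 < k → F' i = fun _ => 0 := fun i hi => by simp [F', hi]
    refine ⟨F', fun i => ?_, ?_, fun J hJ c => ?_⟩
    · by_cases hi : i.1 < k
      · simpa [F', hi] using hu ⟨i.1, hi⟩
      · rw [hF0 i hi]; exact hzero
    · cases p with
      | top =>
        intro x
        rw [← show _ = f x from hd x]
        apply le_antisymm
        · refine Finset.sup_le fun i _ => ?_
          by_cases hi : i.1 < k
          · have := Finset.le_sup (f := fun i => F i x) (Finset.mem_univ ⟨i.1, hi⟩)
            simpa [F', hi] using this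
          · simp [hF0 i hi]
        · refine Finset.sup_le fun i _ => ?_
          rw [← hF' i]
          exact Finset.le_sup (f := fun i => F' i x) (Finset.mem_univ _)
      | coe q =>
        intro x
        have hq : q ≠ 0 := by
          rintro rfl
          simp at hp
        rw [← show _ = f x ^ q from hd x]
        symm
        have : ∑ i, F i x ^ q = ∑ i : Fin k, F' (Fin.castLE hk2 i) x ^ q := by simp [hF']
        rw [this]
        refine Finset.sum_of_injOn (Fin.castLE hk2) (Fin.castLE_injective hk2).injOn (by simp)
          (fun i _ hi => ?_) (fun _ _ => rfl)
        rw [hF0 i, zero_pow hq]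
        intro hik
        exact hi ⟨⟨i.1, hik⟩, by simp, rfl⟩
    · by_cases hJk : ∀ i ∈ J, i.1 < k
      · have := hs (Finset.univ.filter fun i => Fin.castLE hk2 i ∈ J)
          (by
            obtain ⟨j, hj⟩ := hJ
            exact ⟨⟨j.1, hJk j hj⟩, by simpa using hj⟩) (fun i => c (Fin.castLE hk2 i))
        convert this using 1
        ext x
        simp only [Set.mem_ofPred_eq, Finset.mem_filter, Finset.mem_univ, true_and]
        constructor
        · intro h i hi
          rw [← hF' i]; exact h _ hi
        · intro h i hi
          have := h ⟨i.1, hJk i hi⟩ hi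
          rwa [← hF'] at this
      · push Not at hJk
        obtain ⟨i, hiJ, hi⟩ := hJk
        left
        ext x
        simp only [Set.mem_ofPred_eq, Set.mem_empty_iff_false, iff_false]
        intro h
        have := h i hiJ
        rw [hF0 i (by omega)] at this
        exact not_lt_bot this
  obtain ⟨hu, hd, hs⟩ := hF
  have hF : F = ![F 0, F 1] := by ext i x; fin_cases i <;> rfl
  refine ⟨F 0, F 1, ?_, hF ▸ hd⟩
  have hle : (∀ x, F 0 x ≤ f x) ∧ (∀ x, F 1 x ≤ f x) ∧
      ∀ x, 0 < f x → 0 < F 0 x ∨ 0 < F 1 x := by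
    cases p with
    | top =>
      have hd : ∀ x, max (F 0 x) (F 1 x) = f x := fun x => by
        rw [← show _ = f x from hd x, show (Finset.univ : Finset (Fin 2)) = {0, 1} from rfl,
          Finset.sup_insert, Finset.sup_singleton]
      refine ⟨fun x => hd x ▸ le_max_left _ _, fun x => hd x ▸ le_max_right _ _, fun x hx => ?_⟩
      rw [← hd x] at hx
      exact lt_max_iff.1 hx
    | coe q =>
      have hq : q ≠ 0 := by
        rintro rfl
        simp at hp
      have hd : ∀ x, F 0 x ^ q + F 1 x ^ q = f x ^ q := fun x => by
        rw [← show _ = f x ^ q from hd x, Fin.sum_univ_two]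
      refine ⟨fun x => ?_, fun x => ?_, fun x hx => ?_⟩
      · rw [← pow_le_pow_iff_left₀ zero_le zero_le hq, ← hd]; exact le_self_add
      · rw [← pow_le_pow_iff_left₀ zero_le zero_le hq, ← hd]; exact le_add_self
      · by_contra! h
        have := hd x
        rw [nonpos_iff_eq_zero.1 h.1, nonpos_iff_eq_zero.1 h.2] at this
        rw [zero_pow hq, zero_add] at this
        have h0 : f x = 0 := pow_eq_zero_iff hq |>.1 this.symm
        exact hx.ne' h0
  exact
    { cont₁ := (hu 0).1
      cont₂ := (hu 1).1
      level₁ := fun c hc => ((hu 0).2 c hc).isPreconnected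
      level₂ := fun c hc => ((hu 1).2 c hc).isPreconnected
      supp₁ := by simpa using hs {0} (by simp) 0
      supp₂ := by simpa using hs {1} (by simp) 0
      supp_inter := by
        convert (hs {0, 1} (by simp) 0).isPreconnected using 1
        ext x; simp
      le₁ := hle.1
      le₂ := hle.2.1
      pos := hle.2.2 }

section Necessity

variable {V : Type} [Fintype V] [DecidableEq V] {G : SimpleGraph V}

/-- The path in the realization along an edge. -/
noncomputable def edgePath {a b : V} (hab : G.Adj a b) (t : unitInterval) : realization G :=
  ⟨edgePoint a b t, edgePoint_mem hab t.2.1 t.2.2⟩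

theorem continuous_edgePath {a b : V} (hab : G.Adj a b) : Continuous (edgePath hab) := by
  refine Continuous.subtype_mk ?_ _
  unfold edgePoint
  fun_prop

theorem edgePath_zero {a b : V} (hab : G.Adj a b) : edgePath hab 0 = vtx G a :=
  Subtype.ext (by simp [edgePath, edgePoint_zero, vtx])

theorem edgePath_one {a b : V} (hab : G.Adj a b) : edgePath hab 1 = vtx G b :=
  Subtype.ext (by simp [edgePath, edgePoint_one, vtx])

theorem edgeLinear_edgePath_pos {f : V → ℝ≥0} {a b : V} (hab : G.Adj a b) (ha : 0 < f a)
    (hb : 0 < f b) (t : unitInterval) : 0 < edgeLinear G f (edgePath hab t) := by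
  rw [← NNReal.coe_pos, edgePath, edgeLinear_edgePoint]
  have ha : (0 : ℝ) < f a := ha
  have hb : (0 : ℝ) < f b := hb
  have h0 := t.2.1
  have h1 := t.2.2
  rcases h0.eq_or_lt with h | h
  · rw [← h]; simpa using ha
  · have : 0 < (t : ℝ) * f b := mul_pos h hb
    nlinarith

/-- A map from the realization to the plane without zeros. It takes the edge from `u` to `v` to the
right of the origin, and all other edges to the other parts of the plane, so that it takes a cycle
through this edge to a curve around the origin. -/
noncomputable def windingMap (u v : V) (x : realization G) : ℂ :=
  ⟨x.1 u + x.1 v - 1 / 2, x.1 u - x.1 v⟩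

theorem continuous_windingMap (u v : V) : Continuous (windingMap (G := G) u v) := by
  have h : windingMap (G := G) u v = fun x : realization G =>
      (((x.1 u + x.1 v - 1 / 2 : ℝ) : ℂ) + ((x.1 u - x.1 v : ℝ) : ℂ) * Complex.I) := by
    ext x
    apply Complex.ext <;> simp [windingMap]
  rw [h]
  have c : ∀ w, Continuous fun x : realization G => x.1 w := fun w =>
    (continuous_apply w).comp continuous_subtype_val
  have cu := c u
  have cv := c v
  exact (Complex.continuous_ofReal.comp ((cu.add cv).sub continuous_const)).add
    ((Complex.continuous_ofReal.comp (cu.sub cv)).mul continuous_const)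

theorem windingMap_mem_slitPlane {u v : V} (huv : G.Adj u v) (t : unitInterval) :
    windingMap u v (edgePath huv t) ∈ Complex.slitPlane := by
  left
  simp [windingMap, edgePath, edgePoint_apply, huv.ne, huv.ne']
  norm_num

theorem neg_windingMap_mem_slitPlane {u v : V} {x : realization G}
    (h : x.1 u = 0 ∨ x.1 v = 0) : -windingMap u v x ∈ Complex.slitPlane := by
  rw [Complex.mem_slitPlane_iff]
  simp only [windingMap, Complex.neg_re, Complex.neg_im]
  rcases h with h | h <;> rw [h]
  · by_cases hv : x.1 v = 0
    · left; rw [hv]; norm_num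
    · right; simpa using hv
  · by_cases hu : x.1 u = 0
    · left; rw [hu]; norm_num
    · right; simpa using hu

theorem windingMap_ne_zero {u v : V} (huv : u ≠ v) (x : realization G) :
    windingMap u v x ≠ 0 := by
  by_cases h : x.1 u = 0 ∨ x.1 v = 0
  · intro h0
    have := neg_windingMap_mem_slitPlane h
    rw [h0, neg_zero] at this
    exact Complex.zero_notMem_slitPlane this
  · push Not at h
    have hu := (realization_nonneg x.2 u).lt_of_ne h.1.symm
    have hv := (realization_nonneg x.2 v).lt_of_ne h.2.symm
    have hadj := realization_adj x.2 hu hv huv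
    have hsum : x.1 u + x.1 v = 1 := by
      rcases realization_cases x.2 with ⟨w, hw⟩ | ⟨a, b, t, hab, -, -, hw⟩
      · rw [hw] at hu hv
        have e : ∀ y, 0 < (vertexPoint w : V → ℝ) y → y = w := fun y hy => by
          by_contra h'
          simp [vertexPoint, h'] at hy
        exact absurd ((e u hu).trans (e v hv).symm) huv
      · rw [hw, edgePoint_apply] at hu hv
        rw [hw, edgePoint_apply, edgePoint_apply]
        have := hab.ne
        split_ifs at * <;> simp_all
    intro h0
    have := congrArg Complex.re h0
    simp only [windingMap, Complex.zero_re, hsum] at this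
    norm_num at this

variable {f : V → ℝ≥0} {F₁ F₂ : realization G → ℝ≥0}

/-- A locally constant function on the subgraph where `f` is positive, without the edge from `u` to
`v`, that takes different values at `u` and `v`: hence this edge lies on no cycle. It is the
difference of two logarithms of `windingMap`, one on the set where `f` is positive, and one with a
branch cut that is met only by the edge from `u` to `v`. -/
theorem IsStrongPair.exists_winding (P : IsStrongPair F₁ F₂ (edgeLinear G f)) {u v : V}
    (huv : G.Adj u v) (hu : 0 < f u) (hv : 0 < f v) :
    ∃ c : V → ℂ, (∀ a b, G.Adj a b → 0 < f a → 0 < f b → ¬ (a = u ∧ b = v) → ¬ (a = v ∧ b = u) →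
      c a = c b) ∧ c u ≠ c v := by
  set Z := windingMap (G := G) u v
  have hZ := continuous_windingMap (G := G) u v
  have hZ0 : ∀ x, Z x ≠ 0 := windingMap_ne_zero huv.ne
  obtain ⟨L, hL, hLZ⟩ := exists_log_on_union (isOpen_lt continuous_const P.cont₁)
    (isOpen_lt continuous_const P.cont₂) P.supp₁ P.supp₂ P.supp_inter Z hZ hZ0
  have hsub : ∀ {a b : V} (hab : G.Adj a b), 0 < f a → 0 < f b →
      Set.range (edgePath hab) ⊆ {x | 0 < F₁ x} ∪ {x | 0 < F₂ x} := by
    rintro a b hab ha hb _ ⟨t, rfl⟩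
    exact P.pos _ (edgeLinear_edgePath_pos hab ha hb t)
  have hpre : ∀ {a b : V} (hab : G.Adj a b), IsPreconnected (Set.range (edgePath hab)) :=
    fun hab => isPreconnected_range (continuous_edgePath hab)
  have mem0 : ∀ {a b : V} (hab : G.Adj a b), vtx G a ∈ Set.range (edgePath hab) := fun hab =>
    ⟨0, edgePath_zero hab⟩
  have mem1 : ∀ {a b : V} (hab : G.Adj a b), vtx G b ∈ Set.range (edgePath hab) := fun hab =>
    ⟨1, edgePath_one hab⟩
  refine ⟨fun w => L (vtx G w) - (Complex.log (-Z (vtx G w)) + Real.pi * Complex.I),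
    fun a b hab ha hb h1 h2 => ?_, fun h => ?_⟩
  · have hslit : ∀ x ∈ Set.range (edgePath hab), -Z x ∈ Complex.slitPlane := by
      rintro _ ⟨t, rfl⟩
      apply neg_windingMap_mem_slitPlane
      have := huv.ne
      simp only [edgePath, edgePoint_apply]
      by_contra! h
      by_cases e1 : u = a
      · subst e1
        have e2 : v ≠ b := fun e => h1 ⟨rfl, e.symm⟩
        simp [this.symm, e2] at h
      · by_cases e3 : u = b
        · subst e3
          have e2 : v ≠ a := fun e => h2 ⟨e.symm, rfl⟩
          simp [this.symm, e2] at h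
        · simp [e1, e3] at h
    refine eq_of_exp_eq_on_preconnected (hpre hab) (hL.mono (hsub hab ha hb))
      (L' := fun x => Complex.log (-Z x) + Real.pi * Complex.I)
      ((hZ.neg.continuousOn.clog hslit).add continuousOn_const) (fun x hx => ?_)
      (mem0 hab) (mem1 hab)
    rw [hLZ x (hsub hab ha hb hx), Complex.exp_add, Complex.exp_log (neg_ne_zero.2 (hZ0 x)),
      Complex.exp_pi_mul_I]
    ring
  · have h' := eq_of_exp_eq_on_preconnected (hpre huv) (hL.mono (hsub huv hu hv))
      (L' := fun x => Complex.log (Z x)) (hZ.continuousOn.clog (by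
        rintro _ ⟨t, rfl⟩; exact windingMap_mem_slitPlane huv t)) (fun x hx => by
        rw [hLZ x (hsub huv hu hv hx), Complex.exp_log (hZ0 x)]) (mem0 huv) (mem1 huv)
    have h2 : Complex.log (Z (vtx G u)) - Complex.log (-Z (vtx G u)) =
        Complex.log (Z (vtx G v)) - Complex.log (-Z (vtx G v)) := by
      linear_combination h - h'
    have him := congrArg Complex.im h2
    have iu : 0 < (Z (vtx G u)).im := by
      simp [Z, windingMap, vtx_apply, huv.ne']
    have iv : (Z (vtx G v)).im < 0 := by
      simp [Z, windingMap, vtx_apply, huv.ne]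
    simp only [Complex.sub_im, Complex.log_im, Complex.arg_neg_eq_arg_sub_pi_of_im_pos iu,
      Complex.arg_neg_eq_arg_add_pi_of_im_neg iv] at him
    linarith [Real.pi_pos]

section

variable {g : V → ℕ} {ε : ℕ} {ρ m : V} {M : Finset V} {par : V → V}
  {rank rise low : V → ℕ} {total : ℕ}

/-- The edges outside of a search forest would close cycles. -/
theorem IsSearchForest.edge_of_strongPair
    (S : IsSearchForest G g ε ρ m M par rank rise low total)
    (P : IsStrongPair F₁ F₂ (edgeLinear G f)) (hpos : ∀ v, 0 < f v ↔ 0 < g v)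
    (hM : ∀ v, 0 < g v → v ∈ M) {u v : V} (hu : 0 < g u) (hv : 0 < g v) (huv : G.Adj u v) :
    par u = v ∨ par v = u := by
  by_contra! hne
  obtain ⟨c, hc, hcuv⟩ := P.exists_winding huv ((hpos u).2 hu) ((hpos v).2 hv)
  have step : ∀ w ∈ M, par w ≠ w → c w = c (par w) := by
    intro w hw h
    refine hc _ _ (S.adj w hw h) ((hpos _).2 (S.pos w hw))
      ((hpos _).2 (S.pos _ (S.par_mem w hw))) ?_ ?_
    · rintro ⟨rfl, h'⟩; exact hne.1 h'
    · rintro ⟨rfl, h'⟩; exact hne.2 h'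
  by_cases hsec : ∃ r ∈ M, par r = r ∧ r ≠ ρ
  · obtain ⟨r, hr, h1, h2⟩ := hsec
    obtain ⟨-, -, -, C, hρC, hmC, hC⟩ := S.second r hr h1 h2
    have key : ∀ w ∈ M, (w ∈ C ∧ c w = c ρ) ∨ (w ∉ C ∧ c w = c m) := by
      refine S.induction (fun w hw h => ?_) fun w hw h ih => ?_
      · by_cases hwρ : w = ρ
        · exact Or.inl ⟨hwρ ▸ hρC, by rw [hwρ]⟩
        · have := (S.second w hw h hwρ).1
          exact Or.inr ⟨this ▸ hmC, by rw [this]⟩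
      · have e := step w hw h
        have g1 := S.pos w hw
        have g2 := S.pos _ (S.par_mem w hw)
        have hadj := S.adj w hw h
        rcases ih with ⟨i1, i2⟩ | ⟨i1, i2⟩
        · exact Or.inl ⟨hC _ i1 _ hadj.symm g2 g1, e.trans i2⟩
        · exact Or.inr ⟨fun h' => i1 (hC _ h' _ hadj g1 g2), e.trans i2⟩
    rcases key u (hM u hu) with ⟨h1, h2⟩ | ⟨h1, h2⟩ <;>
      rcases key v (hM v hv) with ⟨h3, h4⟩ | ⟨h3, h4⟩
    · exact hcuv (h2.trans h4.symm)
    · exact h3 (hC _ h1 _ huv hu hv)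
    · exact h1 (hC _ h3 _ huv.symm hv hu)
    · exact hcuv (h2.trans h4.symm)
  · push Not at hsec
    have key : ∀ w ∈ M, c w = c ρ := by
      refine S.induction (fun w hw h => ?_) fun w hw h ih => (step w hw h).trans ih
      rw [hsec w hw h]
    exact hcuv ((key u (hM u hu)).trans (key v (hM v hv)).symm)

/-- A unimodal function on the realization increases from child to parent in a forest if it has
its maximum at a vertex that is not a descendant of the child. -/
theorem le_par_of_level {F : realization G → ℝ≥0} (hF : ∀ c, 0 < c → IsPreconnected {x | c ≤ F x})
    (hFf : ∀ x, F x ≤ edgeLinear G f x)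
    (hedge : ∀ u v, 0 < f u → 0 < f v → G.Adj u v → par u = v ∨ par v = u) {v r : V}
    (hr : F (vtx G v) ≤ F (vtx G r)) (hrv : ∀ k, par^[k] r ≠ v) :
    F (vtx G v) ≤ F (vtx G (par v)) := by
  by_contra! hlt
  have hv0 : 0 < F (vtx G v) := lt_of_le_of_lt zero_le hlt
  have hmem := mem_of_isPreconnected (hF _ hv0) {w | ∃ k, par^[k] w = v} (u := v) (v := r) ?_
    ⟨0, rfl⟩ (le_refl (F (vtx G v))) hr
  · obtain ⟨k, hk⟩ := hmem
    exact hrv k hk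
  · rintro a ⟨k, hk⟩ b hb hab (haS : F (vtx G v) ≤ _) (hbS : F (vtx G v) ≤ _)
    have ha0 : 0 < f a := by
      rw [← edgeLinear_vtx (G := G) f a]; exact (hv0.trans_le haS).trans_le (hFf _)
    have hb0 : 0 < f b := by
      rw [← edgeLinear_vtx (G := G) f b]; exact (hv0.trans_le hbS).trans_le (hFf _)
    rcases hedge a b ha0 hb0 hab with h | h
    · cases k with
      | zero =>
        have : b = par v := by rw [← h, show a = v from hk]
        exact absurd (this ▸ hbS) (not_le.2 hlt)
      | succ k => exact hb ⟨k, by rw [← h]; exact hk⟩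
    · exact hb ⟨k + 1, by rw [Function.iterate_succ_apply, h, hk]⟩

/-- A unimodal function on the realization increases from parent to child in a forest if it has
its maximum at a descendant of the child. -/
theorem par_le_of_level {F : realization G → ℝ≥0} (hF : ∀ c, 0 < c → IsPreconnected {x | c ≤ F x})
    (hFf : ∀ x, F x ≤ edgeLinear G f x)
    (hedge : ∀ u v, 0 < f u → 0 < f v → G.Adj u v → par u = v ∨ par v = u) {v r : V}
    (hr : F (vtx G (par v)) ≤ F (vtx G r)) (hrv : ∃ k, par^[k] r = v)
    (hv : ∀ k, par^[k] (par v) ≠ v) :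
    F (vtx G (par v)) ≤ F (vtx G v) := by
  by_contra! hlt
  have hv0 : 0 < F (vtx G (par v)) := lt_of_le_of_lt zero_le hlt
  have hmem := mem_of_isPreconnected (hF _ hv0) {w | ∃ k, par^[k] w = v} (u := r) (v := par v) ?_
    hrv hr (le_refl (F (vtx G (par v))))
  · obtain ⟨k, hk⟩ := hmem
    exact hv k hk
  · rintro a ⟨k, hk⟩ b hb hab (haS : F (vtx G (par v)) ≤ _) (hbS : F (vtx G (par v)) ≤ _)
    have ha0 : 0 < f a := by
      rw [← edgeLinear_vtx (G := G) f a]; exact (hv0.trans_le haS).trans_le (hFf _)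
    have hb0 : 0 < f b := by
      rw [← edgeLinear_vtx (G := G) f b]; exact (hv0.trans_le hbS).trans_le (hFf _)
    rcases hedge a b ha0 hb0 hab with h | h
    · cases k with
      | zero =>
        rw [show a = v from hk] at haS
        exact absurd haS (not_le.2 hlt)
      | succ k => exact hb ⟨k, by rw [← h]; exact hk⟩
    · exact hb ⟨k + 1, by rw [Function.iterate_succ_apply, h, hk]⟩

/-- What a decomposition with maxima at `ρ` and `m` says about the search forest. -/
structure IsForestCompatible (G : SimpleGraph V) (g : V → ℕ) (ρ m : V) (M : Finset V)
    (par : V → V) (F₁ F₂ : realization G → ℝ≥0) : Prop where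
  mem : ∀ v, 0 < g v → v ∈ M
  edge : ∀ u v, 0 < g u → 0 < g v → G.Adj u v → par u = v ∨ par v = u
  le_par₁ : ∀ v ∈ M, par v ≠ v → F₁ (vtx G v) ≤ F₁ (vtx G (par v))
  le_par₂ : ∀ v ∈ M, par v ≠ v → v ∉ ancestors par m → F₂ (vtx G v) ≤ F₂ (vtx G (par v))
  par_le₂ : ∀ v ∈ M, par v ≠ v → v ∈ ancestors par m → F₂ (vtx G (par v)) ≤ F₂ (vtx G v)
  second : par m = m → m ≠ ρ → F₁ (vtx G m) = 0

theorem IsSearchForest.isForestCompatible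
    (S : IsSearchForest G g ε ρ m M par rank rise low total) (hm : m ∈ M)
    (hcl : ∀ u ∈ M, ∀ w, G.Adj u w → 0 < g w → w ∈ M)
    (P : IsStrongPair F₁ F₂ (edgeLinear G f)) (hpos : ∀ v, 0 < f v ↔ 0 < g v)
    (hρmax : ∀ v, F₁ (vtx G v) ≤ F₁ (vtx G ρ)) (hmmax : ∀ v, F₂ (vtx G v) ≤ F₂ (vtx G m)) :
    IsForestCompatible G g ρ m M par F₁ F₂ := by
  have hsupp : ∀ {F : realization G → ℝ≥0}, (∀ x, F x ≤ edgeLinear G f x) → ∀ {v},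
      0 < F (vtx G v) → 0 < g v := by
    intro F hF v hv
    rw [← hpos, ← edgeLinear_vtx (G := G) f v]
    exact hv.trans_le (hF _)
  have hmem : ∀ v, 0 < g v → v ∈ M := by
    intro v hv
    rcases P.pos (vtx G v) (by rwa [edgeLinear_vtx, hpos]) with h | h
    · exact mem_of_isPreconnected (P.level₁ _ h) (M : Set V)
        (fun a ha b hb hab _ hbS => hb (hcl a ha b hab (hsupp P.le₁ (h.trans_le hbS))))
        S.root_mem (hρmax v) (le_refl (F₁ (vtx G v)))
    · exact mem_of_isPreconnected (P.level₂ _ h) (M : Set V)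
        (fun a ha b hb hab _ hbS => hb (hcl a ha b hab (hsupp P.le₂ (h.trans_le hbS))))
        hm (hmmax v) (le_refl (F₂ (vtx G v)))
  have hedge : ∀ u v, 0 < g u → 0 < g v → G.Adj u v → par u = v ∨ par v = u :=
    fun u v hu hv huv => S.edge_of_strongPair P hpos hmem hu hv huv
  have hedge' : ∀ u v, 0 < f u → 0 < f v → G.Adj u v → par u = v ∨ par v = u :=
    fun u v hu hv huv => hedge u v ((hpos u).1 hu) ((hpos v).1 hv) huv
  refine ⟨hmem, hedge, fun v hv h => ?_, fun v hv h hoff => ?_, fun v hv h hon => ?_,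
    fun h1 h2 => ?_⟩
  · refine le_par_of_level P.level₁ P.le₁ hedge' (hρmax v) fun k hk => h ?_
    rw [Function.iterate_fixed S.par_root] at hk
    rw [← hk, S.par_root]
  · exact le_par_of_level P.level₂ P.le₂ hedge' (hmmax v) (by simpa [mem_ancestors] using hoff)
  · refine par_le_of_level P.level₂ P.le₂ hedge' (hmmax _) hon fun k hk => ?_
    have h1 := S.rank_iterate_le k (par v)
    have h2 := S.rank_lt v hv h
    rw [hk] at h1
    omega
  · obtain ⟨-, -, -, C, hρC, hmC, hC⟩ := S.second m hm h1 h2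
    by_contra h0
    have h0 : 0 < F₁ (vtx G m) := pos_of_ne_zero h0
    exact hmC (mem_of_isPreconnected (P.level₁ _ h0) C
      (fun a ha b hb hab haS hbS => hb (hC a ha b hab (hsupp P.le₁ (h0.trans_le haS))
        (hsupp P.le₁ (h0.trans_le hbS)))) hρC (hρmax m) (le_refl (F₁ (vtx G m))))

theorem IsForestCompatible.rise_eq_total (K : IsForestCompatible G g ρ m M par F₁ F₂)
    (S : IsSearchForest G g ε ρ m M par rank rise low total) (hm : m ∈ M)
    (hgle : ∀ u v, F₁ (vtx G u) ≤ F₁ (vtx G v) → F₂ (vtx G u) ≤ F₂ (vtx G v) → g u ≤ g v) :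
    rise m = total := by
  refine (S.rise_eq_total_iff hm).2 fun v hv hoff => ?_
  unfold increment
  split_ifs with h1 h2
  · rfl
  · exact absurd ⟨0, (S.second v hv h1 h2).1.symm⟩ hoff
  · exact Nat.sub_eq_zero_of_le (hgle _ _ (K.le_par₁ v hv h1) (K.le_par₂ v hv h1 hoff))

theorem mem_ancestors_par {v : V} (h : v ∈ ancestors par m) : par v ∈ ancestors par m := by
  obtain ⟨k, rfl⟩ := h
  exact ⟨k + 1, Function.iterate_succ_apply' par k m⟩

/-- On the path to `m`, the second summand is at least the rise. -/
theorem IsForestCompatible.isAccepting (K : IsForestCompatible G g ρ m M par F₁ F₂)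
    (S : IsSearchForest G g 0 ρ m M par rank rise low total) (hm : m ∈ M) {q : ℕ}
    {D : ℝ} (hD : 0 < D) (hg : ∀ v, (g v : ℝ) = D * (f v : ℝ) ^ q)
    (hsum : ∀ x, F₁ x ^ q + F₂ x ^ q = edgeLinear G f x ^ q) :
    IsAccepting G g m M par rise low total := by
  have hg' : ∀ v, (g v : ℝ) =
      D * (F₁ (vtx G v) : ℝ) ^ q + D * (F₂ (vtx G v) : ℝ) ^ q := by
    intro v
    have := hsum (vtx G v)
    rw [edgeLinear_vtx] at this
    rw [hg, ← mul_add]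
    congr 1
    exact_mod_cast this.symm
  have pw : ∀ {a b : ℝ≥0}, a ≤ b → D * (a : ℝ) ^ q ≤ D * (b : ℝ) ^ q := fun h =>
    mul_le_mul_of_nonneg_left (pow_le_pow_left₀ (NNReal.coe_nonneg _) (NNReal.coe_le_coe.2 h) q)
      hD.le
  have pp : ∀ a : ℝ≥0, 0 ≤ D * (a : ℝ) ^ q := fun a => mul_nonneg hD.le (pow_nonneg a.2 q)
  refine ⟨K.mem, K.edge, K.rise_eq_total S hm fun u v h1 h2 => ?_, ?_⟩
  · rw [← Nat.cast_le (α := ℝ), hg', hg']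
    exact add_le_add (pw h1) (pw h2)
  · have key : ∀ v ∈ M, v ∈ ancestors par m → (rise v : ℝ) ≤ D * (F₂ (vtx G v) : ℝ) ^ q := by
      refine S.induction (fun v hv h _ => ?_) fun v hv h ih hon => ?_
      · by_cases hρ : v = ρ
        · rw [hρ, S.rise_root, Nat.cast_zero]; exact pp _
        · obtain ⟨h1, h2, -⟩ := S.second v hv h hρ
          have h0 := K.second (h1 ▸ h) (h1 ▸ hρ)
          rw [h2, hg, h1]
          have := hsum (vtx G m)
          rw [h0, edgeLinear_vtx] at this
          by_cases hq : q = 0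
          · simp [hq]
          · rw [zero_pow hq, zero_add] at this
            rw [← NNReal.coe_pow, ← this, NNReal.coe_pow]
      · have ih := ih (mem_ancestors_par hon)
        have h1 := pw (K.le_par₁ v hv h)
        have h2 := pw (K.par_le₂ v hv h hon)
        rw [S.rise_eq v hv h]
        rcases le_total (g v) (g (par v)) with h3 | h3
        · rw [Nat.sub_eq_zero_of_le h3, add_zero]
          exact ih.trans h2
        · rw [Nat.cast_add, Nat.cast_sub h3, hg', hg']
          linarith
    rw [S.low_eq_zero m hm, add_zero, ← Nat.cast_le (α := ℝ), hg']
    linarith [key m hm ⟨0, rfl⟩, pp (F₁ (vtx G m))]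

/-- On the path to `m`, the second summand is larger than the first one once there has been a rise;
from there on the values do not decrease, so that `low` has reached its final value. -/
theorem IsForestCompatible.isAccepting_top (K : IsForestCompatible G g ρ m M par F₁ F₂)
    (S : IsSearchForest G g 1 ρ m M par rank rise low total) (hm : m ∈ M)
    (hpos : ∀ v, 0 < f v ↔ 0 < g v) (hg : ∀ u v, g u ≤ g v ↔ f u ≤ f v)
    (hmax : ∀ x, max (F₁ x) (F₂ x) = edgeLinear G f x) :
    IsAccepting G g m M par rise low total := by
  have hg' : ∀ u v, g u ≤ g v ↔
      max (F₁ (vtx G u)) (F₂ (vtx G u)) ≤ max (F₁ (vtx G v)) (F₂ (vtx G v)) := by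
    intro u v
    rw [hg, hmax, hmax, edgeLinear_vtx, edgeLinear_vtx]
  refine ⟨K.mem, K.edge, K.rise_eq_total S hm fun u v h1 h2 => ?_, ?_⟩
  · rw [hg']; exact max_le_max h1 h2
  · have key : ∀ v ∈ M, v ∈ ancestors par m → rise v + low v ≤ g v ∧
        (0 < rise v → F₁ (vtx G v) < F₂ (vtx G v)) := by
      refine S.induction (fun v hv h _ => ?_) fun v hv h ih hon => ?_
      · by_cases hρ : v = ρ
        · rw [hρ, S.rise_root, S.low_root]
          exact ⟨by omega, fun h => absurd h (lt_irrefl 0)⟩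
        · obtain ⟨h1, h2, h3, -⟩ := S.second v hv h hρ
          have h0 := K.second (h1 ▸ h) (h1 ▸ hρ)
          refine ⟨by omega, fun _ => ?_⟩
          rw [h1, h0]
          by_contra hn
          have hn : F₂ (vtx G m) = 0 := le_bot_iff.1 (not_lt.1 hn)
          have := hmax (vtx G m)
          rw [h0, hn, edgeLinear_vtx, max_self] at this
          exact ((hpos m).2 (h1 ▸ S.pos v hv)).ne this
      · have ih := ih (mem_ancestors_par hon)
        have h1 := K.le_par₁ v hv h
        have h2 := K.par_le₂ v hv h hon
        have e1 := S.rise_eq v hv h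
        have e2 := S.low_eq v hv h
        rcases le_or_gt (g v) (g (par v)) with h3 | h3
        · rcases Nat.eq_zero_or_pos (rise (par v)) with h0 | h0
          · exact ⟨by omega, fun h' => by omega⟩
          · have h4 := ih.2 h0
            have h5 : g (par v) ≤ g v := by
              rw [hg']
              exact max_le (h4.le.trans (h2.trans (le_max_right _ _)))
                (h2.trans (le_max_right _ _))
            exact ⟨by omega, fun _ => h1.trans_lt (h4.trans_le h2)⟩
        · refine ⟨by omega, fun _ => ?_⟩
          rw [← not_le, hg', not_le] at h3
          by_contra! h6
          rw [max_eq_left h6] at h3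
          exact absurd (h1.trans (le_max_left _ _)) (not_le.2 h3)
    exact (key m hm ⟨0, rfl⟩).1

/-- If the strong unimodal category is at most two, then some search forest is accepting. -/
theorem exists_isAccepting {p : ℕ∞} {q : ℕ} (hq : q ≠ 0)
    (hpq : (p = q ∧ ε = 0) ∨ (p = ⊤ ∧ q = 1 ∧ ε = 1)) {D : ℝ} (hD : 0 < D)
    (hg : ∀ v, (g v : ℝ) = D * (f v : ℝ) ^ q) (hne : ∃ v, 0 < g v)
    (h : strongUcat p (edgeLinear G f) ≤ 2) :
    ∃ ρ m, 0 < g ρ ∧ 0 < g m ∧ ∀ M par rank rise low total,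
      IsSearchForest G g ε ρ m M par rank rise low total → m ∈ M →
      (∀ u ∈ M, ∀ w, G.Adj u w → 0 < g w → w ∈ M) →
      IsAccepting G g m M par rise low total := by
  have hp : 1 ≤ p := by
    rcases hpq with ⟨rfl, -⟩ | ⟨rfl, -⟩
    · exact_mod_cast Nat.one_le_iff_ne_zero.2 hq
    · exact le_top
  obtain ⟨F₁, F₂, P, hdec⟩ := exists_pair_of_strongUcat_le_two hp h
  have hle : ∀ u v, g u ≤ g v ↔ f u ≤ f v := by
    intro u v
    rw [← Nat.cast_le (α := ℝ), hg, hg, mul_le_mul_iff_right₀ hD,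
      pow_le_pow_iff_left₀ (NNReal.coe_nonneg _) (NNReal.coe_nonneg _) hq, NNReal.coe_le_coe]
  have hpos : ∀ v, 0 < f v ↔ 0 < g v := by
    intro v
    rw [← Nat.cast_pos (α := ℝ), hg, mul_pos_iff_of_pos_left hD]
    refine ⟨fun h => pow_pos (NNReal.coe_pos.2 h) q, fun h => pos_of_ne_zero ?_⟩
    intro h0
    simp [h0, hq] at h
  have hex : ∀ F : realization G → ℝ≥0, (∀ x, F x ≤ edgeLinear G f x) →
      ∃ r, 0 < g r ∧ ∀ v, F (vtx G v) ≤ F (vtx G r) := by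
    intro F hF
    obtain ⟨r, hr, hmax⟩ := Finset.exists_max_image (Finset.univ.filter fun v => 0 < g v)
      (fun v => F (vtx G v)) (by obtain ⟨v, hv⟩ := hne; exact ⟨v, by simpa using hv⟩)
    refine ⟨r, by simpa using hr, fun v => ?_⟩
    by_cases hv : 0 < g v
    · exact hmax v (by simpa using hv)
    · have : F (vtx G v) = 0 := by
        rw [← hpos, ← edgeLinear_vtx (G := G) f v] at hv
        exact le_bot_iff.1 ((hF _).trans (not_lt.1 hv))
      rw [this]; exact zero_le
  obtain ⟨ρ, hρ, hρmax⟩ := hex F₁ P.le₁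
  obtain ⟨m, hm, hmmax⟩ := hex F₂ P.le₂
  refine ⟨ρ, m, hρ, hm, fun M par rank rise low total S hmM hcl => ?_⟩
  have K := S.isForestCompatible hmM hcl P hpos hρmax hmmax
  rcases hpq with ⟨rfl, rfl⟩ | ⟨rfl, rfl, rfl⟩
  · refine K.isAccepting S hmM hD hg fun x => ?_
    rw [← show _ = edgeLinear G f x ^ q from hdec x]
    simp
  · refine K.isAccepting_top S hmM hpos hle fun x => ?_
    rw [← show _ = edgeLinear G f x from hdec x,
      show (Finset.univ : Finset (Fin 2)) = {0, 1} from rfl]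
    simp

end

end Necessity

/-! ### The search -/

section Search

variable {V : Type} [DecidableEq V]

/-- The state of a search: the vertices found so far, with the data of `IsSearchForest`. -/
structure Search (V : Type) where
  M : Finset V
  par : V → V
  rank : V → ℕ
  rise : V → ℕ
  low : V → ℕ
  total : ℕ

namespace Search

/-- The start of a search at the root `ρ`. -/
def init (g : V → ℕ) (ε : ℕ) (ρ : V) : Search V where
  M := {ρ}
  par := id
  rank _ := 0
  rise _ := 0
  low _ := ε * g ρ
  total := 0

/-- The search finds the vertex `v` as a child of `u`. -/
def visit (g : V → ℕ) (u v : V) (S : Search V) : Search V where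
  M := insert v S.M
  par := Function.update S.par v u
  rank := Function.update S.rank v (S.rank u + 1)
  rise := Function.update S.rise v (S.rise u + (g v - g u))
  low := Function.update S.low v (min (S.low u) (g v))
  total := S.total + (g v - g u)

/-- The search starts anew at the root `m`. -/
def addRoot (g : V → ℕ) (m : V) (S : Search V) : Search V where
  M := insert m S.M
  par := S.par
  rank := S.rank
  rise := Function.update S.rise m (g m)
  low := Function.update S.low m 0
  total := S.total + g m

/-- A search forest, bundled as the state of a search. -/
abbrev IsForest (G : SimpleGraph V) (g : V → ℕ) (ε : ℕ) (ρ m : V) (S : Search V) : Prop :=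
  IsSearchForest G g ε ρ m S.M S.par S.rank S.rise S.low S.total

/-- The criterion `IsAccepting` for the state of a search. -/
abbrev Accepts (G : SimpleGraph V) (g : V → ℕ) (m : V) (S : Search V) : Prop :=
  IsAccepting G g m S.M S.par S.rise S.low S.total

/-- The search can find no more vertices. -/
def Closed (G : SimpleGraph V) (g : V → ℕ) (M : Finset V) : Prop :=
  ∀ u ∈ M, ∀ w, G.Adj u w → 0 < g w → w ∈ M

variable {G : SimpleGraph V} {g : V → ℕ} {ε : ℕ} {ρ m : V} {S : Search V}

theorem isForest_init (hρ : 0 < g ρ) : (init g ε ρ).IsForest G g ε ρ m where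
  pos v hv := Finset.mem_singleton.1 hv ▸ hρ
  root_mem := Finset.mem_singleton_self ρ
  par_root := rfl
  rise_root := rfl
  low_root := rfl
  par_of_notMem _ _ := rfl
  second v hv _ h := absurd (Finset.mem_singleton.1 hv) h
  par_mem v hv := hv
  adj v _ h := absurd rfl h
  rank_lt v _ h := absurd rfl h
  rise_eq v _ h := absurd rfl h
  low_eq v _ h := absurd rfl h
  total_eq := by simp [init, increment]

theorem IsForest.visit (hS : S.IsForest G g ε ρ m) {u v : V} (hu : u ∈ S.M) (hv : v ∉ S.M)
    (huv : G.Adj u v) (hg : 0 < g v) : (S.visit g u v).IsForest G g ε ρ m := by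
  have hne : ∀ w ∈ S.M, w ≠ v := fun w hw h => hv (h ▸ hw)
  have hsplit : ∀ w ∈ insert v S.M, w = v ∨ (w ∈ S.M ∧ w ≠ v) := fun w hw => by
    rcases Finset.mem_insert.1 hw with h | h
    · exact Or.inl h
    · exact Or.inr ⟨h, hne w h⟩
  have up : ∀ {α : Type} (φ : V → α) (x : α) {w}, w ≠ v → Function.update φ v x w = φ w :=
    fun φ x w hw => Function.update_of_ne hw x φ
  have us : ∀ {α : Type} (φ : V → α) (x : α), Function.update φ v x v = x :=
    fun φ x => Function.update_self v x φ
  have hρ := hne ρ hS.root_mem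
  have huv' := hne u hu
  refine
    { pos := fun w hw => ?_
      root_mem := Finset.mem_insert_of_mem hS.root_mem
      par_root := (up _ _ hρ).trans hS.par_root
      rise_root := (up _ _ hρ).trans hS.rise_root
      low_root := (up _ _ hρ).trans hS.low_root
      par_of_notMem := fun w hw => ?_
      second := fun w hw => ?_
      par_mem := fun w hw => ?_
      adj := fun w hw => ?_
      rank_lt := fun w hw => ?_
      rise_eq := fun w hw => ?_
      low_eq := fun w hw => ?_
      total_eq := ?_ }
  · rcases hsplit w hw with rfl | ⟨h, h'⟩
    exacts [hg, hS.pos w h]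
  · have h1 : w ≠ v := fun h => hw (h ▸ Finset.mem_insert_self _ _)
    exact (up _ _ h1).trans (hS.par_of_notMem w fun h => hw (Finset.mem_insert_of_mem h))
  · simp only [Search.visit]
    rcases hsplit w hw with rfl | ⟨h, h'⟩
    · rw [us]; exact fun h' => absurd h' huv'
    · rw [up _ _ h', up _ _ h', up _ _ h']; exact hS.second w h
  · simp only [Search.visit]
    rcases hsplit w hw with rfl | ⟨h, h'⟩
    · rw [us]; exact Finset.mem_insert_of_mem hu
    · rw [up _ _ h']; exact Finset.mem_insert_of_mem (hS.par_mem w h)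
  · simp only [Search.visit]
    rcases hsplit w hw with rfl | ⟨h, h'⟩
    · rw [us]; exact fun _ => huv.symm
    · rw [up _ _ h']; exact hS.adj w h
  · simp only [Search.visit]
    rcases hsplit w hw with rfl | ⟨h, h'⟩
    · rw [us, us, up _ _ huv']; exact fun _ => Nat.lt_succ_self _
    · rw [up _ _ h', up _ _ h', up _ _ (hne _ (hS.par_mem w h))]; exact hS.rank_lt w h
  · simp only [Search.visit]
    rcases hsplit w hw with rfl | ⟨h, h'⟩
    · rw [us, us, up _ _ huv']; exact fun _ => rfl
    · rw [up _ _ h', up _ _ h', up _ _ (hne _ (hS.par_mem w h))]; exact hS.rise_eq w h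
  · simp only [Search.visit]
    rcases hsplit w hw with rfl | ⟨h, h'⟩
    · rw [us, us, up _ _ huv']; exact fun _ => rfl
    · rw [up _ _ h', up _ _ h', up _ _ (hne _ (hS.par_mem w h))]; exact hS.low_eq w h
  · simp only [Search.visit]
    rw [Finset.sum_insert hv, hS.total_eq, add_comm]
    congr 1
    · rw [increment, us, if_neg huv']
    · refine Finset.sum_congr rfl fun w hw => ?_
      rw [increment, increment, up _ _ (hne w hw)]

theorem IsForest.addRoot (hS : S.IsForest G g ε ρ m) (hcl : Closed G g S.M) (hm : m ∉ S.M)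
    (hg : 0 < g m) : (S.addRoot g m).IsForest G g ε ρ m := by
  have hne : ∀ w ∈ S.M, w ≠ m := fun w hw h => hm (h ▸ hw)
  have hsplit : ∀ w ∈ insert m S.M, w = m ∨ (w ∈ S.M ∧ w ≠ m) := fun w hw => by
    rcases Finset.mem_insert.1 hw with h | h
    · exact Or.inl h
    · exact Or.inr ⟨h, hne w h⟩
  have up : ∀ {α : Type} (φ : V → α) (x : α) {w}, w ≠ m → Function.update φ m x w = φ w :=
    fun φ x w hw => Function.update_of_ne hw x φ
  have us : ∀ {α : Type} (φ : V → α) (x : α), Function.update φ m x m = x :=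
    fun φ x => Function.update_self m x φ
  have hρ := hne ρ hS.root_mem
  have hpm := hS.par_of_notMem m hm
  refine
    { pos := fun w hw => ?_
      root_mem := Finset.mem_insert_of_mem hS.root_mem
      par_root := hS.par_root
      rise_root := (up _ _ hρ).trans hS.rise_root
      low_root := (up _ _ hρ).trans hS.low_root
      par_of_notMem := fun w hw => hS.par_of_notMem w fun h => hw (Finset.mem_insert_of_mem h)
      second := fun w hw => ?_
      par_mem := fun w hw => ?_
      adj := fun w hw => ?_
      rank_lt := fun w hw => ?_
      rise_eq := fun w hw => ?_
      low_eq := fun w hw => ?_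
      total_eq := ?_ }
  · rcases hsplit w hw with rfl | ⟨h, h'⟩
    exacts [hg, hS.pos w h]
  · simp only [Search.addRoot]
    rcases hsplit w hw with rfl | ⟨h, h'⟩
    · rw [us, us]
      exact fun _ _ => ⟨rfl, rfl, rfl, (S.M : Set V), hS.root_mem, hm,
        fun u hu w hw _ hgw => hcl u hu w hw hgw⟩
    · exact fun h1 h2 => absurd (hS.second w h h1 h2).1 h'
  · rcases hsplit w hw with rfl | ⟨h, h'⟩
    · exact Finset.mem_insert.2 (Or.inl hpm)
    · exact Finset.mem_insert_of_mem (hS.par_mem w h)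
  · rcases hsplit w hw with rfl | ⟨h, h'⟩
    · exact fun h => absurd hpm h
    · exact hS.adj w h
  · rcases hsplit w hw with rfl | ⟨h, h'⟩
    · exact fun h => absurd hpm h
    · exact hS.rank_lt w h
  · simp only [Search.addRoot]
    rcases hsplit w hw with rfl | ⟨h, h'⟩
    · exact fun h => absurd hpm h
    · rw [up _ _ h', up _ _ (hne _ (hS.par_mem w h))]; exact hS.rise_eq w h
  · simp only [Search.addRoot]
    rcases hsplit w hw with rfl | ⟨h, h'⟩
    · exact fun h => absurd hpm h
    · rw [up _ _ h', up _ _ (hne _ (hS.par_mem w h))]; exact hS.low_eq w h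
  · simp only [Search.addRoot]
    rw [Finset.sum_insert hm, hS.total_eq, add_comm, increment, if_pos hpm, if_neg hρ.symm]

/-- The numbers that a search computes are bounded. -/
theorem IsForest.total_le [Fintype V] (hS : S.IsForest G g ε ρ m) {B : ℕ} (hB : ∀ v, g v ≤ B) :
    S.total ≤ Fintype.card V * B := by
  rw [hS.total_eq]
  refine (Finset.sum_le_card_nsmul _ _ B fun v _ => ?_).trans ?_
  · unfold increment
    split_ifs
    · exact Nat.zero_le _
    · exact hB v
    · exact (Nat.sub_le _ _).trans (hB v)
  · exact Nat.mul_le_mul_right _ (Finset.card_le_univ _)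

theorem IsForest.rise_le [Fintype V] (hS : S.IsForest G g ε ρ m) {v : V} (hv : v ∈ S.M) :
    S.rise v ≤ S.total := by
  classical
  rw [hS.rise_eq_sum v hv, hS.total_eq]
  exact Finset.sum_le_sum_of_subset (Finset.filter_subset _ _)

/-- After the search has tried the pairs of vertices in `T`, starting with the set `M₀`, it is
complete, or has found vertices that `M₀` lacked, or the pairs have led to none. -/
def Progress (G : SimpleGraph V) (g : V → ℕ) (M₀ : Finset V) (T : V → V → Prop) (M : Finset V) :
    Prop :=
  Closed G g M ∨ (¬ Closed G g M₀ ∧ M₀.card < M.card) ∨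
    (M = M₀ ∧ ∀ u v, T u v → u ∈ M → G.Adj u v → 0 < g v → v ∈ M)

theorem Progress.visit {M₀ : Finset V} {T T' : V → V → Prop} (h : Progress G g M₀ T S.M) {u v : V}
    (hu : u ∈ S.M) (hv : v ∉ S.M) (huv : G.Adj u v) (hg : 0 < g v) :
    Progress G g M₀ T' (S.visit g u v).M := by
  have hcard : (S.visit g u v).M.card = S.M.card + 1 := Finset.card_insert_of_notMem hv
  rcases h with h | h | ⟨h, -⟩
  · exact absurd (h u hu v huv hg) hv
  · exact Or.inr (Or.inl ⟨h.1, by omega⟩)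
  · refine Or.inr (Or.inl ⟨fun hcl => hv ?_, by rw [hcard, h]; omega⟩)
    rw [h] at hu ⊢
    exact hcl u hu v huv hg

theorem Progress.skip {M₀ M : Finset V} {T T' : V → V → Prop} (h : Progress G g M₀ T M) {u v : V}
    (huv : u ∈ M → G.Adj u v → 0 < g v → v ∈ M) (hT : ∀ a b, T' a b → T a b ∨ (a = u ∧ b = v)) :
    Progress G g M₀ T' M := by
  rcases h with h | h | ⟨h, h'⟩
  · exact Or.inl h
  · exact Or.inr (Or.inl h)
  · refine Or.inr (Or.inr ⟨h, fun a b hab => ?_⟩)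
    rcases hT a b hab with h1 | ⟨rfl, rfl⟩
    · exact h' a b h1
    · exact huv

theorem Progress.mono {M₀ M : Finset V} {T T' : V → V → Prop} (h : Progress G g M₀ T M)
    (hT : ∀ a b, T' a b → T a b) : Progress G g M₀ T' M :=
  h.imp_right fun h => h.imp_right fun h => ⟨h.1, fun a b hab => h.2 a b (hT a b hab)⟩

theorem Progress.start (M : Finset V) {T : V → V → Prop} (hT : ∀ a b, ¬ T a b) :
    Progress G g M T M :=
  Or.inr (Or.inr ⟨rfl, fun a b h => absurd h (hT a b)⟩)

theorem Progress.finish {M₀ M : Finset V} {T : V → V → Prop} (h : Progress G g M₀ T M)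
    (hT : ∀ a b, T a b) : Closed G g M ∨ (¬ Closed G g M₀ ∧ M₀.card < M.card) :=
  h.elim Or.inl fun h => h.elim Or.inr fun h => Or.inl fun u hu w huw hg => h.2 u w (hT u w) hu huw hg

end Search

end Search

/-! ### Running time of programs -/

namespace RAM

/-- The state after writing `x` to register `r`. -/
def State.setReg (s : State) (r x : ℕ) : State := { s with reg := Function.update s.reg r x }

/-- The state after writing `x` to the memory cell with address `a`. -/
def State.setMem (s : State) (a x : ℕ) : State := { s with mem := Function.update s.mem a x }

@[simp] theorem State.setReg_mem (s : State) (r x : ℕ) : (s.setReg r x).mem = s.mem := rfl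

@[simp] theorem State.setMem_reg (s : State) (a x : ℕ) : (s.setMem a x).reg = s.reg := rfl

theorem State.setReg_reg (s : State) (r x r' : ℕ) :
    (s.setReg r x).reg r' = if r' = r then x else s.reg r' := by
  simp [State.setReg, Function.update_apply]

theorem State.setMem_mem (s : State) (a x a' : ℕ) :
    (s.setMem a x).mem a' = if a' = a then x else s.mem a' := by
  simp [State.setMem, Function.update_apply]

/-- All numbers in registers and memory have at most `b` bits. -/
def State.Bounded (b : ℕ) (s : State) : Prop := (∀ r, s.reg r < 2 ^ b) ∧ ∀ a, s.mem a < 2 ^ b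

theorem State.Bounded.setReg {b : ℕ} {s : State} (hs : s.Bounded b) {r x : ℕ} (hx : x < 2 ^ b) :
    (s.setReg r x).Bounded b := by
  refine ⟨fun r' => ?_, hs.2⟩
  rw [State.setReg_reg]
  split_ifs
  exacts [hx, hs.1 r']

theorem State.Bounded.setMem {b : ℕ} {s : State} (hs : s.Bounded b) {a x : ℕ} (hx : x < 2 ^ b) :
    (s.setMem a x).Bounded b := by
  refine ⟨hs.1, fun a' => ?_⟩
  rw [State.setMem_mem]
  split_ifs
  exacts [hx, hs.2 a']

/-- A factor by which the value of an expression has more bits than the numbers in it. -/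
def Expr.growth : Expr → ℕ
  | const a => a.size
  | reg _ => 1
  | cell _ => 1
  | add e₁ e₂ => e₁.growth + e₂.growth + 1
  | sub e₁ _ => e₁.growth
  | mul e₁ e₂ => e₁.growth + e₂.growth

/-- The cost of an expression per bit of the numbers in it. -/
def Expr.costFactor : Expr → ℕ
  | const a => a.size + 1
  | reg _ => 2
  | cell e => e.costFactor + e.growth + 2
  | add e₁ e₂ => e₁.costFactor + e₂.costFactor + e₁.growth + e₂.growth + 1
  | sub e₁ e₂ => e₁.costFactor + e₂.costFactor + e₁.growth + e₂.growth + 1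
  | mul e₁ e₂ => e₁.costFactor + e₂.costFactor + e₁.growth + e₂.growth + 1

variable {b : ℕ} {s : State}

theorem Expr.size_eval_le (hb : 1 ≤ b) (hs : s.Bounded b) (e : Expr) :
    (e.eval s).size ≤ e.growth * b := by
  induction e with
  | const a => exact Nat.le_mul_of_pos_right _ hb
  | reg r => rw [growth, one_mul]; exact Nat.size_le.2 (hs.1 r)
  | cell e _ => rw [growth, one_mul]; exact Nat.size_le.2 (hs.2 _)
  | add e₁ e₂ h₁ h₂ =>
    rw [Nat.size_le] at *
    rw [eval, growth, add_mul, add_mul, one_mul]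
    have h3 : 2 ^ (e₁.growth * b) ≤ 2 ^ (e₁.growth * b + e₂.growth * b) :=
      Nat.pow_le_pow_right (by norm_num) (by omega)
    have h4 : 2 ^ (e₂.growth * b) ≤ 2 ^ (e₁.growth * b + e₂.growth * b) :=
      Nat.pow_le_pow_right (by norm_num) (by omega)
    have h5 : 2 ^ (e₁.growth * b + e₂.growth * b + 1) ≤
        2 ^ (e₁.growth * b + e₂.growth * b + b) :=
      Nat.pow_le_pow_right (by norm_num) (by omega)
    rw [pow_succ] at h5
    omega
  | sub e₁ e₂ h₁ h₂ => exact (Nat.size_le_size (Nat.sub_le _ _)).trans h₁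
  | mul e₁ e₂ h₁ h₂ =>
    rw [Nat.size_le] at *
    rw [eval, growth, add_mul, pow_add]
    exact Nat.mul_lt_mul'' h₁ h₂

theorem Expr.cost_le (hb : 1 ≤ b) (hs : s.Bounded b) (e : Expr) :
    e.cost s ≤ e.costFactor * b := by
  induction e with
  | const a => exact Nat.le_mul_of_pos_right _ hb
  | reg r =>
    have : (s.reg r).size ≤ b := Nat.size_le.2 (hs.1 r)
    simp only [cost, costFactor]; omega
  | cell e h =>
    have h1 := e.size_eval_le hb hs
    have h2 : (s.mem (e.eval s)).size ≤ b := Nat.size_le.2 (hs.2 _)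
    simp only [cost, costFactor, add_mul]; omega
  | add e₁ e₂ h₁ h₂ | sub e₁ e₂ h₁ h₂ | mul e₁ e₂ h₁ h₂ =>
    have h3 := e₁.size_eval_le hb hs
    have h4 := e₂.size_eval_le hb hs
    simp only [cost, costFactor, add_mul]; omega

/-- The cost of evaluating an expression and of using its value, per bit of the numbers in it. -/
def Expr.useFactor (e : Expr) : ℕ := e.costFactor + e.growth + 1

theorem Expr.use_le (hb : 1 ≤ b) (hs : s.Bounded b) (e : Expr) :
    e.cost s + (e.eval s).size + 1 ≤ e.useFactor * b := by
  have h1 := e.size_eval_le hb hs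
  have h2 := e.cost_le hb hs
  simp only [useFactor, add_mul]; omega

/-- A bound for the running time of a program, if all numbers have at most `b` bits and no loop is
executed more than `N` times. -/
def Program.timeBound (N b : ℕ) : Program → ℕ
  | skip => 1
  | set _ e => e.useFactor * b
  | store a e => a.useFactor * b + e.useFactor * b
  | seq P Q => P.timeBound N b + Q.timeBound N b + 1
  | ite e P Q => e.useFactor * b + P.timeBound N b + Q.timeBound N b
  | loop e P => (N + 1) * (e.useFactor * b + P.timeBound N b)

/-- The polynomial form of `Program.timeBound`. -/
noncomputable def Program.timePolynomial (B : Polynomial ℕ) : Program → Polynomial ℕ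
  | skip => 1
  | set _ e => Polynomial.C e.useFactor * B
  | store a e => Polynomial.C a.useFactor * B + Polynomial.C e.useFactor * B
  | seq P Q => P.timePolynomial B + Q.timePolynomial B + 1
  | ite e P Q => Polynomial.C e.useFactor * B + P.timePolynomial B + Q.timePolynomial B
  | loop e P => (Polynomial.X + 1) * (Polynomial.C e.useFactor * B + P.timePolynomial B)

theorem Program.eval_timePolynomial (B : Polynomial ℕ) (N : ℕ) (P : Program) :
    (P.timePolynomial B).eval N = P.timeBound N (B.eval N) := by
  induction P <;> simp_all [timePolynomial, timeBound]

/-- The program does not write to register `r`. -/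
def Program.keeps (r : ℕ) : Program → Bool
  | skip => true
  | set r' _ => r' != r
  | store _ _ => true
  | seq P Q => P.keeps r && Q.keeps r
  | ite _ P Q => P.keeps r && Q.keeps r
  | loop _ P => P.keeps r

theorem Run.reg_eq {P : Program} {s s' : State} {t r : ℕ} (h : Run P s t s')
    (hr : P.keeps r = true) : s'.reg r = s.reg r := by
  induction h with
  | skip | store | loop_false => rfl
  | set r' e s =>
    have : r ≠ r' := by rintro rfl; simp [Program.keeps] at hr
    simp [this]
  | seq _ _ h₁ h₂ =>
    simp only [Program.keeps, Bool.and_eq_true] at hr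
    exact (h₂ hr.2).trans (h₁ hr.1)
  | ite_true _ _ h₁ | ite_false _ _ h₁ =>
    simp only [Program.keeps, Bool.and_eq_true] at hr
    first | exact h₁ hr.1 | exact h₁ hr.2
  | loop_true _ _ _ h₁ h₂ => exact (h₂ hr).trans (h₁ hr)

/-- Started in the state `s`, the program halts within its time bound in a state with numbers of at
most `b` bits that has the property `Q`. -/
def Ensures (N b : ℕ) (P : Program) (s : State) (Q : State → Prop) : Prop :=
  ∃ t s', Run P s t s' ∧ t ≤ P.timeBound N b ∧ s'.Bounded b ∧ Q s'

variable {N : ℕ} {P P' : Program} {Q R : State → Prop}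

theorem Ensures.mono (h : Ensures N b P s Q) (hQ : ∀ s', s'.Bounded b → Q s' → R s') :
    Ensures N b P s R := by
  obtain ⟨t, s', hrun, ht, hb, hs'⟩ := h
  exact ⟨t, s', hrun, ht, hb, hQ s' hb hs'⟩

theorem Ensures.and_reg_eq (h : Ensures N b P s Q) {r : ℕ} (hr : P.keeps r = true) :
    Ensures N b P s fun s' => s'.reg r = s.reg r ∧ Q s' := by
  obtain ⟨t, s', hrun, ht, hb, hs'⟩ := h
  exact ⟨t, s', hrun, ht, hb, hrun.reg_eq hr, hs'⟩

theorem Ensures.skip (hs : s.Bounded b) (hQ : Q s) : Ensures N b .skip s Q :=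
  ⟨1, s, .skip s, le_rfl, hs, hQ⟩

theorem Ensures.set (hb : 1 ≤ b) (hs : s.Bounded b) {r : ℕ} {e : Expr} (he : e.eval s < 2 ^ b)
    (hQ : Q (s.setReg r (e.eval s))) : Ensures N b (.set r e) s Q :=
  ⟨_, _, .set r e s, e.use_le hb hs, hs.setReg he, hQ⟩

theorem Ensures.store (hb : 1 ≤ b) (hs : s.Bounded b) {a e : Expr} (he : e.eval s < 2 ^ b)
    (hQ : Q (s.setMem (a.eval s) (e.eval s))) : Ensures N b (.store a e) s Q := by
  refine ⟨_, _, .store a e s, ?_, hs.setMem he, hQ⟩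
  have h1 := a.use_le hb hs
  have h2 := e.use_le hb hs
  simp only [Program.timeBound]
  omega

theorem Ensures.seq (hP : Ensures N b P s R) (hP' : ∀ s', s'.Bounded b → R s' → Ensures N b P' s' Q) :
    Ensures N b (.seq P P') s Q := by
  obtain ⟨t, s₁, hrun, ht, hb, hs₁⟩ := hP
  obtain ⟨t', s₂, hrun', ht', hb', hs₂⟩ := hP' s₁ hb hs₁
  refine ⟨_, s₂, .seq hrun hrun', ?_, hb', hs₂⟩
  simp only [Program.timeBound]
  omega

theorem Ensures.ite (hb : 1 ≤ b) (hs : s.Bounded b) {e : Expr}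
    (hP : e.eval s ≠ 0 → Ensures N b P s Q) (hP' : e.eval s = 0 → Ensures N b P' s Q) :
    Ensures N b (.ite e P P') s Q := by
  have h1 := e.use_le hb hs
  by_cases h : e.eval s = 0
  · obtain ⟨t, s', hrun, ht, hb', hs'⟩ := hP' h
    refine ⟨_, s', .ite_false h hrun, ?_, hb', hs'⟩
    simp only [Program.timeBound]
    omega
  · obtain ⟨t, s', hrun, ht, hb', hs'⟩ := hP h
    refine ⟨_, s', .ite_true h hrun, ?_, hb', hs'⟩
    simp only [Program.timeBound]
    omega

/-- The program that executes `P` with the values `0, 1, …` in register `r`, up to the number in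
register `1`. -/
def forLoop (r : ℕ) (P : Program) : Program :=
  .seq (.set r (.const 0))
    (.loop (.sub (.reg 1) (.reg r)) (.seq P (.set r (.add (.reg r) (.const 1)))))

theorem Ensures.forLoop {Inv : ℕ → State → Prop} {n r : ℕ} (hb : 1 ≤ b) (hs : s.Bounded b)
    (hnN : n ≤ N) (hnb : n < 2 ^ b) (hr : r ≠ 1) (hPr : P.keeps r = true) (hP1 : P.keeps 1 = true)
    (hn : s.reg 1 = n) (hstab : ∀ i s x, Inv i s → Inv i (s.setReg r x)) (h0 : Inv 0 s)
    (hbody : ∀ i < n, ∀ s : State, s.Bounded b → s.reg 1 = n → s.reg r = i → Inv i s →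
      Ensures N b P s (Inv (i + 1))) :
    Ensures N b (forLoop r P) s (Inv n) := by
  set body : Program := .seq P (.set r (.add (.reg r) (.const 1))) with hbodydef
  set cond : Expr := .sub (.reg 1) (.reg r) with hcond
  have hceval : ∀ s : State, cond.eval s = s.reg 1 - s.reg r := fun s => rfl
  -- The remaining executions of the loop.
  have key : ∀ j i, i + j = n → ∀ s : State, s.Bounded b → s.reg 1 = n → s.reg r = i → Inv i s →
      ∃ t s', Run (.loop cond body) s t s' ∧
        t ≤ (j + 1) * (cond.useFactor * b + body.timeBound N b) ∧ s'.Bounded b ∧ Inv n s' := by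
    intro j
    induction j with
    | zero =>
      intro i hi s hs h1 hri hI
      have hz : cond.eval s = 0 := by rw [hceval]; omega
      refine ⟨_, s, .loop_false hz, ?_, hs, ?_⟩
      · have := cond.use_le hb hs
        rw [zero_add, one_mul]
        omega
      · rwa [← hi, add_zero]
    | succ j ih =>
      intro i hi s hs h1 hri hI
      have hz : cond.eval s ≠ 0 := by rw [hceval]; omega
      have hE : Ensures N b body s fun s' => s'.reg 1 = n ∧ s'.reg r = i + 1 ∧ Inv (i + 1) s' := by
        refine Ensures.seq (((hbody i (by omega) s hs h1 hri hI).and_reg_eq hPr).and_reg_eq hP1)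
          fun s' hs' h => ?_
        obtain ⟨e1, e2, e3⟩ := h
        have he : (Expr.add (.reg r) (.const 1)).eval s' = i + 1 := by
          simp only [Expr.eval]; rw [e2, hri]
        refine Ensures.set hb hs' (by rw [he]; omega) ?_
        rw [he]
        refine ⟨?_, ?_, hstab _ _ _ e3⟩
        · rw [State.setReg_reg, if_neg hr.symm, e1, h1]
        · rw [State.setReg_reg, if_pos rfl]
      obtain ⟨t₁, s₁, hrun₁, ht₁, hb₁, g1, g2, g3⟩ := hE
      obtain ⟨t₂, s₂, hrun₂, ht₂, hb₂, hI₂⟩ := ih (i + 1) (by omega) s₁ hb₁ g1 g2 g3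
      refine ⟨_, s₂, .loop_true hz hrun₁ hrun₂, ?_, hb₂, hI₂⟩
      have := cond.use_le hb hs
      rw [add_mul (j + 1), one_mul]
      omega
  refine Ensures.seq (R := fun s' => s'.reg 1 = n ∧ s'.reg r = 0 ∧ Inv 0 s')
    (Ensures.set hb hs (by simp [Expr.eval]) ?_) fun s' hs' h => ?_
  · refine ⟨?_, ?_, hstab _ _ _ h0⟩
    · rw [State.setReg_reg, if_neg hr.symm, hn]
    · rw [State.setReg_reg, if_pos rfl]; rfl
  · obtain ⟨t, s'', hrun, ht, hb', hI⟩ := key n 0 (by omega) s' hs' h.1 h.2.1 h.2.2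
    refine ⟨t, s'', hrun, ht.trans ?_, hb', hI⟩
    simp only [Program.timeBound]
    exact Nat.mul_le_mul_right _ (by omega)

end RAM

/-! ### The search as a program -/

namespace RAM

theorem Ensures.seq_set {N b : ℕ} {s : State} {P : Program} {Q : State → Prop} (hb : 1 ≤ b)
    (hs : s.Bounded b) {r : ℕ} {e : Expr} {x : ℕ} (hx : e.eval s = x) (he : x < 2 ^ b)
    (hP : (s.setReg r x).Bounded b → Ensures N b P (s.setReg r x) Q) :
    Ensures N b (.seq (.set r e) P) s Q := by
  subst hx
  exact Ensures.seq (R := fun s' => s' = s.setReg r (e.eval s)) (Ensures.set hb hs he rfl)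
    fun s' hs' h => by subst h; exact hP hs'

theorem Ensures.seq_store {N b : ℕ} {s : State} {P : Program} {Q : State → Prop} (hb : 1 ≤ b)
    (hs : s.Bounded b) {a e : Expr} {y x : ℕ} (hy : a.eval s = y) (hx : e.eval s = x)
    (he : x < 2 ^ b)
    (hP : (s.setMem y x).Bounded b → Ensures N b P (s.setMem y x) Q) :
    Ensures N b (.seq (.store a e) P) s Q := by
  subst hx hy
  exact Ensures.seq (R := fun s' => s' = s.setMem (a.eval s) (e.eval s))
    (Ensures.store hb hs he rfl) fun s' hs' h => by subst h; exact hP hs'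

@[simp] theorem Expr.eval_const (s : State) (a : ℕ) : (Expr.const a).eval s = a := rfl

@[simp] theorem Expr.eval_reg (s : State) (r : ℕ) : (Expr.reg r).eval s = s.reg r := rfl

theorem Expr.eval_add (s : State) (e e' : Expr) : (e.add e').eval s = e.eval s + e'.eval s := rfl

theorem Expr.eval_sub (s : State) (e e' : Expr) : (e.sub e').eval s = e.eval s - e'.eval s := rfl

theorem Expr.eval_mul (s : State) (e e' : Expr) : (e.mul e').eval s = e.eval s * e'.eval s := rfl

/-- The length of the encoding of an instance with `n` vertices. -/
def inputLength (n : ℕ) : ℕ := 1 + n * n + n + n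

/-- The address of entry `v` of the array with number `j`. The arrays are stored behind the input.
They are: the values at the vertices (`0`), the marks of the vertices found by the search (`1`),
their parents (`2`), and the numbers `rise` (`3`) and `low` (`4`). -/
def addr (n j v : ℕ) : ℕ := inputLength n + j * n + v

theorem addr_inj {n j j' v v' : ℕ} (hv : v < n) (hv' : v' < n) :
    addr n j v = addr n j' v' ↔ j = j' ∧ v = v' := by
  refine ⟨fun h => ?_, fun h => by rw [h.1, h.2]⟩
  have h1 : v + n * j = v' + n * j' := by
    simp only [addr] at h
    rw [mul_comm n, mul_comm n]
    omega
  have hn : 0 < n := by omega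
  have h2 := congrArg (· / n) h1
  simp only [Nat.add_mul_div_left _ _ hn, Nat.div_eq_of_lt hv, Nat.div_eq_of_lt hv', zero_add] at h2
  exact ⟨h2, by subst h2; omega⟩

theorem mul_add_lt {n u v : ℕ} (hu : u < n) (hv : v < n) : u * n + v < n * n := by
  have : (u + 1) * n ≤ n * n := Nat.mul_le_mul_right _ hu
  rw [add_mul, one_mul] at this
  omega

theorem adj_address_ne {n : ℕ} (u v : Fin n) (j w : ℕ) : 1 + ((u : ℕ) * n + v) ≠ addr n j w := by
  have := mul_add_lt u.2 v.2
  simp only [addr, inputLength]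
  omega

/-- The address of an array entry, as an expression. -/
def arr (j : ℕ) (e : Expr) : Expr := .add (.add (.reg 0) (.mul (.const j) (.reg 1))) e

/-- An entry of the adjacency matrix. -/
def adjCell (e e' : Expr) : Expr :=
  .cell (.add (.const 1) (.add (.mul e (.reg 1)) e'))

/-- An expression that vanishes if and only if the two expressions have the same value. -/
def diff (e e' : Expr) : Expr := .add (.sub e e') (.sub e' e)

theorem diff_eval (s : State) (e e' : Expr) : (diff e e').eval s = 0 ↔ e.eval s = e'.eval s := by
  simp only [diff, Expr.eval]
  omega

section Verification

variable {n : ℕ} (G : SimpleGraph (Fin n)) (g : Fin n → ℕ)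

/-- The memory holds the adjacency matrix of the graph and the values at the vertices, and registers
`0` and `1` hold the length of the input and the number of vertices. Of the other registers, `2` and
`3` are for the two roots of a search, `4` to `6` for loops, `7` for the answer, `8` for `total`, and
`9` for the outcome of a single trial. -/
structure HasGraph (s : State) : Prop where
  length : s.reg 0 = inputLength n
  card : s.reg 1 = n
  adj : ∀ u v : Fin n, G.Adj u v → s.mem (1 + ((u : ℕ) * n + v)) = 1
  not_adj : ∀ u v : Fin n, ¬ G.Adj u v → s.mem (1 + ((u : ℕ) * n + v)) = 0
  val : ∀ v : Fin n, s.mem (addr n 0 v) = g v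

/-- The memory holds the state of a search; `total` is in register `8`. -/
structure HasSearch (S : Search (Fin n)) (s : State) : Prop where
  mark : ∀ v : Fin n, s.mem (addr n 1 v) = if v ∈ S.M then 1 else 0
  par : ∀ v : Fin n, s.mem (addr n 2 v) = (S.par v : ℕ)
  rise : ∀ v ∈ S.M, s.mem (addr n 3 v) = S.rise v
  low : ∀ v ∈ S.M, s.mem (addr n 4 v) = S.low v
  total : s.reg 8 = S.total

/-- The number `b` of bits suffices for all numbers that occur, if `B` bounds the values; no loop is
executed more than `N` times. -/
structure Suffices (N b B : ℕ) : Prop where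
  one_le : 1 ≤ b
  card_le : n ≤ N
  card_lt : n < 2 ^ b
  val_le : ∀ v, g v ≤ B
  mul_lt : n * B < 2 ^ b

variable {G g} {N b B ε : ℕ} {ρ m : Fin n} {S : Search (Fin n)} {s : State}

theorem HasGraph.setReg (h : HasGraph G g s) {r : ℕ} (h0 : r ≠ 0) (h1 : r ≠ 1) (x : ℕ) :
    HasGraph G g (s.setReg r x) := by
  refine ⟨?_, ?_, h.adj, h.not_adj, h.val⟩
  · rw [State.setReg_reg, if_neg h0.symm, h.length]
  · rw [State.setReg_reg, if_neg h1.symm, h.card]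

theorem HasGraph.setMem (h : HasGraph G g s) {j : ℕ} (hj : j ≠ 0) (v : Fin n) (x : ℕ) :
    HasGraph G g (s.setMem (addr n j v) x) := by
  refine ⟨h.length, h.card, fun u w huw => ?_, fun u w huw => ?_, fun w => ?_⟩
  · rw [State.setMem_mem, if_neg (adj_address_ne u w j v), h.adj u w huw]
  · rw [State.setMem_mem, if_neg (adj_address_ne u w j v), h.not_adj u w huw]
  · rw [State.setMem_mem, if_neg, h.val]
    rw [addr_inj w.2 v.2]
    exact fun h => hj h.1.symm

theorem HasSearch.setReg (h : HasSearch S s) {r : ℕ} (h8 : r ≠ 8) (x : ℕ) :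
    HasSearch S (s.setReg r x) :=
  ⟨h.mark, h.par, h.rise, h.low, by rw [State.setReg_reg, if_neg h8.symm, h.total]⟩

theorem HasGraph.eval_arr (h : HasGraph G g s) {j : ℕ} {e : Expr} {v : ℕ} (he : e.eval s = v) :
    (arr j e).eval s = addr n j v := by
  simp only [arr, Expr.eval, h.length, h.card, he, addr]

theorem HasGraph.eval_cell (h : HasGraph G g s) {j : ℕ} {e : Expr} {v : ℕ} (he : e.eval s = v) :
    (Expr.cell (arr j e)).eval s = s.mem (addr n j v) := by
  rw [Expr.eval, h.eval_arr he]

theorem HasGraph.eval_val (h : HasGraph G g s) {e : Expr} {v : Fin n} (he : e.eval s = v) :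
    (Expr.cell (arr 0 e)).eval s = g v := by
  rw [h.eval_cell he, h.val]

theorem HasGraph.eval_adjCell (h : HasGraph G g s) {e e' : Expr} {u v : Fin n} (he : e.eval s = u)
    (he' : e'.eval s = v) : (adjCell e e').eval s ≠ 0 ↔ G.Adj u v := by
  have : (adjCell e e').eval s = s.mem (1 + ((u : ℕ) * n + v)) := by
    simp only [adjCell, Expr.eval, he, he', h.card]
  rw [this]
  by_cases huv : G.Adj u v
  · simp [h.adj u v huv, huv]
  · simp [h.not_adj u v huv, huv]

theorem addr_eq_iff {j j' : ℕ} (v w : Fin n) : addr n j v = addr n j' w ↔ j = j' ∧ v = w := by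
  rw [addr_inj v.2 w.2, Fin.ext_iff]

/-! ### One step of the search -/

/-- Register `6` holds a new vertex, and register `5` its parent. -/
def visitProgram : Program :=
  .seq (.store (arr 2 (.reg 6)) (.reg 5)) <|
  .seq (.store (arr 3 (.reg 6)) (.add (.cell (arr 3 (.reg 5)))
    (.sub (.cell (arr 0 (.reg 6))) (.cell (arr 0 (.reg 5)))))) <|
  .seq (.store (arr 4 (.reg 6)) (.sub (.cell (arr 4 (.reg 5)))
    (.sub (.cell (arr 4 (.reg 5))) (.cell (arr 0 (.reg 6)))))) <|
  .seq (.set 8 (.add (.reg 8) (.sub (.cell (arr 0 (.reg 6))) (.cell (arr 0 (.reg 5)))))) <|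
  .store (arr 1 (.reg 6)) (.const 1)

theorem ensures_visitProgram (hN : Suffices g N b B) (hs : s.Bounded b)
    (hG : HasGraph G g s) (hS : HasSearch S s) (hF : S.IsForest G g ε ρ m) {u v : Fin n}
    (h5 : s.reg 5 = u) (h6 : s.reg 6 = v) (hu : u ∈ S.M) (hv : v ∉ S.M) (huv : G.Adj u v)
    (hgv : 0 < g v) :
    Ensures N b visitProgram s fun s' => HasGraph G g s' ∧ HasSearch (S.visit g u v) s' := by
  have hF' := hF.visit hu hv huv hgv
  have htot : S.total + (g v - g u) < 2 ^ b := by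
    have := hF'.total_le hN.val_le
    rw [Fintype.card_fin] at this
    exact lt_of_le_of_lt this hN.mul_lt
  have hrise : S.rise u + (g v - g u) < 2 ^ b :=
    lt_of_le_of_lt (Nat.add_le_add_right (hF.rise_le hu) _) htot
  have hlow : min (S.low u) (g v) < 2 ^ b := by
    refine lt_of_le_of_lt ((min_le_right _ _).trans (hN.val_le v)) (lt_of_le_of_lt ?_ hN.mul_lt)
    exact Nat.le_mul_of_pos_left _ (Nat.zero_lt_of_lt v.2)
  have hne : u ≠ v := huv.ne
  have hb := hN.one_le
  refine Ensures.seq_store hb hs (hG.eval_arr (by simpa [Expr.eval] using h6))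
    (x := u) (by simpa [Expr.eval] using h5) (u.2.trans hN.card_lt) fun hs => ?_
  replace hG := hG.setMem (j := 2) (by norm_num) v u
  refine Ensures.seq_store hb hs (hG.eval_arr (by simpa [Expr.eval] using h6))
    (x := S.rise u + (g v - g u)) ?_ hrise fun hs => ?_
  · rw [Expr.eval_add, Expr.eval_sub, hG.eval_val (v := v) (e := .reg 6) (by simpa [Expr.eval] using h6),
      hG.eval_val (v := u) (e := .reg 5) (by simpa [Expr.eval] using h5),
      hG.eval_cell (v := u) (e := .reg 5) (by simpa [Expr.eval] using h5)]
    simp [State.setMem_mem, addr_eq_iff, hS.rise u hu]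
  replace hG := hG.setMem (j := 3) (by norm_num) v (S.rise u + (g v - g u))
  refine Ensures.seq_store hb hs (hG.eval_arr (by simpa [Expr.eval] using h6))
    (x := min (S.low u) (g v)) ?_ hlow fun hs => ?_
  · rw [Expr.eval_sub, Expr.eval_sub, hG.eval_val (v := v) (e := .reg 6) (by simpa [Expr.eval] using h6),
      hG.eval_cell (v := u) (e := .reg 5) (by simpa [Expr.eval] using h5)]
    simp only [State.setMem_mem, addr_eq_iff, hS.low u hu]
    simp
    omega
  replace hG := hG.setMem (j := 4) (by norm_num) v (min (S.low u) (g v))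
  refine Ensures.seq_set hb hs (x := S.total + (g v - g u)) ?_ htot fun hs => ?_
  · rw [Expr.eval_add, Expr.eval_sub, hG.eval_val (v := v) (e := .reg 6) (by simpa [Expr.eval] using h6),
      hG.eval_val (v := u) (e := .reg 5) (by simpa [Expr.eval] using h5)]
    simp [Expr.eval, hS.total]
  replace hG := hG.setReg (r := 8) (by norm_num) (by norm_num) (S.total + (g v - g u))
  have e1 : (arr 1 (.reg 6)).eval _ = _ := hG.eval_arr (j := 1) (e := .reg 6) (v := v)
    (by simpa [Expr.eval, State.setReg_reg] using h6)
  refine Ensures.store hb hs (by simp only [Expr.eval]; exact Nat.one_lt_two_pow (by omega)) ?_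
  rw [e1]
  refine ⟨hG.setMem (by norm_num) v _, ?_⟩
  refine ⟨fun w => ?_, fun w => ?_, fun w hw => ?_, fun w hw => ?_, ?_⟩
  · simp only [State.setMem_mem, State.setReg_mem, addr_eq_iff, hS.mark, Search.visit,
      Finset.mem_insert, Expr.eval]
    by_cases hwv : w = v <;> simp [hwv]
  all_goals simp only [Search.visit, Finset.mem_insert] at *
  · simp only [State.setMem_mem, State.setReg_mem, addr_eq_iff, Function.update_apply]
    by_cases hwv : w = v
    · simp [hwv]
    · simp [hwv, hS.par w]
  · simp only [State.setMem_mem, State.setReg_mem, addr_eq_iff, Function.update_apply]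
    by_cases hwv : w = v
    · simp [hwv]
    · simp [hwv, hS.rise w (hw.resolve_left hwv)]
  · simp only [State.setMem_mem, State.setReg_mem, addr_eq_iff, Function.update_apply]
    by_cases hwv : w = v
    · simp [hwv]
    · simp [hwv, hS.low w (hw.resolve_left hwv)]
  · simp [State.setReg_reg]

/-- Try the edge from the vertex in register `5` to the vertex in register `6`. -/
def stepProgram : Program :=
  .ite (.mul (.mul (.cell (arr 1 (.reg 5))) (adjCell (.reg 5) (.reg 6)))
    (.mul (.cell (arr 0 (.reg 6))) (.sub (.const 1) (.cell (arr 1 (.reg 6))))))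
    visitProgram .skip

/-- A search forest that contains the vertices in `M₀` and has the property `T`. -/
def Searching (G : SimpleGraph (Fin n)) (g : Fin n → ℕ) (ε : ℕ) (ρ m : Fin n)
    (M₀ : Finset (Fin n)) (T : Finset (Fin n) → Prop) (s : State) : Prop :=
  HasGraph G g s ∧ ∃ S : Search (Fin n), HasSearch S s ∧ S.IsForest G g ε ρ m ∧ M₀ ⊆ S.M ∧ T S.M

theorem Searching.setReg {M₀ : Finset (Fin n)} {T : Finset (Fin n) → Prop}
    (h : Searching G g ε ρ m M₀ T s) {r : ℕ} (h0 : r ≠ 0) (h1 : r ≠ 1) (h8 : r ≠ 8) (x : ℕ) :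
    Searching G g ε ρ m M₀ T (s.setReg r x) :=
  ⟨h.1.setReg h0 h1 x, h.2.imp fun _ h => ⟨h.1.setReg h8 x, h.2⟩⟩

theorem Searching.mono {M₀ : Finset (Fin n)} {T T' : Finset (Fin n) → Prop}
    (h : Searching G g ε ρ m M₀ T s) (hT : ∀ M, T M → T' M) : Searching G g ε ρ m M₀ T' s :=
  ⟨h.1, h.2.imp fun _ h => ⟨h.1, h.2.1, h.2.2.1, hT _ h.2.2.2⟩⟩

theorem ensures_stepProgram (hN : Suffices g N b B) (hs : s.Bounded b)
    {M₀ M₁ : Finset (Fin n)} {T T' : Fin n → Fin n → Prop} {u v : Fin n}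
    (h : Searching G g ε ρ m M₀ (Search.Progress G g M₁ T) s)
    (h5 : s.reg 5 = u) (h6 : s.reg 6 = v) (hT : ∀ x y, T' x y → T x y ∨ (x = u ∧ y = v)) :
    Ensures N b stepProgram s (Searching G g ε ρ m M₀ (Search.Progress G g M₁ T')) := by
  obtain ⟨hG, S, hS, hF, hM, hP⟩ := h
  have hcond : (Expr.mul (.mul (.cell (arr 1 (.reg 5))) (adjCell (.reg 5) (.reg 6)))
      (.mul (.cell (arr 0 (.reg 6))) (.sub (.const 1) (.cell (arr 1 (.reg 6)))))).eval s ≠ 0 ↔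
      (u ∈ S.M ∧ G.Adj u v) ∧ (0 < g v ∧ v ∉ S.M) := by
    have e0 := hG.eval_adjCell (e := .reg 5) (e' := .reg 6) h5 h6
    have e1 := hG.eval_val (e := .reg 6) h6
    have e2 := hG.eval_cell (j := 1) (e := .reg 5) h5
    have e3 := hG.eval_cell (j := 1) (e := .reg 6) h6
    rw [hS.mark] at e2 e3
    rw [Expr.eval_mul, Expr.eval_mul, Expr.eval_mul, Expr.eval_sub, Expr.eval_const, mul_ne_zero_iff, mul_ne_zero_iff,
      mul_ne_zero_iff, e0, e1, e2, e3, Nat.pos_iff_ne_zero]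
    by_cases h1 : u ∈ S.M <;> by_cases h2 : v ∈ S.M <;> simp [h1, h2]
  refine Ensures.ite hN.one_le hs (fun hc => ?_) fun hc => ?_
  · obtain ⟨⟨hu, huv⟩, hg, hv⟩ := hcond.1 hc
    refine (ensures_visitProgram hN hs hG hS hF h5 h6 hu hv huv hg).mono fun s' _ h => ?_
    exact ⟨h.1, _, h.2, hF.visit hu hv huv hg, hM.trans (Finset.subset_insert _ _),
      hP.visit hu hv huv hg⟩
  · have hc := fun h' => hcond.2 h' hc
    refine Ensures.skip hs ⟨hG, S, hS, hF, hM, hP.skip (fun hu huv hg => ?_) hT⟩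
    by_contra hv
    exact hc ⟨⟨hu, huv⟩, hg, hv⟩

/-! ### Completing the search -/

/-- In as many rounds as there are vertices, all pairs of vertices are tried. -/
def searchProgram : Program := forLoop 4 (forLoop 5 (forLoop 6 stepProgram))

/-- Each round finds a new vertex, unless the search is complete. -/
theorem ensures_searchProgram (hN : Suffices g N b B) (hs : s.Bounded b)
    (hG : HasGraph G g s) (hS : HasSearch S s) (hF : S.IsForest G g ε ρ m) :
    Ensures N b searchProgram s (Searching G g ε ρ m S.M (Search.Closed G g)) := by
  have hb := hN.one_le
  have hfin : ∀ s : State, s.Bounded b → s.reg 1 = n → ∀ k < n,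
      Searching G g ε ρ m S.M (fun M => Search.Closed G g M ∨ k < M.card) s →
      Ensures N b (forLoop 5 (forLoop 6 stepProgram)) s
        (Searching G g ε ρ m S.M fun M => Search.Closed G g M ∨ k + 1 < M.card) := by
    intro s hs hn k hk h
    obtain ⟨hG, S₁, hS₁, hF₁, hM₁, hk₁⟩ := h
    refine Ensures.mono (Ensures.forLoop (Inv := fun i => Searching G g ε ρ m S.M
        (Search.Progress G g S₁.M fun x _ => (x : ℕ) < i)) hb hs hN.card_le hN.card_lt
      (by norm_num) rfl rfl hn (fun i s x h => h.setReg (by norm_num) (by norm_num) (by norm_num) x)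
      ⟨hG, S₁, hS₁, hF₁, hM₁, Search.Progress.start _ (by simp)⟩ fun i hi s hs hn h5 h => ?_)
      fun s' hs' h => ?_
    · refine Ensures.mono (Ensures.forLoop (Inv := fun j s => s.reg 5 = i ∧
          Searching G g ε ρ m S.M (Search.Progress G g S₁.M
            fun x y => (x : ℕ) < i ∨ ((x : ℕ) = i ∧ (y : ℕ) < j)) s)
        hb hs hN.card_le hN.card_lt (by norm_num) rfl rfl hn (fun j s x h => ⟨?_, ?_⟩)
        ⟨h5, h.mono fun M h => h.mono (by simp)⟩ fun j hj s hs hn h6 h => ?_)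
        fun s' hs' h => h.2.mono fun M h => h.mono ?_
      · rw [State.setReg_reg, if_neg (by norm_num)]; exact h.1
      · exact h.2.setReg (by norm_num) (by norm_num) (by norm_num) x
      · have := (ensures_stepProgram (T' := fun x y => (x : ℕ) < i ∨ ((x : ℕ) = i ∧ (y : ℕ) < j + 1))
          hN hs h.2 (u := ⟨i, hi⟩) (v := ⟨j, hj⟩) h.1 h6 ?_).and_reg_eq (r := 5) rfl
        · exact this.mono fun s' _ h' => ⟨h'.1.trans h.1, h'.2⟩
        · intro x y hxy
          rw [Fin.ext_iff, Fin.ext_iff]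
          simp only
          omega
      · intro x y hxy
        have := y.2
        omega
    · refine h.mono fun M hM => ?_
      rcases hM.finish fun x _ => x.2 with h | h
      · exact Or.inl h
      · rcases hk₁ with h' | h'
        · exact absurd h' h.1
        · exact Or.inr (by have := h.2; omega)
  refine Ensures.mono (Ensures.forLoop (Inv := fun k => Searching G g ε ρ m S.M
      fun M => Search.Closed G g M ∨ k < M.card) hb hs hN.card_le hN.card_lt
    (by norm_num) rfl rfl hG.card (fun i s x h => h.setReg (by norm_num) (by norm_num) (by norm_num) x)
    ⟨hG, S, hS, hF, Finset.Subset.refl _, Or.inr (Finset.card_pos.2 ⟨ρ, hF.root_mem⟩)⟩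
    fun k hk s hs hn _ h => hfin s hs hn k hk h) fun s' hs' h => h.mono fun M hM => ?_
  rcases hM with h | h
  · exact h
  · have := Finset.card_le_univ M
    rw [Fintype.card_fin] at this
    omega

end Verification

end RAM

/-! ### One trial: the search from a pair of roots and its outcome -/

namespace RAM

section Verification

variable {n : ℕ} {G : SimpleGraph (Fin n)} {g : Fin n → ℕ}
  {N b B ε : ℕ} {ρ m : Fin n} {S : Search (Fin n)} {s : State}

/-- Register `2` holds the root at which the search starts. -/
def startProgram (ε : ℕ) : Program :=
  .seq (forLoop 4 (.seq (.store (arr 1 (.reg 4)) (.const 0)) (.store (arr 2 (.reg 4)) (.reg 4)))) <|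
  .seq (.store (arr 3 (.reg 2)) (.const 0)) <|
  .seq (.store (arr 4 (.reg 2)) (.mul (.const ε) (.cell (arr 0 (.reg 2))))) <|
  .seq (.set 8 (.const 0)) <|
  .store (arr 1 (.reg 2)) (.const 1)

theorem ensures_startProgram (hN : Suffices g N b B) (hε : ε ≤ 1) (hs : s.Bounded b)
    (hG : HasGraph G g s) (h2 : s.reg 2 = ρ) :
    Ensures N b (startProgram ε) s fun s' => HasGraph G g s' ∧ HasSearch (.init g ε ρ) s' := by
  have hb := hN.one_le
  have hpow := Nat.one_lt_two_pow (n := b) (by omega)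
  have hlow : ε * g ρ < 2 ^ b := by
    refine lt_of_le_of_lt ((Nat.mul_le_mul hε (hN.val_le ρ)).trans ?_) hN.mul_lt
    exact Nat.mul_le_mul_right _ (Nat.zero_lt_of_lt ρ.2)
  refine Ensures.seq (Ensures.and_reg_eq (r := 2) (Ensures.forLoop (Inv := fun i s =>
      HasGraph G g s ∧ ∀ v : Fin n, (v : ℕ) < i →
        s.mem (addr n 1 v) = 0 ∧ s.mem (addr n 2 v) = v)
    hb hs hN.card_le hN.card_lt (by norm_num) rfl rfl hG.card (fun i s x h => ?_) ⟨hG, by simp⟩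
    fun i hi s hs hn h4 h => ?_) rfl) fun s₁ hs h => ?_
  · exact ⟨h.1.setReg (by norm_num) (by norm_num) x, h.2⟩
  · obtain ⟨hG, h⟩ := h
    refine Ensures.seq_store hb hs (hG.eval_arr (j := 1) (e := .reg 4) h4) (x := 0) rfl
      (by omega) fun hs => ?_
    replace hG := hG.setMem (j := 1) (by norm_num) ⟨i, hi⟩ 0
    have e2 : (arr 2 (.reg 4)).eval _ = _ := hG.eval_arr (j := 2) (e := .reg 4) (v := i) h4
    have e4 : (Expr.reg 4).eval (s.setMem (addr n 1 i) 0) = i := h4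
    refine Ensures.store hb hs (by rw [e4]; exact hi.trans hN.card_lt) ?_
    rw [e2, e4]
    refine ⟨hG.setMem (by norm_num) ⟨i, hi⟩ i, fun v hv => ?_⟩
    simp only [State.setMem_mem, addr_inj v.2 hi]
    by_cases hvi : (v : ℕ) = i
    · simp [hvi]
    · simpa [hvi] using h v (by omega)
  obtain ⟨h2', hG, hcl⟩ := h
  rw [h2] at h2'
  refine Ensures.seq_store hb hs (hG.eval_arr (j := 3) (e := .reg 2) h2') (x := 0) rfl
    (by omega) fun hs => ?_
  replace hG := hG.setMem (j := 3) (by norm_num) ρ 0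
  refine Ensures.seq_store hb hs (hG.eval_arr (j := 4) (e := .reg 2) h2') (x := ε * g ρ) ?_
    hlow fun hs => ?_
  · rw [Expr.eval_mul, hG.eval_val (e := .reg 2) (v := ρ) h2', Expr.eval_const]
  replace hG := hG.setMem (j := 4) (by norm_num) ρ (ε * g ρ)
  refine Ensures.seq_set hb hs (x := 0) rfl (by omega) fun hs => ?_
  replace hG := hG.setReg (r := 8) (by norm_num) (by norm_num) 0
  have e1 : (arr 1 (.reg 2)).eval _ = _ := hG.eval_arr (j := 1) (e := .reg 2) (v := ρ)
    (by simpa [State.setReg_reg] using h2')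
  refine Ensures.store hb hs (by rw [Expr.eval_const]; exact hpow) ?_
  rw [e1]
  refine ⟨hG.setMem (by norm_num) ρ _, fun w => ?_, fun w => ?_, fun w hw => ?_, fun w hw => ?_, ?_⟩
  · simp only [State.setMem_mem, State.setReg_mem, addr_eq_iff, Search.init, Finset.mem_singleton]
    by_cases hw : w = ρ
    · simp [hw]
    · simpa [hw] using (hcl w w.2).1
  · simp only [State.setMem_mem, State.setReg_mem, addr_eq_iff, Search.init]
    simpa using (hcl w w.2).2
  · obtain rfl := Finset.mem_singleton.1 hw
    simp [State.setMem_mem, addr_eq_iff, Search.init]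
  · obtain rfl := Finset.mem_singleton.1 hw
    simp [State.setMem_mem, addr_eq_iff, Search.init]
  · simp [State.setReg_reg, Search.init]

/-- Register `3` holds the vertex at which the search continues, unless it has found it before. -/
def addRootProgram : Program :=
  .ite (.cell (arr 1 (.reg 3))) .skip <|
  .seq (.store (arr 3 (.reg 3)) (.cell (arr 0 (.reg 3)))) <|
  .seq (.store (arr 4 (.reg 3)) (.const 0)) <|
  .seq (.set 8 (.add (.reg 8) (.cell (arr 0 (.reg 3))))) <|
  .store (arr 1 (.reg 3)) (.const 1)

theorem ensures_addRootProgram (hN : Suffices g N b B) (hs : s.Bounded b)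
    (hG : HasGraph G g s) (hS : HasSearch S s) (hF : S.IsForest G g ε ρ m)
    (hcl : Search.Closed G g S.M) (h3 : s.reg 3 = m) (hm : 0 < g m) :
    Ensures N b addRootProgram s fun s' => HasGraph G g s' ∧
      ∃ S' : Search (Fin n), HasSearch S' s' ∧ S'.IsForest G g ε ρ m ∧ m ∈ S'.M := by
  have hb := hN.one_le
  have hpow := Nat.one_lt_two_pow (n := b) (by omega)
  have hmark := hG.eval_cell (j := 1) (e := .reg 3) h3
  rw [hS.mark] at hmark
  refine Ensures.ite hb hs (fun h => ?_) fun h => ?_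
  · refine Ensures.skip hs ⟨hG, S, hS, hF, ?_⟩
    by_contra hmS
    rw [hmark, if_neg hmS] at h
    exact h rfl
  have hmS : m ∉ S.M := fun hmS => by rw [hmark, if_pos hmS] at h; exact one_ne_zero h
  have hF' := hF.addRoot hcl hmS hm
  have htot : S.total + g m < 2 ^ b := by
    have := hF'.total_le hN.val_le
    rw [Fintype.card_fin] at this
    exact lt_of_le_of_lt this hN.mul_lt
  refine Ensures.seq_store hb hs (hG.eval_arr (j := 3) (e := .reg 3) h3) (x := g m)
    (hG.eval_val (e := .reg 3) h3) (by omega) fun hs => ?_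
  replace hG := hG.setMem (j := 3) (by norm_num) m (g m)
  refine Ensures.seq_store hb hs (hG.eval_arr (j := 4) (e := .reg 3) h3) (x := 0) rfl
    (by omega) fun hs => ?_
  replace hG := hG.setMem (j := 4) (by norm_num) m 0
  refine Ensures.seq_set hb hs (x := S.total + g m) ?_ htot fun hs => ?_
  · rw [Expr.eval_add, hG.eval_val (e := .reg 3) (v := m) h3, Expr.eval_reg]
    simp [hS.total]
  replace hG := hG.setReg (r := 8) (by norm_num) (by norm_num) (S.total + g m)
  have e1 : (arr 1 (.reg 3)).eval _ = _ := hG.eval_arr (j := 1) (e := .reg 3) (v := m)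
    (by simpa [State.setReg_reg] using h3)
  refine Ensures.store hb hs (by rw [Expr.eval_const]; exact hpow) ?_
  rw [e1]
  refine ⟨hG.setMem (by norm_num) m _, S.addRoot g m, ⟨fun w => ?_, fun w => ?_, fun w hw => ?_,
    fun w hw => ?_, ?_⟩, hF', Finset.mem_insert_self _ _⟩
  all_goals simp only [Search.addRoot, Finset.mem_insert] at *
  · simp only [State.setMem_mem, State.setReg_mem, addr_eq_iff, hS.mark, Expr.eval_const]
    by_cases hw : w = m <;> simp [hw]
  · simp [State.setMem_mem, addr_eq_iff, hS.par]
  · simp only [State.setMem_mem, State.setReg_mem, addr_eq_iff, Function.update_apply]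
    by_cases hwm : w = m
    · simp [hwm]
    · simp [hwm, hS.rise w (hw.resolve_left hwm)]
  · simp only [State.setMem_mem, State.setReg_mem, addr_eq_iff, Function.update_apply]
    by_cases hwm : w = m
    · simp [hwm]
    · simp [hwm, hS.low w (hw.resolve_left hwm)]
  · simp [State.setReg_reg]

/-- Register `9` is set to `0` if the value of the expression is not `0`. -/
def test (e : Expr) : Program := .ite e (.set 9 (.const 0)) .skip

/-- The memory holds the graph and the search, and register `9` the truth value of a proposition. -/
def Checked (G : SimpleGraph (Fin n)) (g : Fin n → ℕ) (S : Search (Fin n)) (A : Prop) (s : State) :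
    Prop :=
  HasGraph G g s ∧ HasSearch S s ∧ (A → s.reg 9 = 1) ∧ (¬ A → s.reg 9 = 0)

theorem Checked.setReg {A : Prop} (h : Checked G g S A s) {r : ℕ} (h0 : r ≠ 0) (h1 : r ≠ 1)
    (h8 : r ≠ 8) (h9 : r ≠ 9) (x : ℕ) : Checked G g S A (s.setReg r x) := by
  refine ⟨h.1.setReg h0 h1 x, h.2.1.setReg h8 x, ?_⟩
  rw [State.setReg_reg, if_neg h9.symm]
  exact h.2.2

theorem Checked.congr {A A' : Prop} (h : Checked G g S A s) (hA : A ↔ A') :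
    Checked G g S A' s := by
  rwa [← propext hA]

theorem ensures_test (hb : 1 ≤ b) (hs : s.Bounded b) {A A' : Prop} (h : Checked G g S A s)
    {e : Expr} (he : e.eval s = 0 ↔ A') : Ensures N b (test e) s (Checked G g S (A ∧ A')) := by
  have hpow := Nat.two_pow_pos b
  refine Ensures.ite hb hs (fun h' => ?_) fun h' => ?_
  · refine Ensures.set hb hs (by simp) ⟨h.1.setReg (by norm_num) (by norm_num) _,
      h.2.1.setReg (by norm_num) _, fun hA => ?_, fun _ => ?_⟩
    · exact absurd (he.2 hA.2) h'
    · simp [State.setReg_reg]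
  · exact Ensures.skip hs (h.congr (by simp [he.1 h']))

/-- Decides in register `9` whether the search forest is accepting. -/
def checkProgram : Program :=
  .seq (.set 9 (.const 1)) <|
  .seq (forLoop 5 <|
    .seq (test (.mul (.cell (arr 0 (.reg 5))) (.sub (.const 1) (.cell (arr 1 (.reg 5)))))) <|
    forLoop 6 <| test <|
      .mul (.mul (.mul (.cell (arr 0 (.reg 5))) (.cell (arr 0 (.reg 6)))) (adjCell (.reg 5) (.reg 6)))
        (.mul (diff (.cell (arr 2 (.reg 5))) (.reg 6)) (diff (.cell (arr 2 (.reg 6))) (.reg 5)))) <|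
  .seq (test (diff (.cell (arr 3 (.reg 3))) (.reg 8))) <|
  test (.sub (.add (.cell (arr 3 (.reg 3))) (.cell (arr 4 (.reg 3)))) (.cell (arr 0 (.reg 3))))

theorem ensures_checkProgram (hN : Suffices g N b B) (hs : s.Bounded b)
    (hG : HasGraph G g s) (hS : HasSearch S s) (hmS : m ∈ S.M) (h3 : s.reg 3 = m) :
    Ensures N b checkProgram s (Checked G g S (S.Accepts G g m)) := by
  have hb := hN.one_le
  have hpow := Nat.one_lt_two_pow (n := b) (by omega)
  refine Ensures.seq_set hb hs (x := 1) rfl hpow fun hs => ?_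
  have h : Checked G g S True (s.setReg 9 1) :=
    ⟨hG.setReg (by norm_num) (by norm_num) 1, hS.setReg (by norm_num) 1,
      fun _ => by simp [State.setReg_reg], fun h => absurd trivial h⟩
  set L : Fin n → Prop := fun u => (0 < g u → u ∈ S.M) ∧
    ∀ v, 0 < g u → 0 < g v → G.Adj u v → S.par u = v ∨ S.par v = u with hL
  have hloop : ∀ s : State, s.Bounded b → s.reg 1 = n → Checked G g S True s →
      Ensures N b (forLoop 5 <|
        .seq (test (.mul (.cell (arr 0 (.reg 5))) (.sub (.const 1) (.cell (arr 1 (.reg 5)))))) <|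
        forLoop 6 <| test <|
          .mul (.mul (.mul (.cell (arr 0 (.reg 5))) (.cell (arr 0 (.reg 6))))
            (adjCell (.reg 5) (.reg 6))) (.mul (diff (.cell (arr 2 (.reg 5))) (.reg 6))
            (diff (.cell (arr 2 (.reg 6))) (.reg 5)))) s
        (Checked G g S (∀ u, L u)) := by
    intro s hs hn h
    refine (Ensures.forLoop (Inv := fun i => Checked G g S (∀ u : Fin n, (u : ℕ) < i → L u)) hb hs
      hN.card_le hN.card_lt (by norm_num) rfl rfl hn
      (fun i s x h => h.setReg (by norm_num) (by norm_num) (by norm_num) (by norm_num) x)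
      (h.congr (by simp)) fun i hi s hs hn h5 h => ?_).mono fun s' _ h => h.congr ?_
    · set u : Fin n := ⟨i, hi⟩ with hu
      refine Ensures.seq (Ensures.and_reg_eq (r := 1) (Ensures.and_reg_eq (r := 5)
        (ensures_test hb hs h (A' := 0 < g u → u ∈ S.M) ?_) rfl) rfl) fun s' hs' h' => ?_
      · rw [Expr.eval_mul, Expr.eval_sub, h.1.eval_val (e := .reg 5) (v := u) h5,
          h.1.eval_cell (e := .reg 5) (v := u) h5, h.2.1.mark, Nat.pos_iff_ne_zero]
        by_cases hu : u ∈ S.M <;> simp [hu]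
      obtain ⟨h1', h5', h⟩ := h'
      rw [h5] at h5'
      rw [hn] at h1'
      refine (Ensures.forLoop (Inv := fun j s => s.reg 5 = i ∧ Checked G g S
          (((∀ u : Fin n, (u : ℕ) < i → L u) ∧ (0 < g u → u ∈ S.M)) ∧ ∀ v : Fin n, (v : ℕ) < j →
            0 < g u → 0 < g v → G.Adj u v → S.par u = v ∨ S.par v = u) s) hb hs'
        hN.card_le hN.card_lt (by norm_num) rfl rfl h1' (fun i s x h => ⟨?_, h.2.setReg (by norm_num)
          (by norm_num) (by norm_num) (by norm_num) x⟩)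
        ⟨h5', h.congr (by simp)⟩ fun j hj s hs hn h6 h => ?_).mono fun s' _ h => h.2.congr ?_
      · rw [State.setReg_reg, if_neg (by norm_num)]; exact h.1
      · obtain ⟨h5, h⟩ := h
        set v : Fin n := ⟨j, hj⟩ with hv
        refine ((ensures_test hb hs h (A' := 0 < g u → 0 < g v → G.Adj u v →
          S.par u = v ∨ S.par v = u) ?_).and_reg_eq (r := 5) rfl).mono fun s' _ h =>
            ⟨h.1.trans h5, h.2.congr ?_⟩
        · rw [Expr.eval_mul, Expr.eval_mul, Expr.eval_mul, Expr.eval_mul,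
            h.1.eval_val (e := .reg 5) (v := u) h5, h.1.eval_val (e := .reg 6) (v := v) h6,
            mul_eq_zero, mul_eq_zero, mul_eq_zero, mul_eq_zero, diff_eval, diff_eval,
            h.1.eval_cell (e := .reg 5) (v := u) h5, h.1.eval_cell (e := .reg 6) (v := v) h6,
            h.2.1.par, h.2.1.par, Expr.eval_reg, Expr.eval_reg, h5, h6,
            ← not_ne_iff (a := (adjCell _ _).eval s),
            h.1.eval_adjCell (e := .reg 5) (e' := .reg 6) (u := u) (v := v) h5 h6]
          change ((_ ∨ _) ∨ _) ∨ ((S.par u : ℕ) = (v : ℕ) ∨ (S.par v : ℕ) = (u : ℕ)) ↔ _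
          rw [← Fin.ext_iff, ← Fin.ext_iff, Nat.pos_iff_ne_zero, Nat.pos_iff_ne_zero]
          tauto
        · rw [and_assoc (b := ∀ v : Fin n, (v : ℕ) < j → _)]
          refine and_congr_right fun _ => ⟨fun H w hw => ?_, fun H => ⟨fun w hw => H w (by omega),
            H v (Nat.lt_succ_self _)⟩⟩
          rcases Nat.lt_succ_iff_lt_or_eq.1 hw with h | h
          · exact H.1 w h
          · have : w = v := Fin.ext h
            exact this ▸ H.2
      · refine ⟨fun H w hw => ?_, fun H => ⟨⟨fun w hw => H w (by omega), (H u (Nat.lt_succ_self _)).1⟩,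
          fun v _ => (H u (Nat.lt_succ_self _)).2 v⟩⟩
        rcases Nat.lt_succ_iff_lt_or_eq.1 hw with h | h
        · exact H.1.1 w h
        · have : w = u := Fin.ext h
          exact this ▸ ⟨H.1.2, fun v => H.2 v v.2⟩
    · exact ⟨fun H u => H u u.2, fun H u _ => H u⟩
  have h3' : (s.setReg 9 1).reg 3 = m := by rw [State.setReg_reg, if_neg (by norm_num), h3]
  refine Ensures.seq (Ensures.and_reg_eq (r := 3) (hloop _ hs h.1.card h) rfl) fun s₁ hs h => ?_
  obtain ⟨h3₁, h⟩ := h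
  rw [h3'] at h3₁
  refine Ensures.seq (Ensures.and_reg_eq (r := 3)
    (ensures_test hb hs h (A' := S.rise m = S.total) ?_) rfl) fun s₂ hs h => ?_
  · rw [diff_eval, h.1.eval_cell (e := .reg 3) (v := m) h3₁, h.2.1.rise m hmS, Expr.eval_reg,
      h.2.1.total]
  obtain ⟨h3₂, h⟩ := h
  rw [h3₁] at h3₂
  refine (ensures_test hb hs h (A' := S.rise m + S.low m ≤ g m) ?_).mono fun s' _ h => h.congr ?_
  · rw [Expr.eval_sub, Expr.eval_add, h.1.eval_cell (e := .reg 3) (v := m) h3₂, h.2.1.rise m hmS,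
      h.1.eval_cell (e := .reg 3) (v := m) h3₂, h.2.1.low m hmS,
      h.1.eval_val (e := .reg 3) (v := m) h3₂, Nat.sub_eq_zero_iff_le]
  · exact ⟨fun H => ⟨fun u => (H.1.1 u).1, fun u v hu hv huv => (H.1.1 u).2 v hu hv huv, H.1.2, H.2⟩,
      fun H => ⟨⟨fun u => ⟨H.mem u, fun v hu hv huv => H.edge u v hu hv huv⟩, H.rise_eq_total⟩,
        H.rise_add_low_le⟩⟩

/-- Searches from the vertices in registers `2` and `3`, and sets register `7` to `1` if the search
forest is accepting. -/
def trialProgram (ε : ℕ) : Program :=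
  .seq (startProgram ε) <| .seq searchProgram <| .seq addRootProgram <| .seq searchProgram <|
  .seq checkProgram <| .ite (.reg 9) (.set 7 (.const 1)) .skip

theorem ensures_trialProgram (hN : Suffices g N b B) (hε : ε ≤ 1) (hs : s.Bounded b)
    (hG : HasGraph G g s) (h2 : s.reg 2 = ρ) (h3 : s.reg 3 = m) (hρ : 0 < g ρ) (hm : 0 < g m) :
    Ensures N b (trialProgram ε) s fun s' => HasGraph G g s' ∧ ∃ S : Search (Fin n),
      S.IsForest G g ε ρ m ∧ m ∈ S.M ∧ Search.Closed G g S.M ∧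
      (S.Accepts G g m → s'.reg 7 = 1) ∧ (¬ S.Accepts G g m → s'.reg 7 = s.reg 7) := by
  have hb := hN.one_le
  have hpow := Nat.one_lt_two_pow (n := b) (by omega)
  refine Ensures.seq (((ensures_startProgram hN hε hs hG h2).and_reg_eq (r := 3) rfl).and_reg_eq
    (r := 7) rfl) fun s₁ hs h => ?_
  obtain ⟨g7, g3, hG, hS⟩ := h
  refine Ensures.seq (((ensures_searchProgram hN hs hG hS
    (Search.isForest_init (m := m) hρ)).and_reg_eq (r := 3) rfl).and_reg_eq (r := 7) rfl)
    fun s₂ hs h => ?_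
  obtain ⟨g7₂, g3₂, hG, S₂, hS, hF, -, hcl⟩ := h
  rw [g3, h3] at g3₂
  refine Ensures.seq (((ensures_addRootProgram hN hs hG hS hF hcl g3₂ hm).and_reg_eq (r := 3)
    rfl).and_reg_eq (r := 7) rfl) fun s₃ hs h => ?_
  obtain ⟨g7₃, g3₃, hG, S₃, hS, hF, hmS⟩ := h
  refine Ensures.seq (((ensures_searchProgram hN hs hG hS hF).and_reg_eq (r := 3) rfl).and_reg_eq
    (r := 7) rfl) fun s₄ hs h => ?_
  obtain ⟨g7₄, g3₄, hG, S₄, hS, hF, hsub, hcl⟩ := h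
  refine Ensures.seq ((ensures_checkProgram hN hs hG hS (hsub hmS)
    (g3₄.trans (g3₃.trans g3₂))).and_reg_eq (r := 7) rfl) fun s₅ hs h => ?_
  obtain ⟨g7₅, hG, hS, hpos, hneg⟩ := h
  have h7 : s₅.reg 7 = s.reg 7 := by rw [g7₅, g7₄, g7₃, g7₂, g7]
  refine Ensures.ite hb hs (fun h => ?_) fun h => ?_
  · refine Ensures.set hb hs (by rw [Expr.eval_const]; exact hpow)
      ⟨hG.setReg (by norm_num) (by norm_num) _, S₄, hF, hsub hmS, hcl, fun _ => ?_, fun hA => ?_⟩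
    · simp [State.setReg_reg]
    · exact absurd (hneg hA) h
  · refine Ensures.skip hs ⟨hG, S₄, hF, hsub hmS, hcl, fun hA => ?_, fun _ => h7⟩
    rw [Expr.eval_reg, hpos hA] at h
    exact absurd h one_ne_zero

end Verification

end RAM

/-! ### The decision program -/

namespace RAM

/-- A power of the value of an expression. -/
def Expr.pow (e : Expr) : ℕ → Expr
  | 0 => .const 1
  | q + 1 => .mul (e.pow q) e

theorem Expr.eval_pow (s : State) (e : Expr) (q : ℕ) : (e.pow q).eval s = e.eval s ^ q := by
  induction q with
  | zero => rfl
  | succ q ih => rw [Expr.pow, eval_mul, ih, pow_succ]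

section Verification

variable {n : ℕ}

/-- The memory holds an encoded instance. -/
structure HasInput (G : SimpleGraph (Fin n)) (num den : Fin n → ℕ) (s : State) : Prop where
  length : s.reg 0 = inputLength n
  card : s.mem 0 = n
  adj : ∀ u v : Fin n, G.Adj u v → s.mem (1 + ((u : ℕ) * n + v)) = 1
  not_adj : ∀ u v : Fin n, ¬ G.Adj u v → s.mem (1 + ((u : ℕ) * n + v)) = 0
  num : ∀ v : Fin n, s.mem (1 + (n * n + v)) = num v
  den : ∀ v : Fin n, s.mem (1 + n * n + (n + v)) = den v

/-- The numerator of the value at `v` with respect to the product of all denominators. -/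
def commonNum (num den : Fin n → ℕ) (v : Fin n) : ℕ := num v * ∏ w ∈ Finset.univ.erase v, den w

variable {G : SimpleGraph (Fin n)} {num den g : Fin n → ℕ} {N b B ε q : ℕ} {s : State}

theorem HasInput.setReg (h : HasInput G num den s) {r : ℕ} (h0 : r ≠ 0) (x : ℕ) :
    HasInput G num den (s.setReg r x) := by
  refine ⟨?_, h.card, h.adj, h.not_adj, h.num, h.den⟩
  rw [State.setReg_reg, if_neg h0.symm, h.length]

theorem HasInput.setMem (h : HasInput G num den s) (j : ℕ) (v : Fin n) (x : ℕ) :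
    HasInput G num den (s.setMem (addr n j v) x) := by
  have ne : ∀ a, a < inputLength n → a ≠ addr n j v := fun a ha => by
    unfold addr
    omega
  have hn := v.2
  refine ⟨h.length, ?_, fun u w huw => ?_, fun u w huw => ?_, fun w => ?_, fun w => ?_⟩
  · rw [State.setMem_mem, if_neg (ne _ (by unfold inputLength; omega)), h.card]
  · rw [State.setMem_mem, if_neg (adj_address_ne u w j v), h.adj u w huw]
  · rw [State.setMem_mem, if_neg (adj_address_ne u w j v), h.not_adj u w huw]
  · rw [State.setMem_mem, if_neg (ne _ (by unfold inputLength; omega)), h.num]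
  · rw [State.setMem_mem, if_neg (ne _ (by unfold inputLength; omega)), h.den]

/-- Stores the `q`-th power of `commonNum` for the vertex in register `2`. -/
def valueProgram (q : ℕ) : Program :=
  .seq (.set 4 (.cell (.add (.const 1) (.add (.mul (.reg 1) (.reg 1)) (.reg 2))))) <|
  .seq (forLoop 3 <| .ite (diff (.reg 2) (.reg 3)) (.set 4 (.mul (.reg 4)
    (.cell (.add (.add (.const 1) (.mul (.reg 1) (.reg 1))) (.add (.reg 1) (.reg 3)))))) .skip) <|
  .store (arr 0 (.reg 2)) ((Expr.reg 4).pow q)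

theorem ensures_valueProgram (hden : ∀ v, 0 < den v) (hb : 1 ≤ b) (hnN : n ≤ N) (hnb : n < 2 ^ b)
    (hnum : ∀ v, commonNum num den v < 2 ^ b) (hpow : ∀ v, commonNum num den v ^ q < 2 ^ b)
    (hs : s.Bounded b) (h1 : s.reg 1 = n) {v : Fin n} (h2 : s.reg 2 = v)
    (hI : HasInput G num den s) :
    Ensures N b (valueProgram q) s fun s' => HasInput G num den s' ∧
      (∀ w : Fin n, w ≠ v → s'.mem (addr n 0 w) = s.mem (addr n 0 w)) ∧
      s'.mem (addr n 0 v) = commonNum num den v ^ q := by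
  set pr : ℕ → ℕ := fun j =>
    num v * ∏ w ∈ (Finset.univ.erase v).filter (fun w : Fin n => (w : ℕ) < j), den w with hpr
  have hprle : ∀ j, pr j < 2 ^ b := fun j => by
    refine lt_of_le_of_lt (Nat.mul_le_mul_left _ ?_) (hnum v)
    exact Finset.prod_le_prod_of_subset_of_one_le' (Finset.filter_subset _ _) fun w _ _ => hden w
  have hpr0 : pr 0 = num v := by simp [hpr]
  have hprn : pr n = commonNum num den v := by
    simp [hpr, commonNum]
  refine Ensures.seq_set hb hs (x := pr 0) ?_ (hprle 0) fun hs => ?_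
  · rw [hpr0, ← hI.num v]
    simp only [Expr.eval, h1, h2]
  have h1' : (s.setReg 4 (pr 0)).reg 1 = n := by rw [State.setReg_reg, if_neg (by norm_num), h1]
  refine Ensures.seq (Ensures.and_reg_eq (r := 1) (Ensures.forLoop (Inv := fun j s' =>
    HasInput G num den s' ∧ s'.reg 2 = v ∧ s'.reg 4 = pr j ∧
      ∀ w : Fin n, s'.mem (addr n 0 w) = s.mem (addr n 0 w)) (r := 3) hb hs hnN hnb
      (by norm_num) rfl rfl h1' (fun j s' x h => ?_) ⟨hI.setReg (by norm_num) _, ?_, ?_,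
        fun w => rfl⟩ fun j hj s' hs hn h3 h => ?_) rfl) fun s' hs h => ?_
  · refine ⟨h.1.setReg (by norm_num) x, ?_⟩
    rw [State.setReg_reg, State.setReg_reg, if_neg (by norm_num), if_neg (by norm_num)]
    exact h.2
  · rw [State.setReg_reg, if_neg (by norm_num), h2]
  · simp [State.setReg_reg]
  · obtain ⟨hI, h2, h4, hmem⟩ := h
    -- The denominator of `v` itself is left out.
    have hstep : pr (j + 1) = if (v : ℕ) = j then pr j else pr j * den ⟨j, hj⟩ := by
      have hset : (Finset.univ.erase v).filter (fun w : Fin n => (w : ℕ) < j + 1) =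
          if (v : ℕ) = j then (Finset.univ.erase v).filter (fun w : Fin n => (w : ℕ) < j) else
          insert ⟨j, hj⟩ ((Finset.univ.erase v).filter (fun w : Fin n => (w : ℕ) < j)) := by
        ext w
        split_ifs with hv <;>
          simp only [Finset.mem_filter, Finset.mem_erase, Finset.mem_univ, and_true,
            Finset.mem_insert, Fin.ext_iff, ne_eq] <;> omega
      simp only [hpr]
      rw [hset]
      split_ifs with hv
      · rfl
      · rw [Finset.prod_insert (by simp)]
        ring
    refine Ensures.ite hb hs (fun hc => ?_) fun hc => ?_
    · have hc : (v : ℕ) ≠ j := by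
        rw [Ne, diff_eval, Expr.eval_reg, Expr.eval_reg, h2, h3] at hc
        exact hc
      have hd := hI.den ⟨j, hj⟩
      have e : (Expr.mul (.reg 4) (.cell (.add (.add (.const 1) (.mul (.reg 1) (.reg 1)))
          (.add (.reg 1) (.reg 3))))).eval s' = pr (j + 1) := by
        rw [hstep, if_neg hc, ← hd]
        simp only [Expr.eval, hn, h3, h4]
      refine Ensures.set hb hs (by rw [e]; exact hprle _) ?_
      rw [e]
      refine ⟨hI.setReg (by norm_num) _, ?_, ?_, hmem⟩
      · rw [State.setReg_reg, if_neg (by norm_num), h2]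
      · simp [State.setReg_reg]
    · rw [diff_eval, Expr.eval_reg, Expr.eval_reg, h2, h3] at hc
      exact Ensures.skip hs ⟨hI, h2, by rw [hstep, if_pos hc, h4], hmem⟩
  · obtain ⟨hn, hI, h2, h4, hmem⟩ := h
    rw [h1'] at hn
    have e : ((Expr.reg 4).pow q).eval s' = commonNum num den v ^ q := by
      rw [Expr.eval_pow, Expr.eval_reg, h4, hprn]
    have ea : (arr 0 (.reg 2)).eval s' = addr n 0 v := by
      simp only [arr, Expr.eval, hI.length, hn, h2, addr]
    refine Ensures.store hb hs (by rw [e]; exact hpow v) ?_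
    rw [e, ea]
    refine ⟨hI.setMem 0 v _, fun w hw => ?_, ?_⟩
    · rw [State.setMem_mem, if_neg (by simp [addr_eq_iff, hw]), hmem]
    · rw [State.setMem_mem, if_pos rfl]

/-- Stores the values at all vertices, multiplied by a common denominator. -/
def valuesProgram (q : ℕ) : Program := forLoop 2 (valueProgram q)

theorem ensures_valuesProgram (hden : ∀ v, 0 < den v) (hb : 1 ≤ b) (hnN : n ≤ N) (hnb : n < 2 ^ b)
    (hnum : ∀ v, commonNum num den v < 2 ^ b) (hpow : ∀ v, commonNum num den v ^ q < 2 ^ b)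
    (hs : s.Bounded b) (h1 : s.reg 1 = n) (hI : HasInput G num den s) :
    Ensures N b (valuesProgram q) s (HasGraph G fun v => commonNum num den v ^ q) := by
  refine Ensures.mono (Ensures.and_reg_eq (r := 1) (Ensures.forLoop (Inv := fun i s =>
    HasInput G num den s ∧ ∀ v : Fin n, (v : ℕ) < i →
      s.mem (addr n 0 v) = commonNum num den v ^ q) hb hs hnN hnb (by norm_num) rfl rfl h1
    (fun i s x h => ⟨h.1.setReg (by norm_num) x, h.2⟩) ⟨hI, by simp⟩
    fun i hi s hs hn h2 h => ?_) rfl) fun s' _ h => ?_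
  · refine (ensures_valueProgram hden hb hnN hnb hnum hpow hs hn (v := ⟨i, hi⟩) h2 h.1).mono
      fun s' _ h' => ⟨h'.1, fun v hv => ?_⟩
    rcases Nat.lt_succ_iff_lt_or_eq.1 hv with hv | hv
    · rw [h'.2.1 v (by rintro rfl; exact absurd hv (lt_irrefl _)), h.2 v hv]
    · have hv : v = ⟨i, hi⟩ := Fin.ext hv
      rw [hv, h'.2.2]
  · exact ⟨h.2.1.length, h.1.trans h1, h.2.1.adj, h.2.1.not_adj, fun v => h.2.2 v v.2⟩

/-- The answer `x` of the program, after it has tried the pairs of roots in `T`. -/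
structure Outcome (G : SimpleGraph (Fin n)) (g : Fin n → ℕ) (ε : ℕ) (T : Fin n → Fin n → Prop)
    (x : ℕ) : Prop where
  le_one : x ≤ 1
  sound : x = 1 → (∀ v, g v = 0) ∨ ∃ ρ m, ∃ S : Search (Fin n),
    S.IsForest G g ε ρ m ∧ m ∈ S.M ∧ S.Accepts G g m
  zero : (∀ v, g v = 0) → x = 1
  complete : ∀ ρ m, T ρ m → 0 < g ρ → 0 < g m → (∀ S : Search (Fin n), S.IsForest G g ε ρ m →
    m ∈ S.M → Search.Closed G g S.M → S.Accepts G g m) → x = 1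

theorem Outcome.mono {T T' : Fin n → Fin n → Prop} {x : ℕ} (h : Outcome G g ε T x)
    (hT : ∀ a b, T' a b → T a b) : Outcome G g ε T' x :=
  ⟨h.le_one, h.sound, h.zero, fun ρ m hT' => h.complete ρ m (hT ρ m hT')⟩

/-- Sets register `7` to `1` if all values at the vertices are `0`, and to `0` otherwise. -/
def zeroProgram : Program :=
  .seq (.set 7 (.const 1)) <| forLoop 2 <| .ite (.cell (arr 0 (.reg 2))) (.set 7 (.const 0)) .skip

theorem ensures_zeroProgram (hN : Suffices g N b B) (hs : s.Bounded b) (hG : HasGraph G g s) :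
    Ensures N b zeroProgram s fun s' => HasGraph G g s' ∧
      Outcome G g ε (fun _ _ => False) (s'.reg 7) := by
  have hb := hN.one_le
  have hpow := Nat.one_lt_two_pow (n := b) (by omega)
  refine Ensures.seq_set hb hs (x := 1) rfl hpow fun hs => ?_
  have hG' : HasGraph G g (s.setReg 7 1) := hG.setReg (by norm_num) (by norm_num) 1
  refine (Ensures.forLoop (Inv := fun i s => HasGraph G g s ∧
      ((∀ v : Fin n, (v : ℕ) < i → g v = 0) → s.reg 7 = 1) ∧
      ((¬ ∀ v : Fin n, (v : ℕ) < i → g v = 0) → s.reg 7 = 0)) hb hs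
    hN.card_le hN.card_lt (by norm_num) rfl rfl hG'.card (fun i s x h => ?_)
    ⟨hG', fun _ => by simp [State.setReg_reg], by simp⟩ fun i hi s hs hn h2 h => ?_).mono
    fun s' _ h => ⟨h.1, ?_⟩
  · refine ⟨h.1.setReg (by norm_num) (by norm_num) x, ?_⟩
    rw [State.setReg_reg, if_neg (by norm_num)]
    exact h.2
  · have e := h.1.eval_val (e := .reg 2) (v := ⟨i, hi⟩) h2
    refine Ensures.ite hb hs (fun hc => ?_) fun hc => ?_
    · refine Ensures.set hb hs (by rw [Expr.eval_const]; omega)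
        ⟨h.1.setReg (by norm_num) (by norm_num) _, fun hz => ?_, fun _ => by simp [State.setReg_reg]⟩
      exact absurd (hz ⟨i, hi⟩ (Nat.lt_succ_self i)) (e ▸ hc)
    · have hiff : (∀ v : Fin n, (v : ℕ) < i + 1 → g v = 0) ↔
          ∀ v : Fin n, (v : ℕ) < i → g v = 0 := by
        refine ⟨fun H v hv => H v (by omega), fun H v hv => ?_⟩
        rcases Nat.lt_succ_iff_lt_or_eq.1 hv with hv | hv
        · exact H v hv
        · have hv : v = ⟨i, hi⟩ := Fin.ext hv
          rw [hv, ← e, hc]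
      refine Ensures.skip hs ⟨h.1, ?_⟩
      rw [hiff]
      exact h.2
  · by_cases hz : ∀ v : Fin n, (v : ℕ) < n → g v = 0
    · have h7 := h.2.1 hz
      exact ⟨h7.le, fun _ => Or.inl fun v => hz v v.2, fun _ => h7, by simp⟩
    · have h7 := h.2.2 hz
      exact ⟨by omega, fun h => by omega, fun hz' => absurd (fun v _ => hz' v) hz, by simp⟩

/-- Tries all pairs of roots. -/
def trialsProgram (ε : ℕ) : Program :=
  forLoop 2 <| forLoop 3 <|
    .ite (.mul (.cell (arr 0 (.reg 2))) (.cell (arr 0 (.reg 3)))) (trialProgram ε) .skip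

theorem ensures_trialsProgram (hN : Suffices g N b B) (hε : ε ≤ 1) (hs : s.Bounded b)
    (hG : HasGraph G g s) (h : Outcome G g ε (fun _ _ => False) (s.reg 7)) :
    Ensures N b (trialsProgram ε) s fun s' => Outcome G g ε (fun _ _ => True) (s'.reg 7) := by
  have hb := hN.one_le
  refine (Ensures.forLoop (Inv := fun i s => HasGraph G g s ∧
    Outcome G g ε (fun ρ _ => (ρ : ℕ) < i) (s.reg 7)) hb hs
    hN.card_le hN.card_lt (by norm_num) rfl rfl hG.card (fun i s x h => ?_)
    ⟨hG, h.mono (by simp)⟩ fun i hi s hs hn h2 h => ?_).mono fun s' _ h => h.2.mono fun ρ _ _ => ρ.2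
  · refine ⟨h.1.setReg (by norm_num) (by norm_num) x, ?_⟩
    rw [State.setReg_reg, if_neg (by norm_num)]
    exact h.2
  refine (Ensures.forLoop (Inv := fun j s => s.reg 2 = i ∧ HasGraph G g s ∧
    Outcome G g ε (fun ρ m => (ρ : ℕ) < i ∨ ((ρ : ℕ) = i ∧ (m : ℕ) < j)) (s.reg 7)) hb hs
    hN.card_le hN.card_lt (by norm_num) rfl rfl hn (fun i s x h => ?_)
    ⟨h2, h.1, h.2.mono (by simp)⟩ fun j hj s hs hn h3 h => ?_).mono fun s' _ h =>
      ⟨h.2.1, h.2.2.mono fun ρ m hρ => ?_⟩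
  · refine ⟨?_, h.2.1.setReg (by norm_num) (by norm_num) x, ?_⟩
    · rw [State.setReg_reg, if_neg (by norm_num), h.1]
    · rw [State.setReg_reg, if_neg (by norm_num)]
      exact h.2.2
  · obtain ⟨h2, hG, hO⟩ := h
    have hsplit : ∀ ρ m : Fin n, ((ρ : ℕ) < i ∨ ((ρ : ℕ) = i ∧ (m : ℕ) < j + 1)) →
        ((ρ : ℕ) < i ∨ ((ρ : ℕ) = i ∧ (m : ℕ) < j)) ∨ (ρ = ⟨i, hi⟩ ∧ m = ⟨j, hj⟩) := by
      intro ρ m h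
      rw [Fin.ext_iff, Fin.ext_iff]
      simp only
      omega
    have e : (Expr.mul (.cell (arr 0 (.reg 2))) (.cell (arr 0 (.reg 3)))).eval s =
        g ⟨i, hi⟩ * g ⟨j, hj⟩ := by
      rw [Expr.eval_mul, hG.eval_val (e := .reg 2) (v := ⟨i, hi⟩) h2,
        hG.eval_val (e := .reg 3) (v := ⟨j, hj⟩) h3]
    refine Ensures.ite hb hs (fun hc => ?_) fun hc => ?_
    · rw [e, mul_ne_zero_iff, ← Nat.pos_iff_ne_zero, ← Nat.pos_iff_ne_zero] at hc
      refine ((ensures_trialProgram hN hε hs hG (ρ := ⟨i, hi⟩) (m := ⟨j, hj⟩) h2 h3 hc.1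
        hc.2).and_reg_eq (r := 2) rfl).mono fun s' _ h => ⟨h.1.trans h2, h.2.1, ?_⟩
      obtain ⟨-, -, S, hF, hmS, hcl, hpos, hneg⟩ := h
      by_cases hA : S.Accepts G g ⟨j, hj⟩
      · have h7 := hpos hA
        exact ⟨h7.le, fun _ => Or.inr ⟨_, _, S, hF, hmS, hA⟩, fun _ => h7, fun _ _ _ _ _ _ => h7⟩
      · rw [hneg hA]
        refine ⟨hO.le_one, hO.sound, hO.zero, fun ρ m hT hρ hm H => ?_⟩
        rcases hsplit ρ m hT with hT | ⟨rfl, rfl⟩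
        · exact hO.complete ρ m hT hρ hm H
        · exact absurd (H S hF hmS hcl) hA
    · rw [e] at hc
      refine Ensures.skip hs ⟨h2, hG, hO.le_one, hO.sound, hO.zero, fun ρ m hT hρ hm H => ?_⟩
      rcases hsplit ρ m hT with hT | ⟨rfl, rfl⟩
      · exact hO.complete ρ m hT hρ hm H
      · exact absurd hc (Nat.mul_pos hρ hm).ne'
  · have := m.2
    omega

/-- The program that decides the problem: the values are replaced by their `q`-th powers, and the
search starts with the number `low = ε * g ρ` at the root `ρ`. -/
def mainProgram (ε q : ℕ) : Program :=
  .seq (.set 1 (.cell (.const 0))) <| .seq (valuesProgram q) <| .seq zeroProgram <|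
  .seq (trialsProgram ε) <| .set 0 (.reg 7)

theorem ensures_mainProgram (hden : ∀ v, 0 < den v)
    (hnum : ∀ v, commonNum num den v < 2 ^ b)
    (hN : Suffices (fun v => commonNum num den v ^ q) N b B) (hε : ε ≤ 1) (hs : s.Bounded b)
    (hI : HasInput G num den s) :
    Ensures N b (mainProgram ε q) s fun s' =>
      Outcome G (fun v => commonNum num den v ^ q) ε (fun _ _ => True) (s'.reg 0) := by
  have hb := hN.one_le
  have hpow : ∀ v, commonNum num den v ^ q < 2 ^ b := fun v =>
    lt_of_le_of_lt ((hN.val_le v).trans (Nat.le_mul_of_pos_left _ (Nat.zero_lt_of_lt v.2))) hN.mul_lt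
  refine Ensures.seq_set hb hs (x := n) hI.card hN.card_lt fun hs => ?_
  refine Ensures.seq (ensures_valuesProgram hden hb hN.card_le hN.card_lt hnum hpow hs
    (by simp [State.setReg_reg]) (hI.setReg (by norm_num) n)) fun s hs hG => ?_
  refine Ensures.seq (ensures_zeroProgram (ε := ε) hN hs hG) fun s hs h => ?_
  refine Ensures.seq (ensures_trialsProgram hN hε hs h.1 h.2) fun s hs h => ?_
  refine Ensures.set hb hs (hs.1 7) ?_
  simpa [State.setReg_reg] using h

end Verification

end RAM

/-! ### Encoded instances -/

theorem List.getElem?_flatMap_mul_add {α β : Type} {F : α → List β} {n : ℕ}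
    (hF : ∀ x, (F x).length = n) {j : ℕ} (hj : j < n) (l : List α) (i : ℕ) :
    (l.flatMap F)[i * n + j]? = l[i]?.bind fun x => (F x)[j]? := by
  induction l generalizing i with
  | nil => simp
  | cons x l ih =>
    rw [List.flatMap_cons]
    cases i with
    | zero => rw [List.getElem?_append_left (by rw [hF]; omega)]; simp
    | succ i =>
      have : (i + 1) * n + j = n + (i * n + j) := by ring
      rw [List.getElem?_append_right (by rw [hF]; omega), hF, this, Nat.add_sub_cancel_left, ih]
      simp

namespace GraphFunction

variable (I : GraphFunction)

open Classical in
/-- The adjacency matrix, row by row. -/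
noncomputable def adjList : List ℕ :=
  (List.finRange I.n).flatMap fun u =>
    (List.finRange I.n).map fun v => if I.graph.Adj u v then 1 else 0

theorem encode_eq : I.encode = I.n :: (I.adjList ++ (((List.finRange I.n).map fun v => (I.val v).num) ++
    (List.finRange I.n).map fun v => (I.val v).den)) := by
  simp [encode, adjList]

theorem length_adjList : I.adjList.length = I.n * I.n := by
  simp [adjList, List.length_flatMap]

theorem hasInput_start : RAM.HasInput I.graph (fun v => (I.val v).num) (fun v => (I.val v).den)
    (RAM.start I.encode) := by
  classical
  have hadj : ∀ u v : Fin I.n, I.adjList[(u : ℕ) * I.n + v]? =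
      some (if I.graph.Adj u v then 1 else 0) := fun u v => by
    rw [adjList, List.getElem?_flatMap_mul_add (n := I.n) (by simp) v.2]
    simp
  have hmem : ∀ u v : Fin I.n, (RAM.start I.encode).mem (1 + ((u : ℕ) * I.n + v)) =
      if I.graph.Adj u v then 1 else 0 := fun u v => by
    have hlt := RAM.mul_add_lt u.2 v.2
    rw [RAM.start, encode_eq]
    simp only [List.getD_eq_getElem?_getD]
    rw [add_comm 1, List.getElem?_cons_succ,
      List.getElem?_append_left (by rw [length_adjList]; exact hlt), hadj]
    rfl
  refine ⟨?_, ?_, fun u v h => ?_, fun u v h => ?_, fun v => ?_, fun v => ?_⟩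
  · simp only [RAM.start, encode_eq, RAM.inputLength, List.length_cons, List.length_append,
      length_adjList, List.length_map, List.length_finRange, if_true]
    omega
  · simp [RAM.start, encode_eq]
  · rw [hmem, if_pos h]
  · rw [hmem, if_neg h]
  · have hv := v.2
    rw [RAM.start, encode_eq]
    simp only [List.getD_eq_getElem?_getD]
    rw [add_comm 1, List.getElem?_cons_succ,
      List.getElem?_append_right (by rw [length_adjList]; omega), length_adjList,
      Nat.add_sub_cancel_left, List.getElem?_append_left (by simp)]
    simp
  · have hv := v.2
    rw [RAM.start, encode_eq]
    simp only [List.getD_eq_getElem?_getD]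
    rw [add_assoc, add_comm 1, List.getElem?_cons_succ,
      List.getElem?_append_right (by rw [length_adjList]; omega), length_adjList,
      Nat.add_sub_cancel_left, List.getElem?_append_right (by simp)]
    simp

theorem inputSize_encode : RAM.inputSize I.encode = I.n.size + 1 +
    (RAM.inputSize I.adjList + (∑ v, ((I.val v).num.size + 1) + ∑ v, ((I.val v).den.size + 1))) := by
  simp only [RAM.inputSize, encode_eq, List.map_cons, List.map_append, List.sum_cons,
    List.sum_append, List.map_map, Fin.sum_univ_def]
  rfl

/-- Multiplied by the product of all denominators, the values are less than `2 ^ K`, where `K` is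
the size of the input. -/
theorem commonNum_lt (v : Fin I.n) :
    RAM.commonNum (fun v => (I.val v).num) (fun v => (I.val v).den) v <
      2 ^ RAM.inputSize I.encode := by
  have h1 : ∏ w ∈ Finset.univ.erase v, (I.val w).den ≤ 2 ^ ∑ w, (I.val w).den.size := by
    rw [← Finset.prod_pow_eq_pow_sum]
    refine (Finset.prod_le_prod_of_subset_of_one_le' (Finset.erase_subset _ _) fun w _ _ =>
      (I.val w).den_pos).trans (Finset.prod_le_prod' fun w _ => (Nat.lt_size_self _).le)
  have h2 : (I.val v).num.size + 1 ≤ ∑ w, ((I.val w).num.size + 1) :=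
    Finset.single_le_sum (f := fun w => (I.val w).num.size + 1) (fun _ _ => Nat.zero_le _)
      (Finset.mem_univ v)
  have h3 : ∑ w, (I.val w).den.size ≤ ∑ w, ((I.val w).den.size + 1) :=
    Finset.sum_le_sum fun w _ => Nat.le_succ _
  have h4 := I.inputSize_encode
  calc _ ≤ (I.val v).num * 2 ^ ∑ w, (I.val w).den.size := Nat.mul_le_mul_left _ h1
    _ < 2 ^ (I.val v).num.size * 2 ^ ∑ w, (I.val w).den.size :=
      Nat.mul_lt_mul_of_pos_right (Nat.lt_size_self _) (Nat.two_pow_pos _)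
    _ ≤ _ := by
      rw [← pow_add]
      exact Nat.pow_le_pow_right (by norm_num) (by omega)

theorem le_inputSize : I.n ≤ RAM.inputSize I.encode := by
  have h : I.n ≤ ∑ v : Fin I.n, ((I.val v).num.size + 1) := by
    calc I.n = ∑ v : Fin I.n, 1 := by simp
      _ ≤ _ := Finset.sum_le_sum fun v _ => by omega
  have := I.inputSize_encode
  omega

theorem size_le_inputSize (l : List ℕ) {a : ℕ} (ha : a ∈ l) : a.size ≤ RAM.inputSize l :=
  (Nat.le_succ _).trans (List.le_sum_of_mem (List.mem_map_of_mem ha))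

theorem length_le_inputSize (l : List ℕ) : l.length ≤ RAM.inputSize l := by
  induction l with
  | nil => simp
  | cons a l ih => simp only [RAM.inputSize, List.map_cons, List.sum_cons, List.length_cons] at *; omega

theorem bounded_start (l : List ℕ) : (RAM.start l).Bounded (RAM.inputSize l) := by
  refine ⟨fun r => ?_, fun a => ?_⟩
  · simp only [RAM.start]
    split_ifs
    · exact (length_le_inputSize l).trans_lt Nat.lt_two_pow_self
    · exact Nat.two_pow_pos _
  · simp only [RAM.start, List.getD_eq_getElem?_getD]
    by_cases ha : a < l.length
    · rw [List.getElem?_eq_getElem ha, Option.getD_some]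
      exact Nat.size_le.1 (size_le_inputSize l (List.getElem_mem ha))
    · rw [List.getElem?_eq_none (not_lt.1 ha)]
      exact Nat.two_pow_pos _

theorem coe_commonNum (v : Fin I.n) :
    (RAM.commonNum (fun v => (I.val v).num) (fun v => (I.val v).den) v : ℝ) =
      (∏ w, ((I.val w).den : ℝ)) * ((I.val v : ℝ≥0) : ℝ) := by
  have hval : ((I.val v : ℝ≥0) : ℝ) = (I.val v).num / (I.val v).den := by
    rw [NNRat.cast_def]
    push_cast
    rfl
  have hd : ((I.val v).den : ℝ) ≠ 0 := Nat.cast_ne_zero.2 (I.val v).den_ne_zero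
  rw [hval, RAM.commonNum, ← Finset.mul_prod_erase _ _ (Finset.mem_univ v)]
  push_cast
  field_simp

/-! ### Correctness of the answer -/

theorem strongUcat_edgeLinear_zero {V : Type} [Fintype V] [DecidableEq V] {G : SimpleGraph V}
    {f : V → ℝ≥0} {p : ℕ∞} (hp : 1 ≤ p) (hf : ∀ v, f v = 0) :
    strongUcat p (edgeLinear G f) ≤ 2 := by
  have h0 : ∀ x, edgeLinear G f x = 0 := fun x => by simp [edgeLinear, hf]
  have h : IsStrongDecomposition p (fun i : Fin 0 => i.elim0) (edgeLinear G f) := by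
    refine ⟨fun i => i.elim0, ?_, fun J hJ => hJ.choose.elim0⟩
    cases p with
    | top => intro x; rw [h0 x]; simp
    | coe q =>
      have hq : q ≠ 0 := by rintro rfl; simp at hp
      intro x
      rw [h0 x, zero_pow hq]
      simp
  have h' : strongUcat p (edgeLinear G f) ≤ ((0 : ℕ) : ℕ∞) := sInf_le ⟨0, rfl, _, h⟩
  exact h'.trans (by simp)

end GraphFunction

/-- The answer of the program after all trials is right. -/
theorem RAM.Outcome.eq_one_iff {n : ℕ} {G : SimpleGraph (Fin n)} {g : Fin n → ℕ} {ε x : ℕ}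
    (h : RAM.Outcome G g ε (fun _ _ => True) x) {f : Fin n → ℝ≥0} {p : ℕ∞} {q : ℕ} (hq : q ≠ 0)
    (hpq : (p = q ∧ ε = 0) ∨ (p = ⊤ ∧ q = 1 ∧ ε = 1)) {D : ℝ} (hD : 0 < D)
    (hg : ∀ v, (g v : ℝ) = D * (f v : ℝ) ^ q) : x = 1 ↔ strongUcat p (edgeLinear G f) ≤ 2 := by
  refine ⟨fun hx => ?_, fun hp => ?_⟩
  · rcases h.sound hx with h0 | ⟨ρ, m, S, hF, hm, hA⟩
    · refine GraphFunction.strongUcat_edgeLinear_zero ?_ fun v => ?_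
      · rcases hpq with ⟨rfl, -⟩ | ⟨rfl, -⟩
        · exact_mod_cast Nat.one_le_iff_ne_zero.2 hq
        · exact le_top
      · have := hg v
        rw [h0, Nat.cast_zero, eq_comm, mul_eq_zero] at this
        exact NNReal.coe_eq_zero.1 (pow_eq_zero_iff hq |>.1 (this.resolve_left hD.ne'))
    · rcases hpq with ⟨rfl, rfl⟩ | ⟨rfl, rfl, rfl⟩
      · exact hF.strongUcat_le_two hm hA hq hD hg
      · exact hF.strongUcat_top_le_two hm hA hD fun v => by rw [hg, pow_one]
  · by_cases h0 : ∀ v, g v = 0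
    · exact h.zero h0
    push Not at h0
    obtain ⟨v, hv⟩ := h0
    obtain ⟨ρ, m, hρ, hm, H⟩ :=
      exists_isAccepting hq hpq hD hg ⟨v, Nat.pos_of_ne_zero hv⟩ hp
    exact h.complete ρ m trivial hρ hm fun S hF hmS hcl => H _ _ _ _ _ _ hF hmS hcl

open RAM in
theorem polyTimeDecidable_strongUcat_le_two {p : ℕ∞} {q ε : ℕ} (hq : q ≠ 0)
    (hpq : (p = q ∧ ε = 0) ∨ (p = ⊤ ∧ q = 1 ∧ ε = 1)) :
    PolyTimeDecidable GraphFunction.encode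
      (fun I : GraphFunction => strongUcat p I.toFun ≤ 2) := by
  refine ⟨mainProgram ε q, (mainProgram ε q).timePolynomial (Polynomial.C (q + 1) * Polynomial.X),
    fun I => ?_⟩
  set K := inputSize I.encode with hK
  have hb : (Polynomial.C (q + 1) * Polynomial.X).eval K = (q + 1) * K := by simp
  rw [Program.eval_timePolynomial, hb]
  have hKb : K ≤ (q + 1) * K := Nat.le_mul_of_pos_left _ (Nat.succ_pos q)
  have hpow : 2 ^ K ≤ 2 ^ ((q + 1) * K) := Nat.pow_le_pow_right (by norm_num) hKb
  have hnK : I.n < 2 ^ K := I.le_inputSize.trans_lt Nat.lt_two_pow_self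
  have hε : ε ≤ 1 := by rcases hpq with ⟨-, rfl⟩ | ⟨-, -, rfl⟩ <;> norm_num
  have hsuff : Suffices (fun v => commonNum (fun v => (I.val v).num) (fun v => (I.val v).den) v ^ q)
      K ((q + 1) * K) (2 ^ (K * q)) := by
    refine ⟨?_, I.le_inputSize, hnK.trans_le hpow, fun v => ?_, ?_⟩
    · have := I.inputSize_encode
      omega
    · rw [pow_mul]
      exact Nat.pow_le_pow_left (I.commonNum_lt v).le q
    · rw [add_mul, one_mul, add_comm, pow_add, mul_comm q]
      exact Nat.mul_lt_mul_of_pos_right hnK (Nat.two_pow_pos _)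
  have hstart : (start I.encode).Bounded ((q + 1) * K) :=
    ⟨fun r => ((GraphFunction.bounded_start _).1 r).trans_le hpow,
      fun a => ((GraphFunction.bounded_start _).2 a).trans_le hpow⟩
  obtain ⟨t, s, hrun, ht, -, hs⟩ := ensures_mainProgram (fun v => (I.val v).den_pos)
    (fun v => (I.commonNum_lt v).trans_le hpow) hsuff hε hstart I.hasInput_start
  have hiff := hs.eq_one_iff (f := fun v => (I.val v : ℝ≥0)) hq hpq
    (D := (∏ w, ((I.val w).den : ℝ)) ^ q)
    (pow_pos (Finset.prod_pos fun w _ => Nat.cast_pos.2 (I.val w).den_pos) q)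
    fun v => by rw [Nat.cast_pow, I.coe_commonNum, mul_pow]
  refine ⟨t, s, hrun, ht, hiff.2, fun hno => ?_⟩
  have h1 : s.reg 0 ≠ 1 := fun h => hno (hiff.1 h)
  have := hs.le_one
  omega

theorem theorem4p4 (p : ℕ∞) (hp : 1 ≤ p) :
    RAM.PolyTimeDecidable GraphFunction.encode
      (fun I : GraphFunction => strongUcat p I.toFun ≤ 2) := by
  cases p with
  | top => exact polyTimeDecidable_strongUcat_le_two one_ne_zero (Or.inr ⟨rfl, rfl, rfl⟩)
  | coe q =>
    have hq : q ≠ 0 := by rintro rfl; simp at hp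
    exact polyTimeDecidable_strongUcat_le_two hq (Or.inl ⟨rfl, rfl⟩)
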